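/- Let $\mathbb D=\{|z|<1\}$ and $\mathbb T=\{|z|=1\}$. Let $\varphi$ be a nonconstant meromorphic function on $\mathbb C$ with no pole on the closed unit disk $\overline{\mathbb D}$. For $\eta\in\mathbb T$ let $N(\varphi-\varphi(\eta),\mathbb T)$ denote the cardinality of the set $\{w\in\mathbb T:\varphi(w)-\varphi(\eta)=0\}$, and put $N(\varphi)=\min\{N(\varphi-\varphi(\eta),\mathbb T):\eta\in\mathbb T\}$. Let $b(\varphi)$ (the Cowen–Thomson order of $\varphi$) denote the maximum of the orders of the nonconstant finite Blaschke products $B$ for which there is a bounded holomorphic function $\psi$ on $\mathbb D$ with $\varphi=\psi\circ B$ on $\mathbb D$; here a finite Blaschke product of order $n$ is a function $B(z)=c\prod_{i=1}^n\frac{z-a_i}{1-\overline{a_i}z}$ with $|c|=1$ and $a_1,\dots,a_n\in\mathbb D$. Then there is a countable set $E$ such that $$N(\varphi-\varphi(\xi),\mathbb T)=b(\varphi)\qquad\text{for every }\xi\in\mathbb T\setminus E.$$ Furthermore, $N(\varphi)=b(\varphi)$. -/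

import Mathlib

open Set Metric

/-- Meromorphic functions on `ℂ` without a pole on the closed unit disk. Such a function is
represented by a total function `ℂ → ℂ`, whose values on a discrete closed set outside the closed
disk (for example at the poles) are immaterial; at the points of the closed disk the function is
holomorphic, with its true values. -/
def IsMeromorphicHolClosedDisk (φ : ℂ → ℂ) : Prop :=
  Meromorphic φ ∧ ∀ z ∈ closedBall (0 : ℂ) 1, AnalyticAt ℂ φ z

/-- A function is constant as a meromorphic function on `ℂ`: it has a constant value off a closed
discrete set. -/
def IsConstantMeromorphic (φ : ℂ → ℂ) : Prop :=
  ∃ c : ℂ, ∀ᶠ z in Filter.codiscrete ℂ, φ z = c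

/-- `B` is, on the open unit disk, a finite Blaschke product of order `n`. -/
def IsFiniteBlaschke (n : ℕ) (B : ℂ → ℂ) : Prop :=
  ∃ (c : ℂ) (a : Fin n → ℂ), ‖c‖ = 1 ∧ (∀ i, a i ∈ ball (0 : ℂ) 1) ∧
    ∀ z ∈ ball (0 : ℂ) 1, B z = c * ∏ i, (z - a i) / (1 - (starRingEnd ℂ) (a i) * z)

/-- `ψ` is, on the open unit disk, a bounded holomorphic function. -/
def IsHInfty (ψ : ℂ → ℂ) : Prop :=
  DifferentiableOn ℂ ψ (ball (0 : ℂ) 1) ∧ ∃ M : ℝ, ∀ z ∈ ball (0 : ℂ) 1, ‖ψ z‖ ≤ M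

/-- The orders of the (nonconstant) finite Blaschke products `B` through which `φ` factors on the
open unit disk as `φ = ψ ∘ B` with `ψ` bounded and holomorphic on the open unit disk. A Blaschke
product of positive order maps the open disk into itself, so that the composition is meaningful. -/
def blaschkeFactorOrders (φ : ℂ → ℂ) : Set ℕ :=
  {n | 0 < n ∧ ∃ B ψ : ℂ → ℂ, IsFiniteBlaschke n B ∧ IsHInfty ψ ∧
    ∀ z ∈ ball (0 : ℂ) 1, φ z = ψ (B z)}

/-- The Cowen-Thomson order `b(φ)`: the maximum of the orders of finite Blaschke products `B`
with `φ = ψ ∘ B`. If the set of orders is empty or unbounded, the value is `0`; a nonzero value is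
therefore a true maximum. -/
noncomputable def cowenThomsonOrder (φ : ℂ → ℂ) : ℕ :=
  sSup (blaschkeFactorOrders φ)

theorem cowenThomsonOrder_isGreatest {φ : ℂ → ℂ} (h : cowenThomsonOrder φ ≠ 0) :
    IsGreatest (blaschkeFactorOrders φ) (cowenThomsonOrder φ) := by
  have hb : BddAbove (blaschkeFactorOrders φ) := by
    by_contra hb
    exact h (Nat.sSup_of_not_bddAbove hb)
  have hne : (blaschkeFactorOrders φ).Nonempty := by
    by_contra hne
    rw [Set.not_nonempty_iff_eq_empty] at hne
    exact h (by simp [cowenThomsonOrder, hne])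
  exact ⟨Nat.sSup_mem hne hb, fun n hn => le_csSup hb hn⟩

/-- `N(φ - φ(η), 𝕋)`: the cardinality (possibly infinite) of the set of points `w` of the unit
circle with `φ w = φ η`. -/
noncomputable def selfIntersectionMult (φ : ℂ → ℂ) (η : ℂ) : ℕ∞ :=
  {w ∈ sphere (0 : ℂ) 1 | φ w - φ η = 0}.encard

/-- `N(φ)`: the minimum of `N(φ - φ(η), 𝕋)` over the points `η` of the unit circle (the infimum of
a nonempty set in `ℕ∞` is attained). -/
noncomputable def minSelfIntersectionMult (φ : ℂ → ℂ) : ℕ∞ :=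
  sInf (selfIntersectionMult φ '' sphere (0 : ℂ) 1)

/-! If `φ = ψ ∘ B` with `B` a Blaschke product of order `m > 0`, then `B` is `m`-to-one on the
circle and `φ` is constant on each boundary fibre of `B`. Hence every multiplicity is at least `m`
(`le_selfIntersectionMult`). Both claims follow once there is one factorization whose `B` takes
equal values whenever `φ` does on the circle, up to countably many base points
(`HasBlaschkeFactorization`, `selfIntersectionMult_eq_of_factorization`).

Such a factorization is built for the normal form `f` of `φ`. The key object is the reflection f*(z)
= conj f(1/conj z): it equals conj f on the circle, so circle points with the same `f` also have the
same f*.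

If `f` is meromorphic at infinity, it agrees on the closed disk with a rational r without poles
there. By Lüroth, ℂ(r, r*) = ℂ(h), where h can be chosen without poles in the closed disk.
Reflection preserves this field, so conj h is a Möbius function of h on the circle. As h is
holomorphic and nonconstant on the disk, this forces h to be affinely equivalent to a function
unimodular on the circle, that is, to a Blaschke product B. Now r is a rational function of B, and
B, being rational in r and r*, is determined on the circle by the value of r, up to finitely many
points.

Otherwise, consider germs of biholomorphic maps ρ that preserve `f` and f*. All but countably many
pairs of noncritical circle points with equal values are joined by such a germ
(`countable_not_germRel`). Since f* is not meromorphic at 0 while it is at every other point, these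
germs cannot join points near 0 to points near some w ≠ 0. This leads to |w| ≤ C|z| for all related
points (`exists_norm_le_mul`). The normalized product of x - w/z over all w related to z is then a
bounded function that extends to an entire one. By Liouville it is constant, so every germ is z ↦ cz
(`germRel_div_mul`). The constants c form the group of k-th roots of unity for some k, and B = z^k
works. -/

/-! ### Finite Blaschke products on the disk and the circle -/

/-- The explicit formula of a finite Blaschke product, as a function on `ℂ`. -/
noncomputable def blaschkeFun {n : ℕ} (c : ℂ) (a : Fin n → ℂ) (z : ℂ) : ℂ :=
  c * ∏ i, (z - a i) / (1 - (starRingEnd ℂ) (a i) * z)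

theorem isFiniteBlaschke_blaschkeFun {n : ℕ} {c : ℂ} {a : Fin n → ℂ} (hc : ‖c‖ = 1)
    (ha : ∀ i, a i ∈ ball (0 : ℂ) 1) : IsFiniteBlaschke n (blaschkeFun c a) :=
  ⟨c, a, hc, ha, fun _ _ => rfl⟩

theorem one_sub_conj_mul_ne_zero {a z : ℂ} (ha : ‖a‖ < 1) (hz : ‖z‖ ≤ 1) :
    1 - (starRingEnd ℂ) a * z ≠ 0 := by
  intro h
  have h1 : (starRingEnd ℂ) a * z = 1 := (sub_eq_zero.mp h).symm
  have h2 : ‖a‖ * ‖z‖ = 1 := by simpa using congrArg norm h1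
  nlinarith [norm_nonneg a, norm_nonneg z]

theorem normSq_one_sub_conj_mul_sub (a z : ℂ) :
    Complex.normSq (1 - (starRingEnd ℂ) a * z) - Complex.normSq (z - a) =
      (1 - Complex.normSq a) * (1 - Complex.normSq z) := by
  simp [Complex.normSq_apply]
  ring

theorem norm_sq_one_sub_conj_mul_sub (a z : ℂ) :
    ‖1 - (starRingEnd ℂ) a * z‖ ^ 2 - ‖z - a‖ ^ 2 = (1 - ‖a‖ ^ 2) * (1 - ‖z‖ ^ 2) := by
  simpa [Complex.normSq_eq_norm_sq] using normSq_one_sub_conj_mul_sub a z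

theorem norm_sub_lt_of_norm_lt_one {a z : ℂ} (ha : ‖a‖ < 1) (hz : ‖z‖ < 1) :
    ‖z - a‖ < ‖1 - (starRingEnd ℂ) a * z‖ := by
  have h := norm_sq_one_sub_conj_mul_sub a z
  have h1 : 0 < 1 - ‖a‖ ^ 2 := by nlinarith [norm_nonneg a]
  have h2 : 0 < 1 - ‖z‖ ^ 2 := by nlinarith [norm_nonneg z]
  exact lt_of_pow_lt_pow_left₀ 2 (norm_nonneg _) (by nlinarith [mul_pos h1 h2])

theorem norm_lt_sub_of_one_lt_norm {a z : ℂ} (ha : ‖a‖ < 1) (hz : 1 < ‖z‖) :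
    ‖1 - (starRingEnd ℂ) a * z‖ < ‖z - a‖ := by
  have h := norm_sq_one_sub_conj_mul_sub a z
  have h1 : 0 < 1 - ‖a‖ ^ 2 := by nlinarith [norm_nonneg a]
  have h2 : 0 < ‖z‖ ^ 2 - 1 := by nlinarith [norm_nonneg z]
  exact lt_of_pow_lt_pow_left₀ 2 (norm_nonneg _) (by nlinarith [mul_pos h1 h2])

theorem norm_sub_eq_of_norm_eq_one {a z : ℂ} (hz : ‖z‖ = 1) :
    ‖z - a‖ = ‖1 - (starRingEnd ℂ) a * z‖ := by
  have h := norm_sq_one_sub_conj_mul_sub a z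
  rw [hz] at h
  exact (pow_left_inj₀ (norm_nonneg _) (norm_nonneg _) two_ne_zero).mp (by linarith)

section blaschke
variable {n : ℕ} {c : ℂ} {a : Fin n → ℂ}

theorem prod_one_sub_conj_ne_zero (ha : ∀ i, a i ∈ ball (0 : ℂ) 1) {z : ℂ} (hz : ‖z‖ ≤ 1) :
    ∏ i, (1 - (starRingEnd ℂ) (a i) * z) ≠ 0 :=
  Finset.prod_ne_zero_iff.mpr fun i _ =>
    one_sub_conj_mul_ne_zero (mem_ball_zero_iff.mp (ha i)) hz

theorem blaschkeFun_eq_div (c : ℂ) (a : Fin n → ℂ) (z : ℂ) :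
    blaschkeFun c a z = c * (∏ i, (z - a i)) / ∏ i, (1 - (starRingEnd ℂ) (a i) * z) := by
  rw [blaschkeFun, Finset.prod_div_distrib, mul_div_assoc]

theorem analyticAt_blaschkeFun (ha : ∀ i, a i ∈ ball (0 : ℂ) 1) {z : ℂ} (hz : ‖z‖ ≤ 1) :
    AnalyticAt ℂ (blaschkeFun c a) z := by
  unfold blaschkeFun
  refine analyticAt_const.mul (Finset.analyticAt_fun_prod _ fun i _ => ?_)
  exact (analyticAt_id.sub analyticAt_const).div
    (analyticAt_const.sub (analyticAt_const.mul analyticAt_id))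
    (one_sub_conj_mul_ne_zero (mem_ball_zero_iff.mp (ha i)) hz)

theorem norm_blaschkeFun_of_norm_eq_one (hc : ‖c‖ = 1) (ha : ∀ i, a i ∈ ball (0 : ℂ) 1) {z : ℂ}
    (hz : ‖z‖ = 1) : ‖blaschkeFun c a z‖ = 1 := by
  rw [blaschkeFun, norm_mul, hc, one_mul, norm_prod]
  refine Finset.prod_eq_one fun i _ => ?_
  rw [norm_div, norm_sub_eq_of_norm_eq_one hz, div_self]
  exact norm_ne_zero_iff.mpr (one_sub_conj_mul_ne_zero (mem_ball_zero_iff.mp (ha i)) hz.le)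

theorem prod_norm_lt_prod_norm {ι : Type*} {s : Finset ι} (hs : s.Nonempty) {u v : ι → ℂ}
    (h : ∀ i ∈ s, ‖u i‖ < ‖v i‖) : ‖∏ i ∈ s, u i‖ < ‖∏ i ∈ s, v i‖ := by
  rw [norm_prod, norm_prod]
  by_cases h0 : ∀ i ∈ s, 0 < ‖u i‖
  · exact Finset.prod_lt_prod_of_nonempty h0 h hs
  · push Not at h0
    obtain ⟨i, hi, hi0⟩ := h0
    rw [Finset.prod_eq_zero (f := fun i => ‖u i‖) hi (le_antisymm hi0 (norm_nonneg _))]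
    exact Finset.prod_pos fun j hj => (norm_nonneg _).trans_lt (h j hj)

theorem norm_blaschkeFun_lt_one (hn : 0 < n) (hc : ‖c‖ = 1) (ha : ∀ i, a i ∈ ball (0 : ℂ) 1)
    {z : ℂ} (hz : ‖z‖ < 1) : ‖blaschkeFun c a z‖ < 1 := by
  have : Nonempty (Fin n) := ⟨⟨0, hn⟩⟩
  rw [blaschkeFun_eq_div, norm_div, norm_mul, hc, one_mul,
    div_lt_one (norm_pos_iff.mpr (prod_one_sub_conj_ne_zero ha hz.le))]
  exact prod_norm_lt_prod_norm Finset.univ_nonempty fun i _ =>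
    norm_sub_lt_of_norm_lt_one (mem_ball_zero_iff.mp (ha i)) hz

open Polynomial in
/-- The polynomial whose roots are the solutions of `blaschkeFun c a z = ζ`. -/
noncomputable def blaschkePoly (c : ℂ) (a : Fin n → ℂ) (ζ : ℂ) : ℂ[X] :=
  C c * ∏ i, (X - C (a i)) - C ζ * ∏ i, (C (-(starRingEnd ℂ) (a i)) * X + C 1)

theorem eval_blaschkePoly (c : ℂ) (a : Fin n → ℂ) (ζ z : ℂ) :
    (blaschkePoly c a ζ).eval z =
      c * ∏ i, (z - a i) - ζ * ∏ i, (1 - (starRingEnd ℂ) (a i) * z) := by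
  simp only [blaschkePoly, Polynomial.eval_sub, Polynomial.eval_mul, Polynomial.eval_C,
    Polynomial.eval_prod, Polynomial.eval_X, Polynomial.eval_add]
  congr 2
  exact Finset.prod_congr rfl fun i _ => by ring

/-- The top coefficient is `c - ζ * ∏ (-conj (a i))`. It cannot vanish, because `‖c‖ = 1` while the
subtracted term has norm less than 1. -/
theorem natDegree_blaschkePoly (hn : 0 < n) (hc : ‖c‖ = 1) (ha : ∀ i, a i ∈ ball (0 : ℂ) 1)
    {ζ : ℂ} (hζ : ‖ζ‖ ≤ 1) : (blaschkePoly c a ζ).natDegree = n := by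
  have : Nonempty (Fin n) := ⟨⟨0, hn⟩⟩
  have hd1 : (∏ i, (Polynomial.X - Polynomial.C (a i))).natDegree = n := by
    simp
  have hm1 : (∏ i, (Polynomial.X - Polynomial.C (a i))).coeff n = 1 := by
    have := (Polynomial.monic_prod_X_sub_C a Finset.univ).coeff_natDegree
    rwa [hd1] at this
  have hd2 : (∏ i, (Polynomial.C (-(starRingEnd ℂ) (a i)) * Polynomial.X +
      Polynomial.C 1)).natDegree ≤ n := by
    refine (Polynomial.natDegree_prod_le _ _).trans ?_
    refine (Finset.sum_le_card_nsmul _ _ 1 fun i _ => Polynomial.natDegree_linear_le).trans ?_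
    simp
  have hm2 : (∏ i, (Polynomial.C (-(starRingEnd ℂ) (a i)) * Polynomial.X +
      Polynomial.C 1)).coeff n = ∏ i, (-(starRingEnd ℂ) (a i)) := by
    have := Polynomial.coeff_prod_of_natDegree_le Finset.univ
      (fun i => Polynomial.C (-(starRingEnd ℂ) (a i)) * Polynomial.X + Polynomial.C 1) 1
      (fun i _ => Polynomial.natDegree_linear_le)
    simpa [Polynomial.coeff_one] using this
  refine le_antisymm ?_ ?_
  · refine (Polynomial.natDegree_sub_le _ _).trans (max_le ?_ ?_)
    · exact (Polynomial.natDegree_C_mul_le _ _).trans hd1.le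
    · exact (Polynomial.natDegree_C_mul_le _ _).trans hd2
  · refine Polynomial.le_natDegree_of_ne_zero ?_
    rw [blaschkePoly, Polynomial.coeff_sub, Polynomial.coeff_C_mul, Polynomial.coeff_C_mul, hm1,
      hm2, mul_one, sub_ne_zero]
    intro h
    have h1 : ‖∏ i, (-(starRingEnd ℂ) (a i))‖ < ‖∏ _i : Fin n, (1 : ℂ)‖ :=
      prod_norm_lt_prod_norm Finset.univ_nonempty fun i _ => by
        simpa using ha i
    have h2 := congrArg norm h
    rw [norm_mul, hc] at h2
    simp only [Finset.prod_const_one, norm_one] at h1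
    nlinarith [norm_nonneg (∏ i, (-(starRingEnd ℂ) (a i)))]

theorem norm_le_one_of_isRoot_blaschkePoly (hn : 0 < n) (hc : ‖c‖ = 1)
    (ha : ∀ i, a i ∈ ball (0 : ℂ) 1) {ζ : ℂ} (hζ : ‖ζ‖ ≤ 1) {z : ℂ}
    (hz : (blaschkePoly c a ζ).eval z = 0) : ‖z‖ ≤ 1 := by
  have : Nonempty (Fin n) := ⟨⟨0, hn⟩⟩
  by_contra! h
  rw [eval_blaschkePoly, sub_eq_zero] at hz
  have h1 : ‖∏ i, (1 - (starRingEnd ℂ) (a i) * z)‖ < ‖∏ i, (z - a i)‖ :=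
    prod_norm_lt_prod_norm Finset.univ_nonempty fun i _ =>
      norm_lt_sub_of_one_lt_norm (mem_ball_zero_iff.mp (ha i)) h
  have h2 := congrArg norm hz
  rw [norm_mul, norm_mul, hc, one_mul] at h2
  nlinarith [norm_nonneg (∏ i, (1 - (starRingEnd ℂ) (a i) * z))]

theorem eval_blaschkePoly_eq_zero_iff (ha : ∀ i, a i ∈ ball (0 : ℂ) 1) {ζ z : ℂ} (hz : ‖z‖ ≤ 1) :
    (blaschkePoly c a ζ).eval z = 0 ↔ blaschkeFun c a z = ζ := by
  rw [eval_blaschkePoly, sub_eq_zero, blaschkeFun_eq_div,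
    div_eq_iff (prod_one_sub_conj_ne_zero ha hz)]

theorem exists_blaschkeFun_eq (hn : 0 < n) (hc : ‖c‖ = 1)
    (ha : ∀ i, a i ∈ ball (0 : ℂ) 1) {ζ : ℂ} (hζ : ‖ζ‖ ≤ 1) :
    ∃ z, ‖z‖ ≤ 1 ∧ blaschkeFun c a z = ζ := by
  have hd : (blaschkePoly c a ζ).degree ≠ 0 := by
    have := natDegree_blaschkePoly hn hc ha hζ
    intro h
    rw [Polynomial.natDegree_eq_zero_iff_degree_le_zero.mpr h.le] at this
    omega
  obtain ⟨z, hz⟩ := IsAlgClosed.exists_root _ hd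
  have hz1 := norm_le_one_of_isRoot_blaschkePoly hn hc ha hζ hz
  exact ⟨z, hz1, (eval_blaschkePoly_eq_zero_iff ha hz1).mp hz⟩

/-- On the circle `z B'(z) / B(z)` is a sum of Poisson kernels `(1 - |a|²) / |1 - conj a z|²`, hence
positive. -/
theorem deriv_blaschkeFun_ne_zero (hn : 0 < n) (hc : ‖c‖ = 1)
    (ha : ∀ i, a i ∈ ball (0 : ℂ) 1) {z : ℂ} (hz : ‖z‖ = 1) : deriv (blaschkeFun c a) z ≠ 0 := by
  have : Nonempty (Fin n) := ⟨⟨0, hn⟩⟩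
  have hz0 : z ≠ 0 := by rintro rfl; simp at hz
  have ha' : ∀ i, ‖a i‖ < 1 := fun i => mem_ball_zero_iff.mp (ha i)
  have hd : ∀ i, 1 - (starRingEnd ℂ) (a i) * z ≠ 0 := fun i =>
    one_sub_conj_mul_ne_zero (ha' i) hz.le
  have hne : ∀ i, z - a i ≠ 0 := fun i h => by
    have := ha' i
    rw [← sub_eq_zero.mp h, hz] at this
    exact lt_irrefl _ this
  have hc0 : c ≠ 0 := by rintro rfl; simp at hc
  have hder : ∀ i, HasDerivAt (fun z => (z - a i) / (1 - (starRingEnd ℂ) (a i) * z))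
      ((1 * (1 - (starRingEnd ℂ) (a i) * z) - (z - a i) * (-((starRingEnd ℂ) (a i) * 1))) /
        (1 - (starRingEnd ℂ) (a i) * z) ^ 2) z := fun i =>
    ((hasDerivAt_id z).sub_const _).div
      (((hasDerivAt_id z).const_mul _).const_sub 1) (hd i)
  have hlog : ∀ i, z * logDeriv (fun z => (z - a i) / (1 - (starRingEnd ℂ) (a i) * z)) z =
      (((1 - ‖a i‖ ^ 2) / ‖1 - (starRingEnd ℂ) (a i) * z‖ ^ 2 : ℝ) : ℂ) := fun i => by
    have hconj : z * (starRingEnd ℂ) z = 1 := by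
      rw [Complex.mul_conj, Complex.normSq_eq_norm_sq, hz]; simp
    have hd' : (starRingEnd ℂ) (1 - (starRingEnd ℂ) (a i) * z) ≠ 0 :=
      (map_ne_zero _).mpr (hd i)
    -- Since `conj z = 1 / z` on the circle, numerator and denominator of each factor differ by a
    -- conjugation and the factor `z`.
    have hcd : z * (starRingEnd ℂ) (1 - (starRingEnd ℂ) (a i) * z) = z - a i := by
      simp only [map_sub, map_one, map_mul, Complex.conj_conj, mul_sub, mul_one]
      linear_combination -a i * hconj
    rw [logDeriv_apply, (hder i).deriv]
    push_cast
    rw [← Complex.mul_conj', ← Complex.mul_conj']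
    have hnum : 1 * (1 - (starRingEnd ℂ) (a i) * z) -
        (z - a i) * (-((starRingEnd ℂ) (a i) * 1)) = 1 - a i * (starRingEnd ℂ) (a i) := by ring
    have hne' := hne i
    rw [hnum, ← hcd]
    have hDi := hd i
    generalize (starRingEnd ℂ) (1 - (starRingEnd ℂ) (a i) * z) = D' at *
    generalize 1 - (starRingEnd ℂ) (a i) * z = D at *
    field_simp
  have hsum : z * logDeriv (blaschkeFun c a) z =
      ((∑ i, (1 - ‖a i‖ ^ 2) / ‖1 - (starRingEnd ℂ) (a i) * z‖ ^ 2 : ℝ) : ℂ) := by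
    have : blaschkeFun c a = fun z => c * ∏ i, (z - a i) / (1 - (starRingEnd ℂ) (a i) * z) := rfl
    rw [this, logDeriv_const_mul _ _ hc0, logDeriv_prod, Finset.mul_sum, Complex.ofReal_sum]
    · exact Finset.sum_congr rfl fun i _ => hlog i
    · exact fun i _ => div_ne_zero (hne i) (hd i)
    · exact fun i _ => (hder i).differentiableAt
  have hpos : 0 < ∑ i, (1 - ‖a i‖ ^ 2) / ‖1 - (starRingEnd ℂ) (a i) * z‖ ^ 2 := by
    refine Finset.sum_pos (fun i _ => ?_) Finset.univ_nonempty
    have := ha' i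
    refine div_pos (by nlinarith [norm_nonneg (a i)]) (pow_pos (norm_pos_iff.mpr (hd i)) 2)
  intro h
  rw [logDeriv_apply, h, zero_div, mul_zero] at hsum
  exact hpos.ne (by exact_mod_cast hsum)

/-- The solutions are the roots of a polynomial of degree `n`. All lie on the circle, because `|B| <
1` inside and roots cannot lie outside, and all are simple, because `B' ≠ 0` there. -/
theorem encard_blaschkeFun_eq (hn : 0 < n) (hc : ‖c‖ = 1)
    (ha : ∀ i, a i ∈ ball (0 : ℂ) 1) {ζ : ℂ} (hζ : ‖ζ‖ = 1) :
    {w ∈ sphere (0 : ℂ) 1 | blaschkeFun c a w = ζ}.encard = n := by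
  classical
  set P := blaschkePoly c a ζ with hP
  have hdeg : P.natDegree = n := natDegree_blaschkePoly hn hc ha hζ.le
  have hP0 : P ≠ 0 := by rintro h; rw [h] at hdeg; simp at hdeg; omega
  have hroot : ∀ z, P.eval z = 0 ↔ ‖z‖ = 1 ∧ blaschkeFun c a z = ζ := fun z => by
    constructor
    · intro h
      have h1 := norm_le_one_of_isRoot_blaschkePoly hn hc ha hζ.le h
      have h2 := (eval_blaschkePoly_eq_zero_iff ha h1).mp h
      refine ⟨le_antisymm h1 (not_lt.mp fun h3 => ?_), h2⟩
      have := norm_blaschkeFun_lt_one hn hc ha h3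
      rw [h2, hζ] at this
      exact lt_irrefl _ this
    · rintro ⟨h1, h2⟩
      exact (eval_blaschkePoly_eq_zero_iff ha h1.le).mpr h2
  have hnodup : P.roots.Nodup := by
    rw [Multiset.nodup_iff_count_le_one]
    intro z
    rw [Polynomial.count_roots]
    by_contra! h
    obtain ⟨h2, h1⟩ := (Polynomial.one_lt_rootMultiplicity_iff_isRoot hP0).mp h
    obtain ⟨hz, hBz⟩ := (hroot z).mp h2
    set Dn : ℂ → ℂ := fun w => ∏ i, (1 - (starRingEnd ℂ) (a i) * w) with hDn
    have hDd : Differentiable ℂ Dn := by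
      rw [hDn]
      exact Differentiable.fun_finsetProd fun i _ => by fun_prop
    have hD0 : Dn z ≠ 0 := prod_one_sub_conj_ne_zero ha hz.le
    have heq : (fun w => P.eval w) =ᶠ[nhds z] fun w => Dn w * (blaschkeFun c a w - ζ) := by
      filter_upwards [hDd.continuous.continuousAt.eventually_ne hD0] with w hw
      rw [eval_blaschkePoly, blaschkeFun_eq_div, mul_sub]
      simp only [hDn] at hw ⊢
      rw [mul_div_cancel₀ _ hw]
      ring
    have hB := (analyticAt_blaschkeFun (c := c) ha hz.le).differentiableAt.hasDerivAt
    have hder : HasDerivAt (fun w => P.eval w) (deriv Dn z * (blaschkeFun c a z - ζ) +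
        Dn z * deriv (blaschkeFun c a) z) z :=
      ((hDd z).hasDerivAt.mul (hB.sub_const ζ)).congr_of_eventuallyEq heq
    have h3 := (P.hasDerivAt z).unique hder
    rw [hBz, sub_self, mul_zero, zero_add] at h3
    rw [Polynomial.IsRoot.def] at h1
    rw [h1] at h3
    exact mul_ne_zero hD0 (deriv_blaschkeFun_ne_zero hn hc ha hz) h3.symm
  have hset : {w ∈ sphere (0 : ℂ) 1 | blaschkeFun c a w = ζ} = (P.roots.toFinset : Set ℂ) := by
    ext w
    simp only [mem_ofPred_eq, mem_sphere_zero_iff_norm, Finset.mem_coe, Multiset.mem_toFinset,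
      Polynomial.mem_roots hP0, Polynomial.IsRoot.def, hroot]
  rw [hset, Set.encard_coe_eq_coe_finsetCard, Multiset.toFinset_card_of_nodup hnodup,
    IsAlgClosed.card_roots_eq_natDegree, hdeg]

end blaschke

/-! ### Factorizations bound the multiplicities from below -/

section factorization
variable {n : ℕ} {c : ℂ} {a : Fin n → ℂ}

theorem norm_lt_one_of_norm_blaschkeFun_lt_one (hc : ‖c‖ = 1) (ha : ∀ i, a i ∈ ball (0 : ℂ) 1)
    {z : ℂ} (hz : ∏ i, (1 - (starRingEnd ℂ) (a i) * z) ≠ 0) (h : ‖blaschkeFun c a z‖ < 1) :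
    ‖z‖ < 1 := by
  by_contra! h1
  have h2 : ‖∏ i, (1 - (starRingEnd ℂ) (a i) * z)‖ ≤ ‖∏ i, (z - a i)‖ := by
    rw [norm_prod, norm_prod]
    refine Finset.prod_le_prod (fun _ _ => norm_nonneg _) fun i _ => ?_
    rcases h1.eq_or_lt with h1 | h1
    · exact (norm_sub_eq_of_norm_eq_one h1.symm).ge
    · exact (norm_lt_sub_of_one_lt_norm (mem_ball_zero_iff.mp (ha i)) h1).le
  rw [blaschkeFun_eq_div, norm_div, norm_mul, hc, one_mul, div_lt_one (norm_pos_iff.mpr hz)] at h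
  exact absurd h2 (not_le.mpr h)

/-- Nothing is known about `ψ` on the circle. But `B` is locally invertible at `ξ`, and points near
`ξ` that it sends into the disk lie in the disk, so the values of `ψ` near `B ξ` are values of `f`
near `ξ`. -/
theorem tendsto_of_eq_comp_blaschkeFun (hn : 0 < n) (hc : ‖c‖ = 1)
    (ha : ∀ i, a i ∈ ball (0 : ℂ) 1) {f ψ : ℂ → ℂ} {ξ : ℂ} (hξ : ‖ξ‖ = 1) (hf : ContinuousAt f ξ)
    (hfac : ∀ z ∈ ball (0 : ℂ) 1, f z = ψ (blaschkeFun c a z)) :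
    Filter.Tendsto ψ (nhdsWithin (blaschkeFun c a ξ) (ball 0 1)) (nhds (f ξ)) := by
  refine Filter.tendsto_def.mpr fun W hW => ?_
  have hDc : Continuous fun z => ∏ i, (1 - (starRingEnd ℂ) (a i) * z) := by fun_prop
  have hU : {z | f z ∈ W ∧ ∏ i, (1 - (starRingEnd ℂ) (a i) * z) ≠ 0} ∈ nhds ξ :=
    Filter.inter_mem (hf hW) (hDc.continuousAt.eventually_ne (prod_one_sub_conj_ne_zero ha hξ.le))
  have hmap := (analyticAt_blaschkeFun (c := c) ha hξ.le).hasStrictDerivAt.map_nhds_eq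
    (deriv_blaschkeFun_ne_zero hn hc ha hξ)
  have himg := Filter.image_mem_map (m := blaschkeFun c a) hU
  rw [hmap] at himg
  filter_upwards [nhdsWithin_le_nhds himg, self_mem_nhdsWithin] with y hy hy1
  obtain ⟨z, ⟨hz1, hz2⟩, rfl⟩ := hy
  have hz := norm_lt_one_of_norm_blaschkeFun_lt_one hc ha hz2 (mem_ball_zero_iff.mp hy1)
  rw [mem_preimage]
  rwa [← hfac z (mem_ball_zero_iff.mpr hz)]

theorem eq_of_blaschkeFun_eq (hn : 0 < n) (hc : ‖c‖ = 1)
    (ha : ∀ i, a i ∈ ball (0 : ℂ) 1) {f ψ : ℂ → ℂ} {ξ w : ℂ} (hξ : ‖ξ‖ = 1) (hw : ‖w‖ = 1)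
    (hfξ : ContinuousAt f ξ) (hfw : ContinuousAt f w)
    (hfac : ∀ z ∈ ball (0 : ℂ) 1, f z = ψ (blaschkeFun c a z))
    (h : blaschkeFun c a w = blaschkeFun c a ξ) : f w = f ξ := by
  have h1 := tendsto_of_eq_comp_blaschkeFun hn hc ha hξ hfξ hfac
  have h2 := tendsto_of_eq_comp_blaschkeFun hn hc ha hw hfw hfac
  rw [h] at h2
  have : (nhdsWithin (blaschkeFun c a ξ) (ball 0 1)).NeBot := by
    rw [← mem_closure_iff_nhdsWithin_neBot, closure_ball _ one_ne_zero, mem_closedBall_zero_iff]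
    exact (norm_blaschkeFun_of_norm_eq_one hc ha hξ).le
  exact tendsto_nhds_unique h2 h1

/-- The fibre of `B` through `ξ` on the circle has exactly `m` points, and `f` equals the boundary
limit of `ψ` at all of them. -/
theorem le_selfIntersectionMult {f : ℂ → ℂ} (hf : ∀ z ∈ closedBall (0 : ℂ) 1, AnalyticAt ℂ f z)
    {m : ℕ} (hm : m ∈ blaschkeFactorOrders f) {ξ : ℂ} (hξ : ξ ∈ sphere (0 : ℂ) 1) :
    (m : ℕ∞) ≤ selfIntersectionMult f ξ := by
  obtain ⟨hm0, B, ψ, ⟨c, a, hc, ha, hB⟩, -, hfac⟩ := hm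
  have hfac' : ∀ z ∈ ball (0 : ℂ) 1, f z = ψ (blaschkeFun c a z) := fun z hz => by
    rw [hfac z hz, hB z hz, blaschkeFun]
  have hξ1 : ‖ξ‖ = 1 := mem_sphere_zero_iff_norm.mp hξ
  rw [← encard_blaschkeFun_eq hm0 hc ha (norm_blaschkeFun_of_norm_eq_one hc ha hξ1)]
  refine encard_le_encard fun w hw => ⟨hw.1, sub_eq_zero.mpr ?_⟩
  exact eq_of_blaschkeFun_eq hm0 hc ha hξ1 (mem_sphere_zero_iff_norm.mp hw.1)
    (hf ξ (sphere_subset_closedBall hξ)).continuousAt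
    (hf w (sphere_subset_closedBall hw.1)).continuousAt hfac' hw.2

theorem not_countable_sphere : ¬ (sphere (0 : ℂ) 1).Countable := by
  intro h
  have hsub : Icc (-1 : ℝ) 1 ⊆ Complex.re '' sphere (0 : ℂ) 1 :=
    ((isPreconnected_sphere (by simp [Complex.rank_real_complex]) (0 : ℂ) 1).image _
      Complex.continuous_re.continuousOn).Icc_subset ⟨-1, by simp, by simp⟩ ⟨1, by simp, by simp⟩
  have h0 := ((h.image Complex.re).mono hsub).measure_zero MeasureTheory.volume
  norm_num at h0

/-- A factorization through a finite Blaschke product that accounts for almost all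
self-intersections determines the Cowen-Thomson order. -/
theorem selfIntersectionMult_eq_of_factorization {f : ℂ → ℂ}
    (hf : ∀ z ∈ closedBall (0 : ℂ) 1, AnalyticAt ℂ f z) (hn : 0 < n) (hc : ‖c‖ = 1)
    (ha : ∀ i, a i ∈ ball (0 : ℂ) 1) {ψ : ℂ → ℂ} (hψ : IsHInfty ψ)
    (hfac : ∀ z ∈ ball (0 : ℂ) 1, f z = ψ (blaschkeFun c a z)) {E : Set ℂ} (hE : E.Countable)
    (h : ∀ ξ ∈ sphere (0 : ℂ) 1 \ E, ∀ w ∈ sphere (0 : ℂ) 1, f w = f ξ →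
      blaschkeFun c a w = blaschkeFun c a ξ) :
    (∃ E : Set ℂ, E.Countable ∧
      ∀ ξ ∈ sphere (0 : ℂ) 1 \ E, selfIntersectionMult f ξ = (cowenThomsonOrder f : ℕ∞)) ∧
    minSelfIntersectionMult f = (cowenThomsonOrder f : ℕ∞) := by
  have hmem : n ∈ blaschkeFactorOrders f :=
    ⟨hn, blaschkeFun c a, ψ, isFiniteBlaschke_blaschkeFun hc ha, hψ, hfac⟩
  have hmult : ∀ ξ ∈ sphere (0 : ℂ) 1 \ E, selfIntersectionMult f ξ = n := by
    intro ξ hξ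
    have hξ1 : ‖ξ‖ = 1 := mem_sphere_zero_iff_norm.mp hξ.1
    refine le_antisymm ?_ (le_selfIntersectionMult hf hmem hξ.1)
    rw [← encard_blaschkeFun_eq hn hc ha (norm_blaschkeFun_of_norm_eq_one hc ha hξ1)]
    exact encard_le_encard fun w hw => ⟨hw.1, h ξ hξ w hw.1 (sub_eq_zero.mp hw.2)⟩
  obtain ⟨ξ₀, hξ₀⟩ : (sphere (0 : ℂ) 1 \ E).Nonempty := by
    by_contra hne
    exact not_countable_sphere (hE.mono (sdiff_eq_empty.mp (not_nonempty_iff_eq_empty.mp hne)))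
  have hgreat : IsGreatest (blaschkeFactorOrders f) n := by
    refine ⟨hmem, fun m hm => ?_⟩
    have := le_selfIntersectionMult hf hm hξ₀.1
    rw [hmult ξ₀ hξ₀] at this
    exact_mod_cast this
  have hord : cowenThomsonOrder f = n := hgreat.csSup_eq
  rw [hord]
  refine ⟨⟨E, hE, hmult⟩, le_antisymm ?_ ?_⟩
  · exact (sInf_le (mem_image_of_mem _ hξ₀.1)).trans (hmult ξ₀ hξ₀).le
  · refine le_sInf ?_
    rintro _ ⟨ξ, hξ, rfl⟩
    exact le_selfIntersectionMult hf hmem hξ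

end factorization

/-! ### Rational functions: reflection, Lüroth generators and their poles -/

section ratfunc
open IntermediateField Filter

theorem RatFunc.induction_X {p : RatFunc ℂ → Prop} (hX : p RatFunc.X)
    (hC : ∀ c, p (RatFunc.C c)) (hadd : ∀ x y, p x → p y → p (x + y))
    (hinv : ∀ x, p x → p x⁻¹) (hmul : ∀ x y, p x → p y → p (x * y)) (x : RatFunc ℂ) : p x := by
  have hx : x ∈ IntermediateField.adjoin ℂ {(RatFunc.X : RatFunc ℂ)} := by
    rw [RatFunc.adjoin_X]; trivial
  induction hx using adjoin_induction with
  | mem y hy => rw [mem_singleton_iff.mp hy]; exact hX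
  | algebraMap c => exact hC c
  | add y z _ _ hy hz => exact hadd y z hy hz
  | inv y _ hy => exact hinv y hy
  | mul y z _ _ hy hz => exact hmul y z hy hz

/-- The value of a rational function at a point, with value `0` at the poles. -/
noncomputable def ratEval (x : RatFunc ℂ) (z : ℂ) : ℂ := RatFunc.eval (RingHom.id ℂ) z x

theorem ratEval_eq_div (x : RatFunc ℂ) (z : ℂ) :
    ratEval x z = x.num.eval z / x.denom.eval z := rfl

theorem eventually_eval_ne_zero {p : Polynomial ℂ} (hp : p ≠ 0) :
    ∀ᶠ z in cofinite, p.eval z ≠ 0 := by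
  have := Polynomial.finite_setOfPred_isRoot hp
  rw [eventually_cofinite]
  simpa [Polynomial.IsRoot] using this

theorem eventually_denom_ne_zero (x : RatFunc ℂ) :
    ∀ᶠ z in cofinite, Polynomial.eval₂ (RingHom.id ℂ) z x.denom ≠ 0 :=
  eventually_eval_ne_zero x.denom_ne_zero

@[simp]
theorem ratEval_C (c z : ℂ) : ratEval (RatFunc.C c) z = c := by simp [ratEval]

@[simp]
theorem ratEval_X (z : ℂ) : ratEval RatFunc.X z = z := by simp [ratEval]

theorem ratEval_add (x y : RatFunc ℂ) :
    ∀ᶠ z in cofinite, ratEval (x + y) z = ratEval x z + ratEval y z := by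
  filter_upwards [eventually_denom_ne_zero x, eventually_denom_ne_zero y] with z hx hy
  exact RatFunc.eval_add _ _ hx hy

theorem ratEval_mul (x y : RatFunc ℂ) :
    ∀ᶠ z in cofinite, ratEval (x * y) z = ratEval x z * ratEval y z := by
  filter_upwards [eventually_denom_ne_zero x, eventually_denom_ne_zero y] with z hx hy
  exact RatFunc.eval_mul _ _ hx hy

theorem ratEval_inv (x : RatFunc ℂ) :
    ∀ᶠ z in cofinite, ratEval x⁻¹ z = (ratEval x z)⁻¹ := by
  rcases eq_or_ne x 0 with rfl | hx
  · simp [ratEval]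
  · filter_upwards [ratEval_mul x x⁻¹] with z hz
    rw [mul_inv_cancel₀ hx] at hz
    refine eq_inv_of_mul_eq_one_right ?_
    rw [← hz]
    simp [ratEval]

/-- The involution `r ↦ conj (r (1 / conj z))` of the field of rational functions. -/
noncomputable def ratConj : RatFunc ℂ →+* RatFunc ℂ :=
  IsFractionRing.lift (A := Polynomial ℂ)
    (g := Polynomial.eval₂RingHom (RatFunc.C.comp (starRingEnd ℂ)) (RatFunc.X⁻¹ : RatFunc ℂ)) <| by
      rw [injective_iff_map_eq_zero]
      intro p hp
      have htr : Transcendental ℂ (RatFunc.X⁻¹ : RatFunc ℂ) := fun h =>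
        RatFunc.transcendental_X (by simpa using h.inv)
      have h1 : Polynomial.aeval (RatFunc.X⁻¹ : RatFunc ℂ) (p.map (starRingEnd ℂ)) = 0 := by
        rw [Polynomial.aeval_def, Polynomial.eval₂_map]
        exact hp
      have h2 := (transcendental_iff.mp htr) _ h1
      exact (Polynomial.map_eq_zero_iff (starRingEnd ℂ).injective).mp h2

@[simp]
theorem ratConj_C (c : ℂ) : ratConj (RatFunc.C c) = RatFunc.C ((starRingEnd ℂ) c) := by
  rw [← RatFunc.algebraMap_C, ratConj, IsFractionRing.lift_algebraMap]
  simp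

@[simp]
theorem ratConj_X : ratConj RatFunc.X = (RatFunc.X)⁻¹ := by
  rw [← RatFunc.algebraMap_X, ratConj, IsFractionRing.lift_algebraMap]
  simp

@[simp]
theorem ratConj_ratConj (x : RatFunc ℂ) : ratConj (ratConj x) = x := by
  induction x using RatFunc.induction_X with
  | hX => simp
  | hC c => simp
  | hadd x y hx hy => rw [map_add, map_add, hx, hy]
  | hinv x hx => rw [map_inv₀, map_inv₀, hx]
  | hmul x y hx hy => rw [map_mul, map_mul, hx, hy]

theorem ratEval_ratConj (x : RatFunc ℂ) :
    ∀ᶠ z in cofinite, ‖z‖ = 1 → ratEval (ratConj x) z = (starRingEnd ℂ) (ratEval x z) := by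
  induction x using RatFunc.induction_X with
  | hX =>
    filter_upwards [ratEval_inv RatFunc.X] with z hz h1
    rw [ratConj_X, hz, ratEval_X]
    refine inv_eq_of_mul_eq_one_right ?_
    rw [Complex.mul_conj, Complex.normSq_eq_norm_sq, h1]; simp
  | hC c => simp
  | hadd x y hx hy =>
    filter_upwards [hx, hy, ratEval_add x y, ratEval_add (ratConj x) (ratConj y)]
      with z h1 h2 h3 h4 hz
    rw [map_add, h4, h3, h1 hz, h2 hz, map_add]
  | hinv x hx =>
    filter_upwards [hx, ratEval_inv x, ratEval_inv (ratConj x)] with z h1 h3 h4 hz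
    rw [map_inv₀, h4, h3, h1 hz, map_inv₀]
  | hmul x y hx hy =>
    filter_upwards [hx, hy, ratEval_mul x y, ratEval_mul (ratConj x) (ratConj y)]
      with z h1 h2 h3 h4 hz
    rw [map_mul, h4, h3, h1 hz, h2 hz, map_mul]

/-- The field generated by `r` and `ratConj r`. -/
noncomputable def conjClosure (r : RatFunc ℂ) : IntermediateField ℂ (RatFunc ℂ) :=
  IntermediateField.adjoin ℂ {r, ratConj r}

theorem ratConj_mem_conjClosure {r x : RatFunc ℂ} (hx : x ∈ conjClosure r) :
    ratConj x ∈ conjClosure r := by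
  unfold conjClosure at hx
  induction hx using adjoin_induction with
  | mem y hy =>
    rcases hy with rfl | hy
    · exact subset_adjoin _ _ (by simp)
    · rw [mem_singleton_iff.mp hy, ratConj_ratConj]
      exact subset_adjoin _ _ (by simp)
  | algebraMap c =>
    rw [RatFunc.algebraMap_eq_C, ratConj_C, ← RatFunc.algebraMap_eq_C]
    exact IntermediateField.algebraMap_mem _ _
  | add y z _ _ hy hz => rw [map_add]; exact add_mem hy hz
  | inv y _ hy => rw [map_inv₀]; exact inv_mem hy
  | mul y z _ _ hy hz => rw [map_mul]; exact mul_mem hy hz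

/-- On the circle the value of `r` determines that of `ratConj r`, hence that of any rational
expression in the two. The finite set absorbs the points where `ratEval`, with its default value at
poles, fails to respect the field operations. -/
theorem ratEval_eq_of_mem_conjClosure {r x : RatFunc ℂ} (hx : x ∈ conjClosure r) :
    ∃ Z : Set ℂ, Z.Finite ∧ ∀ z w, z ∉ Z → w ∉ Z → ‖z‖ = 1 → ‖w‖ = 1 →
      ratEval r z = ratEval r w → ratEval x z = ratEval x w := by
  unfold conjClosure at hx
  induction hx using adjoin_induction with
  | mem y hy =>
    rcases hy with rfl | hy
    · exact ⟨∅, finite_empty, fun _ _ _ _ _ _ h => h⟩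
    · rw [mem_singleton_iff.mp hy]
      refine ⟨_, ratEval_ratConj r, fun z w hz hw hz1 hw1 h => ?_⟩
      rw [not_not.mp hz hz1, not_not.mp hw hw1, h]
  | algebraMap c =>
    exact ⟨∅, finite_empty, fun z w _ _ _ _ _ => by simp [RatFunc.algebraMap_eq_C]⟩
  | add x y _ _ hx hy =>
    obtain ⟨Z, hZ, h⟩ := hx
    obtain ⟨Z', hZ', h'⟩ := hy
    refine ⟨Z ∪ Z' ∪ _, (hZ.union hZ').union (ratEval_add x y), fun z w hz hw hz1 hw1 hr => ?_⟩
    simp only [mem_union, not_or] at hz hw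
    rw [not_not.mp hz.2, not_not.mp hw.2, h z w hz.1.1 hw.1.1 hz1 hw1 hr,
      h' z w hz.1.2 hw.1.2 hz1 hw1 hr]
  | inv x _ hx =>
    obtain ⟨Z, hZ, h⟩ := hx
    refine ⟨Z ∪ _, hZ.union (ratEval_inv x), fun z w hz hw hz1 hw1 hr => ?_⟩
    simp only [mem_union, not_or] at hz hw
    rw [not_not.mp hz.2, not_not.mp hw.2, h z w hz.1 hw.1 hz1 hw1 hr]
  | mul x y _ _ hx hy =>
    obtain ⟨Z, hZ, h⟩ := hx
    obtain ⟨Z', hZ', h'⟩ := hy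
    refine ⟨Z ∪ Z' ∪ _, (hZ.union hZ').union (ratEval_mul x y), fun z w hz hw hz1 hw1 hr => ?_⟩
    simp only [mem_union, not_or] at hz hw
    rw [not_not.mp hz.2, not_not.mp hw.2, h z w hz.1.1 hw.1.1 hz1 hw1 hr,
      h' z w hz.1.2 hw.1.2 hz1 hw1 hr]

/-- The reflection is an involution that maps the field `conjClosure r` onto itself, so it sends a
generator to a generator. -/
theorem adjoin_ratConj_eq {r h : RatFunc ℂ}
    (hh : IntermediateField.adjoin ℂ {h} = conjClosure r) :
    IntermediateField.adjoin ℂ {ratConj h} = IntermediateField.adjoin ℂ {h} := by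
  have hmem : h ∈ conjClosure r := hh ▸ mem_adjoin_simple_self ℂ h
  refine le_antisymm ?_ ?_
  · rw [adjoin_simple_le_iff, hh]
    exact ratConj_mem_conjClosure hmem
  · have key : ∀ x ∈ IntermediateField.adjoin ℂ {h},
        ratConj x ∈ IntermediateField.adjoin ℂ {ratConj h} := by
      intro x hx
      induction hx using adjoin_induction with
      | mem y hy => rw [mem_singleton_iff.mp hy]; exact mem_adjoin_simple_self _ _
      | algebraMap c =>
        rw [RatFunc.algebraMap_eq_C, ratConj_C, ← RatFunc.algebraMap_eq_C]
        exact IntermediateField.algebraMap_mem _ _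
      | add y z _ _ hy hz => rw [map_add]; exact add_mem hy hz
      | inv y _ hy => rw [map_inv₀]; exact inv_mem hy
      | mul y z _ _ hy hz => rw [map_mul]; exact mul_mem hy hz
    rw [adjoin_simple_le_iff]
    have := key (ratConj h) (by rw [hh]; exact ratConj_mem_conjClosure hmem)
    rwa [ratConj_ratConj] at this

theorem exists_aeval_of_mem_adjoin {h x : RatFunc ℂ} (hh : Transcendental ℂ h)
    (hx : x ∈ IntermediateField.adjoin ℂ {h}) :
    ∃ u : RatFunc ℂ, RatFunc.algEquivOfTranscendental h hh u = ⟨x, hx⟩ ∧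
      Polynomial.aeval h u.denom ≠ 0 ∧
      x * Polynomial.aeval h u.denom = Polynomial.aeval h u.num := by
  refine ⟨(RatFunc.algEquivOfTranscendental h hh).symm ⟨x, hx⟩, by simp, ?_, ?_⟩
  · exact fun h0 => RatFunc.denom_ne_zero _ (transcendental_iff.mp hh _ h0)
  · have h0 : Polynomial.aeval h
        ((RatFunc.algEquivOfTranscendental h hh).symm ⟨x, hx⟩).denom ≠ 0 :=
      fun h0 => RatFunc.denom_ne_zero _ (transcendental_iff.mp hh _ h0)
    have := RatFunc.algEquivOfTranscendental_apply h hh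
      ((RatFunc.algEquivOfTranscendental h hh).symm ⟨x, hx⟩)
    rw [AlgEquiv.apply_symm_apply] at this
    exact (eq_div_iff h0).mp this

/-- Write `h' = u(h)`. As `h'` generates the same field, `u` generates all of `RatFunc ℂ`; the
degree of the extension is the degree of `u`, so this degree is 1. -/
theorem exists_moebius_of_adjoin_eq {h h' : RatFunc ℂ} (hh : Transcendental ℂ h)
    (heq : IntermediateField.adjoin ℂ {h'} = IntermediateField.adjoin ℂ {h}) :
    ∃ a b c d : ℂ, (c ≠ 0 ∨ d ≠ 0) ∧
      (RatFunc.C c * h + RatFunc.C d) * h' = RatFunc.C a * h + RatFunc.C b := by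
  have hx : h' ∈ IntermediateField.adjoin ℂ {h} := heq ▸ mem_adjoin_simple_self ℂ h'
  obtain ⟨u, hu, -, hmul⟩ := exists_aeval_of_mem_adjoin hh hx
  have hX : RatFunc.X ∈ IntermediateField.adjoin ℂ {u} := by
    have h1 : h ∈ IntermediateField.adjoin ℂ {h'} := heq ▸ mem_adjoin_simple_self ℂ h
    obtain ⟨p, q, hpq⟩ := (mem_adjoin_simple_iff _ _).mp h1
    refine (mem_adjoin_simple_iff _ _).mpr ⟨p, q, ?_⟩
    apply (RatFunc.algEquivOfTranscendental h hh).injective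
    apply Subtype.ext
    rw [RatFunc.algEquivOfTranscendental_X, map_div₀, ← Polynomial.aeval_algHom_apply,
      ← Polynomial.aeval_algHom_apply, hu]
    exact hpq.trans (by simp [← IntermediateField.aeval_coe])
  have htop : IntermediateField.adjoin ℂ {u} = ⊤ := by
    rw [← top_le_iff, ← RatFunc.adjoin_X, adjoin_simple_le_iff]
    exact hX
  have hdeg : max u.num.natDegree u.denom.natDegree = 1 := by
    rw [← RatFunc.finrank_eq_max_natDegree, htop, IntermediateField.finrank_top]
  obtain ⟨a, b, hab⟩ := Polynomial.exists_eq_X_add_C_of_natDegree_le_one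
    ((le_max_left _ _).trans hdeg.le)
  obtain ⟨c, d, hcd⟩ := Polynomial.exists_eq_X_add_C_of_natDegree_le_one
    ((le_max_right _ _).trans hdeg.le)
  refine ⟨a, b, c, d, ?_, ?_⟩
  · by_contra! h0
    rw [h0.1, h0.2] at hcd
    exact u.denom_ne_zero (by simpa using hcd)
  · rw [hab, hcd] at hmul
    simp only [map_add, map_mul, Polynomial.aeval_C, Polynomial.aeval_X,
      RatFunc.algebraMap_eq_C] at hmul
    rw [mul_comm, hmul]

theorem aeval_reflect {h : RatFunc ℂ} (hh : h ≠ 0) {m : ℕ} {p : Polynomial ℂ}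
    (hp : p.natDegree ≤ m) :
    Polynomial.aeval h (p.reflect m) = Polynomial.aeval h⁻¹ p * h ^ m := by
  have : Invertible h⁻¹ := invertibleOfNonzero (inv_ne_zero hh)
  have h1 := Polynomial.eval₂_reflect_mul_pow (algebraMap ℂ (RatFunc ℂ)) h⁻¹ m p hp
  rw [invOf_eq_inv, inv_inv] at h1
  rw [Polynomial.aeval_def, Polynomial.aeval_def, ← h1, mul_assoc, ← mul_pow,
    inv_mul_cancel₀ hh, one_pow, mul_one]

theorem natDegree_comp_X_add_C (p : Polynomial ℂ) (c : ℂ) :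
    (p.comp (Polynomial.X + Polynomial.C c)).natDegree = p.natDegree := by
  rw [Polynomial.natDegree_comp, Polynomial.natDegree_X_add_C, mul_one]

theorem natDegree_reflect_le {m : ℕ} {p : Polynomial ℂ} (hp : p.natDegree ≤ m) :
    (p.reflect m).natDegree ≤ m := by
  rw [Polynomial.natDegree_le_iff_coeff_eq_zero]
  intro i hi
  rw [Polynomial.coeff_reflect, Polynomial.revAt_eq_self_of_lt hi]
  exact Polynomial.coeff_eq_zero_of_natDegree_lt (hp.trans_lt hi)

/-- A Möbius change of generator makes `r`, as a rational function of the generator, have a pole at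
infinity. Then every pole of the generator is a pole of `r`. -/
theorem exists_generator_natDegree_lt {r h₀ : RatFunc ℂ} (hr : ¬ ∃ c, r = RatFunc.C c)
    (hmem : r ∈ IntermediateField.adjoin ℂ {h₀}) (hh₀ : Transcendental ℂ h₀) :
    ∃ h : RatFunc ℂ, IntermediateField.adjoin ℂ {h} = IntermediateField.adjoin ℂ {h₀} ∧
      ∃ N D : Polynomial ℂ, D.natDegree < N.natDegree ∧
        r * Polynomial.aeval h D = Polynomial.aeval h N := by
  obtain ⟨u, hu, hu0, hmul⟩ := exists_aeval_of_mem_adjoin hh₀ hmem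
  by_cases hdeg : u.denom.natDegree < u.num.natDegree
  · exact ⟨h₀, rfl, u.num, u.denom, hdeg, hmul⟩
  push Not at hdeg
  set m := u.denom.natDegree with hm
  have hm0 : m ≠ 0 := by
    intro h0
    obtain ⟨c, hc⟩ := (RatFunc.eq_C_iff u).mpr ⟨by omega, h0⟩
    refine hr ⟨c, ?_⟩
    have : RatFunc.algEquivOfTranscendental h₀ hh₀ (algebraMap ℂ _ c) = ⟨r, hmem⟩ := by
      rw [RatFunc.algebraMap_eq_C, ← hc, hu]
    rw [AlgEquiv.commutes] at this
    have := congrArg Subtype.val this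
    simpa [RatFunc.algebraMap_eq_C] using this.symm
  -- `P` is a pole of `u`; the new generator `1 / (h₀ - P)` moves it to infinity. Reversing the
  -- coefficients after a shift by `P` expresses this substitution.
  obtain ⟨P, hP⟩ := IsAlgClosed.exists_root u.denom (by
    intro h0
    exact hm0 (Polynomial.natDegree_eq_zero_iff_degree_le_zero.mpr h0.le))
  have hNP : u.num.eval P ≠ 0 := by
    intro h0
    obtain ⟨s, t, hst⟩ := u.isCoprime_num_denom
    have := congrArg (Polynomial.eval P) hst
    rw [Polynomial.IsRoot.def] at hP
    simp [h0, hP] at this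
  have hne : h₀ - RatFunc.C P ≠ 0 := by
    intro h0
    rw [sub_eq_zero.mp h0] at hh₀
    exact hh₀ (isAlgebraic_algebraMap P)
  set h := (h₀ - RatFunc.C P)⁻¹ with hh
  have hh0 : h ≠ 0 := inv_ne_zero hne
  have hinv : h₀ = h⁻¹ + RatFunc.C P := by rw [hh, inv_inv]; ring
  refine ⟨h, le_antisymm ?_ ?_, (u.num.comp (Polynomial.X + Polynomial.C P)).reflect m,
    (u.denom.comp (Polynomial.X + Polynomial.C P)).reflect m, ?_, ?_⟩
  · rw [adjoin_simple_le_iff]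
    exact inv_mem (sub_mem (mem_adjoin_simple_self _ _) (IntermediateField.algebraMap_mem _ P))
  · rw [adjoin_simple_le_iff, hinv]
    exact add_mem (inv_mem (mem_adjoin_simple_self _ _)) (IntermediateField.algebraMap_mem _ P)
  · have hN : ((u.num.comp (Polynomial.X + Polynomial.C P)).reflect m).coeff m ≠ 0 := by
      rw [Polynomial.coeff_reflect, Polynomial.revAt_le le_rfl, Nat.sub_self,
        Polynomial.coeff_zero_eq_eval_zero]
      simpa [Polynomial.eval_comp] using hNP
    have hD : ((u.denom.comp (Polynomial.X + Polynomial.C P)).reflect m).coeff m = 0 := by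
      rw [Polynomial.coeff_reflect, Polynomial.revAt_le le_rfl, Nat.sub_self,
        Polynomial.coeff_zero_eq_eval_zero]
      simpa [Polynomial.eval_comp] using hP
    refine lt_of_lt_of_le ?_ (Polynomial.le_natDegree_of_ne_zero hN)
    refine lt_of_le_of_ne (natDegree_reflect_le (natDegree_comp_X_add_C _ _).le) fun h1 => ?_
    have h2 : ((u.denom.comp (Polynomial.X + Polynomial.C P)).reflect m) ≠ 0 := by
      intro h2
      rw [h2, Polynomial.natDegree_zero] at h1
      exact hm0 h1.symm
    have h3 := Polynomial.leadingCoeff_ne_zero.mpr h2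
    rw [Polynomial.leadingCoeff, h1] at h3
    exact h3 hD
  · rw [aeval_reflect hh0 ((natDegree_comp_X_add_C _ _).trans_le hdeg),
      aeval_reflect hh0 (natDegree_comp_X_add_C _ _).le, ← mul_assoc]
    congr 1
    have hev : Polynomial.aeval h⁻¹ (Polynomial.X + Polynomial.C P : Polynomial ℂ) = h₀ := by
      rw [hinv]
      simp [RatFunc.algebraMap_eq_C]
    rw [Polynomial.aeval_comp, Polynomial.aeval_comp, hev, hmul]

/-- The rational root theorem over `ℂ[X]`: `h` is a root of `r.denom * N(T) - r.num * D(T)`, whose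
leading coefficient is `r.denom` times a unit because `deg D < deg N`. -/
theorem denom_dvd_denom_of_natDegree_lt {r h : RatFunc ℂ} {N D : Polynomial ℂ}
    (hdeg : D.natDegree < N.natDegree)
    (heq : r * Polynomial.aeval h D = Polynomial.aeval h N) : h.denom ∣ r.denom := by
  have hN : N ≠ 0 := by rintro rfl; simp at hdeg
  set p : Polynomial (Polynomial ℂ) := Polynomial.C r.denom * N.map Polynomial.C -
    Polynomial.C r.num * D.map Polynomial.C with hp
  have hmapN : (Polynomial.C r.denom * N.map Polynomial.C).natDegree = N.natDegree := by
    rw [Polynomial.natDegree_C_mul r.denom_ne_zero,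
      Polynomial.natDegree_map_eq_of_injective Polynomial.C_injective]
  have hmapD : (Polynomial.C r.num * D.map Polynomial.C).natDegree ≤ D.natDegree :=
    (Polynomial.natDegree_C_mul_le _ _).trans Polynomial.natDegree_map_le
  have hlead : p.leadingCoeff = r.denom * Polynomial.C N.leadingCoeff := by
    rw [hp, Polynomial.leadingCoeff_sub_of_degree_lt, Polynomial.leadingCoeff_mul,
      Polynomial.leadingCoeff_C, Polynomial.leadingCoeff_map_of_injective Polynomial.C_injective]
    exact Polynomial.degree_lt_degree (by rw [hmapN]; exact hmapD.trans_lt hdeg)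
  have hmapaeval : ∀ q : Polynomial ℂ, Polynomial.aeval h (q.map (Polynomial.C : ℂ →+* _)) =
      Polynomial.aeval h q := fun q => by
    rw [Polynomial.aeval_def, Polynomial.eval₂_map, Polynomial.aeval_def]
    rfl
  have hroot : Polynomial.aeval h p = 0 := by
    rw [hp, map_sub, map_mul, map_mul, Polynomial.aeval_C, Polynomial.aeval_C, hmapaeval,
      hmapaeval, ← heq]
    nth_rw 2 [← RatFunc.num_div_denom r]
    field_simp [RatFunc.algebraMap_ne_zero r.denom_ne_zero]
    ring
  have h1 := den_dvd_of_is_root hroot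
  rw [hlead] at h1
  have h2 : h.denom ∣ (IsFractionRing.den (Polynomial ℂ) h : Polynomial ℂ) := by
    rw [RatFunc.denom_dvd (nonZeroDivisors.coe_ne_zero _)]
    exact ⟨IsFractionRing.num (Polynomial ℂ) h, by
      conv_lhs => rw [← IsFractionRing.mk'_num_den (Polynomial ℂ) h]
      rw [IsFractionRing.mk'_eq_div]⟩
  have h3 := h2.trans h1
  have hu : IsUnit (Polynomial.C N.leadingCoeff) :=
    Polynomial.isUnit_C.mpr (isUnit_iff_ne_zero.mpr (Polynomial.leadingCoeff_ne_zero.mpr hN))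
  exact (hu.dvd_mul_right).mp h3

end ratfunc

/-! ### Holomorphic functions with unimodular or real values on the circle -/

section disk
open Filter

theorem diffContOnCl_ball_of_analyticAt {g : ℂ → ℂ}
    (hg : ∀ z ∈ closedBall (0 : ℂ) 1, AnalyticAt ℂ g z) : DiffContOnCl ℂ g (ball 0 1) := by
  refine DifferentiableOn.diffContOnCl fun z hz => ?_
  rw [closure_ball _ one_ne_zero] at hz
  exact (hg z hz).differentiableAt.differentiableWithinAt

theorem norm_le_one_of_norm_eq_one_on_sphere {g : ℂ → ℂ}
    (hg : ∀ z ∈ closedBall (0 : ℂ) 1, AnalyticAt ℂ g z)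
    (h1 : ∀ z ∈ sphere (0 : ℂ) 1, ‖g z‖ = 1) {z : ℂ} (hz : z ∈ closedBall (0 : ℂ) 1) :
    ‖g z‖ ≤ 1 := by
  refine Complex.norm_le_of_forall_mem_frontier_norm_le isBounded_ball
    (diffContOnCl_ball_of_analyticAt hg) (fun w hw => ?_) (by rwa [closure_ball _ one_ne_zero])
  rw [frontier_ball _ one_ne_zero] at hw
  exact (h1 w hw).le

/-- A zero-free holomorphic function on the closed disk which is unimodular on the circle is
constant. -/
theorem exists_eq_const_of_norm_eq_one_on_sphere {g : ℂ → ℂ}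
    (hg : ∀ z ∈ closedBall (0 : ℂ) 1, AnalyticAt ℂ g z)
    (h0 : ∀ z ∈ closedBall (0 : ℂ) 1, g z ≠ 0)
    (h1 : ∀ z ∈ sphere (0 : ℂ) 1, ‖g z‖ = 1) :
    ∃ c : ℂ, ‖c‖ = 1 ∧ ∀ z ∈ closedBall (0 : ℂ) 1, g z = c := by
  have hle := fun z hz => norm_le_one_of_norm_eq_one_on_sphere hg h1 (z := z) hz
  have hge := fun z hz => norm_le_one_of_norm_eq_one_on_sphere (g := fun z => (g z)⁻¹)
    (fun z hz => (hg z hz).inv (h0 z hz)) (fun z hz => by rw [norm_inv, h1 z hz, inv_one])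
    (z := z) hz
  have heq : ∀ z ∈ closedBall (0 : ℂ) 1, ‖g z‖ = 1 := fun z hz => by
    refine le_antisymm (hle z hz) ?_
    have := hge z hz
    rw [norm_inv] at this
    exact (inv_le_one₀ (norm_pos_iff.mpr (h0 z hz))).mp this
  refine ⟨g 0, heq 0 (by simp), fun z hz => ?_⟩
  have := Complex.eqOn_closure_of_isPreconnected_of_isMaxOn_norm (c := (0 : ℂ))
    (convex_ball (0 : ℂ) 1).isPreconnected isOpen_ball (diffContOnCl_ball_of_analyticAt hg)
    (by simp) (fun w hw => by
      simp only [Function.comp, mem_ofPred_eq]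
      rw [heq w (ball_subset_closedBall hw), heq 0 (by simp)])
  exact this (by rwa [closure_ball _ one_ne_zero])

/-- A holomorphic function on the closed disk which is real on the circle is constant. -/
theorem exists_eq_const_of_im_eq_zero_on_sphere {g : ℂ → ℂ}
    (hg : ∀ z ∈ closedBall (0 : ℂ) 1, AnalyticAt ℂ g z)
    (h1 : ∀ z ∈ sphere (0 : ℂ) 1, (g z).im = 0) :
    ∃ c : ℂ, ∀ z ∈ ball (0 : ℂ) 1, g z = c := by
  -- `exp (i g)` is zero-free and unimodular on the circle, hence constant.
  have hana : ∀ z ∈ closedBall (0 : ℂ) 1, AnalyticAt ℂ (fun z => Complex.exp (Complex.I * g z)) z :=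
    fun z hz => (analyticAt_const.mul (hg z hz)).cexp
  obtain ⟨c, -, hc⟩ := exists_eq_const_of_norm_eq_one_on_sphere hana
    (fun z _ => Complex.exp_ne_zero _) (fun z hz => by simp [Complex.norm_exp, h1 z hz])
  refine isOpen_ball.exists_is_const_of_deriv_eq_zero (convex_ball (0 : ℂ) 1).isPreconnected
    (fun z hz => (hg z (ball_subset_closedBall hz)).differentiableAt.differentiableWithinAt)
    fun z hz => ?_
  have hd : HasDerivAt (fun z => Complex.exp (Complex.I * g z))
      (Complex.exp (Complex.I * g z) * (Complex.I * deriv g z)) z :=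
    ((hg z (ball_subset_closedBall hz)).differentiableAt.hasDerivAt.const_mul _).cexp
  have heq : (fun z => Complex.exp (Complex.I * g z)) =ᶠ[nhds z] fun _ => c := by
    filter_upwards [isOpen_ball.mem_nhds hz] with w hw
    exact hc w (ball_subset_closedBall hw)
  have := hd.unique ((hasDerivAt_const z c).congr_of_eventuallyEq heq)
  simpa [Complex.exp_ne_zero] using this

/-- Removes the finite exceptional sets of identities between `ratEval`s: a nontrivial preconnected
set has no isolated points, so continuity suffices. -/
theorem eq_zero_of_eventually_cofinite {F : ℂ → ℂ} {S : Set ℂ} (hS : IsPreconnected S)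
    (hn : S.Nontrivial) (hF : ∀ z ∈ S, ContinuousAt F z)
    (h : ∀ᶠ z in cofinite, z ∈ S → F z = 0) : ∀ z ∈ S, F z = 0 := by
  intro z hz
  by_contra h0
  have hacc := accPt_iff_frequently_nhdsNE.mp (hS.preperfect_of_nontrivial hn z hz)
  have hfin : ({w | ¬ (w ∈ S → F w = 0)} \ {z}).Finite := (eventually_cofinite.mp h).subset
    sdiff_subset
  have h1 : ∀ᶠ w in nhds z, w ∉ {w | ¬ (w ∈ S → F w = 0)} \ {z} :=
    hfin.isClosed.isOpen_compl.mem_nhds fun hmem => hmem.2 rfl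
  have h2 : ∀ᶠ w in nhdsWithin z {z}ᶜ, (F w ≠ 0 ∧ w ∉ {w | ¬ (w ∈ S → F w = 0)} \ {z}) ∧ w ≠ z :=
    ((((hF z hz).eventually_ne h0).and h1).filter_mono nhdsWithin_le_nhds).and
      self_mem_nhdsWithin
  obtain ⟨w, hwS, ⟨hw0, hw1⟩, hwz⟩ := (hacc.and_eventually h2).exists
  refine hw1 ⟨?_, hwz⟩
  simp only [mem_ofPred_eq]
  exact fun himp => hw0 (himp hwS)

theorem nontrivial_sphere : (sphere (0 : ℂ) 1).Nontrivial :=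
  ⟨1, by simp, -1, by simp, by norm_num⟩

theorem isPreconnected_unit_sphere : IsPreconnected (sphere (0 : ℂ) 1) :=
  isPreconnected_sphere (by simp [Complex.rank_real_complex]) (0 : ℂ) 1

theorem nontrivial_closedBall : (closedBall (0 : ℂ) 1).Nontrivial :=
  nontrivial_sphere.mono sphere_subset_closedBall

/-- A rational function without poles in the closed disk which is unimodular on the circle is a
finite Blaschke product. -/
theorem exists_blaschkeFun_of_norm_eq_one_on_sphere {u v : Polynomial ℂ}
    (hv : ∀ z ∈ closedBall (0 : ℂ) 1, v.eval z ≠ 0)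
    (h1 : ∀ z ∈ sphere (0 : ℂ) 1, ‖u.eval z / v.eval z‖ = 1) :
    ∃ (n : ℕ) (c : ℂ) (a : Fin n → ℂ), ‖c‖ = 1 ∧ (∀ i, a i ∈ ball (0 : ℂ) 1) ∧
      ∀ z ∈ closedBall (0 : ℂ) 1, u.eval z / v.eval z = blaschkeFun c a z := by
  classical
  have hu1 : ∀ z ∈ sphere (0 : ℂ) 1, u.eval z ≠ 0 := fun z hz h0 => by
    have := h1 z hz
    simp [h0] at this
  -- The roots inside the disk become the zeros of the Blaschke product. Dividing it out leaves a
  -- zero-free function that is unimodular on the circle, hence constant.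
  set l := (u.roots.filter fun z => ‖z‖ < 1).toList with hl
  set l' := u.roots.filter fun z => ¬ ‖z‖ < 1 with hl'
  have hfact : ∀ z, u.eval z =
      u.leadingCoeff * (∏ i : Fin l.length, (z - l[i.1])) * (l'.map fun a => z - a).prod := by
    intro z
    have h2 : u = Polynomial.C u.leadingCoeff *
        (u.roots.map fun a => Polynomial.X - Polynomial.C a).prod :=
      (IsAlgClosed.splits u).eq_prod_roots
    have h3 : (u.roots.map fun a => z - a).prod =
        (l.map fun a => z - a).prod * (l'.map fun a => z - a).prod := by
      rw [← Multiset.prod_coe, ← Multiset.map_coe, hl, Multiset.coe_toList, hl',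
        ← Multiset.prod_add, ← Multiset.map_add, Multiset.filter_add_not]
    rw [Fin.prod_univ_fun_getElem l (fun a => z - a), mul_assoc, ← h3]
    conv_lhs => rw [h2]
    rw [Polynomial.eval_mul, Polynomial.eval_C, Polynomial.eval_multiset_prod, Multiset.map_map]
    simp
  set a : Fin l.length → ℂ := fun i => l[i.1] with ha
  have hab : ∀ i, a i ∈ ball (0 : ℂ) 1 := fun i => by
    have h2 : ∀ b ∈ l, ‖b‖ < 1 := fun b hb => by
      rw [hl, Multiset.mem_toList, Multiset.mem_filter] at hb
      exact hb.2
    exact mem_ball_zero_iff.mpr (h2 _ (List.getElem_mem _))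
  have hu0 : u ≠ 0 := by
    rintro rfl
    exact hu1 1 (by simp) (by simp)
  have hl'0 : ∀ z ∈ closedBall (0 : ℂ) 1, (l'.map fun a => z - a).prod ≠ 0 := fun z hz h0 => by
    rw [Multiset.prod_eq_zero_iff, Multiset.mem_map] at h0
    obtain ⟨b, hb, hzb⟩ := h0
    rw [hl', Multiset.mem_filter, Polynomial.mem_roots hu0] at hb
    rw [← sub_eq_zero.mp hzb] at hb
    exact hu1 z (mem_sphere_zero_iff_norm.mpr
      (le_antisymm (mem_closedBall_zero_iff.mp hz) (not_lt.mp hb.2))) hb.1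
  set g : ℂ → ℂ := fun z => u.leadingCoeff * (l'.map fun a => z - a).prod *
    (∏ i, (1 - (starRingEnd ℂ) (a i) * z)) / v.eval z with hg
  have hrel : ∀ z ∈ closedBall (0 : ℂ) 1, u.eval z / v.eval z = g z * blaschkeFun 1 a z := by
    intro z hz
    have h2 := prod_one_sub_conj_ne_zero hab (mem_closedBall_zero_iff.mp hz)
    have h3 := hv z hz
    have h4 : u.eval z =
      u.leadingCoeff * (∏ i, (z - a i)) * (l'.map fun a => z - a).prod := hfact z
    rw [blaschkeFun_eq_div, hg, h4]
    simp only
    generalize ∏ i, (1 - (starRingEnd ℂ) (a i) * z) = p1 at *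
    generalize ∏ i, (z - a i) = p2 at *
    field_simp
  have hgana : ∀ z ∈ closedBall (0 : ℂ) 1, AnalyticAt ℂ g z := by
    intro z hz
    have h2 : Differentiable ℂ fun z : ℂ => (l'.map fun a => z - a).prod := by
      have : (fun z : ℂ => (l'.map fun a => z - a).prod) = fun z =>
          ((l'.map fun a => Polynomial.X - Polynomial.C a).prod).eval z := by
        funext z
        rw [Polynomial.eval_multiset_prod, Multiset.map_map]
        simp
      rw [this]
      exact Polynomial.differentiable _
    refine AnalyticAt.div ?_ (v.differentiable.analyticAt z) (hv z hz)
    refine (analyticAt_const.mul (h2.analyticAt z)).mul ?_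
    exact Finset.analyticAt_fun_prod _ fun i _ => analyticAt_const.sub
      (analyticAt_const.mul analyticAt_id)
  have hgne : ∀ z ∈ closedBall (0 : ℂ) 1, g z ≠ 0 := fun z hz =>
    div_ne_zero (mul_ne_zero (mul_ne_zero (Polynomial.leadingCoeff_ne_zero.mpr hu0) (hl'0 z hz))
      (prod_one_sub_conj_ne_zero hab (mem_closedBall_zero_iff.mp hz))) (hv z hz)
  obtain ⟨c, hc, hgc⟩ := exists_eq_const_of_norm_eq_one_on_sphere hgana hgne fun z hz => by
    have h2 := h1 z hz
    rw [hrel z (sphere_subset_closedBall hz), norm_mul, norm_blaschkeFun_of_norm_eq_one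
      norm_one hab (mem_sphere_zero_iff_norm.mp hz), mul_one] at h2
    exact h2
  refine ⟨l.length, c, a, hc, hab, fun z hz => ?_⟩
  rw [hrel z hz, hgc z hz, blaschkeFun, blaschkeFun, one_mul]

end disk

/-- `f` factors on the disk through a finite Blaschke product which separates points of the circle
with the same value of `f`, up to a countable set. -/
def HasBlaschkeFactorization (f : ℂ → ℂ) : Prop :=
  ∃ (n : ℕ) (c : ℂ) (a : Fin n → ℂ) (ψ : ℂ → ℂ) (E : Set ℂ), 0 < n ∧ ‖c‖ = 1 ∧
    (∀ i, a i ∈ ball (0 : ℂ) 1) ∧ IsHInfty ψ ∧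
    (∀ z ∈ ball (0 : ℂ) 1, f z = ψ (blaschkeFun c a z)) ∧ E.Countable ∧
    ∀ ξ ∈ sphere (0 : ℂ) 1 \ E, ∀ w ∈ sphere (0 : ℂ) 1, f w = f ξ →
      blaschkeFun c a w = blaschkeFun c a ξ

/-! ### The rational case -/

section rational
open Filter

theorem ratEval_aeval (h : RatFunc ℂ) (p : Polynomial ℂ) :
    ∀ᶠ z in cofinite, ratEval (Polynomial.aeval h p) z = p.eval (ratEval h z) := by
  induction p using Polynomial.induction_on' with
  | add p q hp hq =>
    filter_upwards [hp, hq, ratEval_add (Polynomial.aeval h p) (Polynomial.aeval h q)]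
      with z h1 h2 h3
    rw [map_add, h3, h1, h2, Polynomial.eval_add]
  | monomial n a =>
    induction n with
    | zero => simp [RatFunc.algebraMap_eq_C]
    | succ n ih =>
      filter_upwards [ih, ratEval_mul (Polynomial.aeval h (Polynomial.monomial n a)) h]
        with z h1 h2
      have h3 : Polynomial.aeval h (Polynomial.monomial (n + 1) a) =
          Polynomial.aeval h (Polynomial.monomial n a) * h := by
        rw [Polynomial.aeval_monomial, Polynomial.aeval_monomial, pow_succ, mul_assoc]
      rw [h3, h2, h1]
      simp [pow_succ, mul_assoc]

theorem analyticAt_ratEval {x : RatFunc ℂ} {z : ℂ} (hz : x.denom.eval z ≠ 0) :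
    AnalyticAt ℂ (ratEval x) z :=
  (x.num.differentiable.analyticAt z).div (x.denom.differentiable.analyticAt z) hz

theorem RatFunc.eq_C_of_num_eq {x : RatFunc ℂ} {κ : ℂ} (hp : x.num = Polynomial.C κ * x.denom) :
    x = RatFunc.C κ := by
  rw [← RatFunc.num_div_denom x, hp, map_mul, mul_div_assoc,
    div_self (RatFunc.algebraMap_ne_zero x.denom_ne_zero), mul_one, RatFunc.algebraMap_C]

theorem exists_eq_C_of_eqOn_ball {x : RatFunc ℂ}
    (hx : ∀ z ∈ closedBall (0 : ℂ) 1, x.denom.eval z ≠ 0) {κ : ℂ}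
    (h : ∀ z ∈ ball (0 : ℂ) 1, ratEval x z = κ) : x = RatFunc.C κ := by
  refine RatFunc.eq_C_of_num_eq (Polynomial.eq_of_infinite_eval_eq _ _ ((infinite_of_mem_nhds
    (0 : ℂ) (ball_mem_nhds 0 one_pos)).mono fun z hz => ?_))
  have := h z hz
  rw [ratEval_eq_div, div_eq_iff (hx z (ball_subset_closedBall hz))] at this
  simpa using this

/-- A rational function whose values on the circle satisfy a relation of bidegree `(1, 1)` with
their conjugates is, up to an affine change of coordinates, unimodular on the circle. -/
theorem exists_norm_eq_of_moebius_relation {x : RatFunc ℂ} (hnc : ¬ ∃ c, x = RatFunc.C c)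
    (hx : ∀ z ∈ closedBall (0 : ℂ) 1, x.denom.eval z ≠ 0) {a b c d : ℂ} (hcd : c ≠ 0 ∨ d ≠ 0)
    (hrel : ∀ z ∈ sphere (0 : ℂ) 1, (c * ratEval x z + d) * (starRingEnd ℂ) (ratEval x z) =
      a * ratEval x z + b) :
    ∃ (e : ℂ) (s : ℝ), 0 < s ∧ ∀ z ∈ sphere (0 : ℂ) 1, ‖ratEval x z + e‖ = s := by
  have hana : ∀ z ∈ closedBall (0 : ℂ) 1, AnalyticAt ℂ (ratEval x) z := fun z hz =>
    analyticAt_ratEval (hx z hz)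
  -- A holomorphic function that is real on the circle is constant, so no nontrivial affine image of
  -- `x` is real there.
  have hreal : ∀ α β : ℂ,
      (∀ z ∈ sphere (0 : ℂ) 1, (α * ratEval x z + β).im = 0) → α = 0 := by
    intro α β him
    by_contra hα
    obtain ⟨κ, hκ⟩ := exists_eq_const_of_im_eq_zero_on_sphere
      (g := fun z => α * ratEval x z + β)
      (fun z hz => (analyticAt_const.mul (hana z hz)).add analyticAt_const) him
    refine hnc ⟨(κ - β) / α, exists_eq_C_of_eqOn_ball hx fun z hz => ?_⟩
    rw [eq_div_iff hα]
    linear_combination hκ z hz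
  have him_add : ∀ w : ℂ, (w + (starRingEnd ℂ) w).im = 0 := fun w => by simp
  have him_sub : ∀ w : ℂ, (Complex.I * (w - (starRingEnd ℂ) w)).im = 0 := fun w => by simp
  -- If `c = 0`, the conjugate of `x` is affine in `x` on the circle, and so are `x + conj x` and `i
  -- (x - conj x)`. Both are real, so `1 + a/d` and `1 - a/d` both vanish, which is absurd.
  rcases eq_or_ne c 0 with rfl | hc
  · have hd : d ≠ 0 := hcd.resolve_left (by simp)
    have hconj : ∀ z ∈ sphere (0 : ℂ) 1,
        (starRingEnd ℂ) (ratEval x z) = a / d * ratEval x z + b / d := fun z hz => by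
      have := hrel z hz
      field_simp
      linear_combination this
    have h1 := hreal (1 + a / d) (b / d) fun z hz => by
      rw [show (1 + a / d) * ratEval x z + b / d =
        ratEval x z + (starRingEnd ℂ) (ratEval x z) by rw [hconj z hz]; ring]
      exact him_add _
    have h2 := hreal (Complex.I * (1 - a / d)) (-(Complex.I * (b / d))) fun z hz => by
      rw [show Complex.I * (1 - a / d) * ratEval x z + -(Complex.I * (b / d)) =
        Complex.I * (ratEval x z - (starRingEnd ℂ) (ratEval x z)) by rw [hconj z hz]; ring]
      exact him_sub _
    have h3 := (mul_eq_zero.mp h2).resolve_left Complex.I_ne_zero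
    have h4 : (2 : ℂ) = 0 := by linear_combination h1 + h3
    norm_num at h4
  -- The choice of `e` turns the relation into a formula for `|x + e|²` that is affine in `x`. Being
  -- real, it must be constant.
  · set e := d / c with he
    have hsq : ∀ z ∈ sphere (0 : ℂ) 1,
        (a / c + (starRingEnd ℂ) e) * ratEval x z + (b / c + e * (starRingEnd ℂ) e) =
        ((‖ratEval x z + e‖ ^ 2 : ℝ) : ℂ) := fun z hz => by
      rw [Complex.ofReal_pow, ← Complex.mul_conj', map_add]
      have h1 : (ratEval x z + e) * (starRingEnd ℂ) (ratEval x z) =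
          a / c * ratEval x z + b / c := by
        have := hrel z hz
        rw [he]
        field_simp
        linear_combination this
      linear_combination -h1
    have h1 := hreal _ _ fun z hz => by rw [hsq z hz, Complex.ofReal_im]
    have hsq' : ∀ z ∈ sphere (0 : ℂ) 1,
        b / c + e * (starRingEnd ℂ) e = ((‖ratEval x z + e‖ ^ 2 : ℝ) : ℂ) := fun z hz => by
      rw [← hsq z hz, h1, zero_mul, zero_add]
    have h1s : (1 : ℂ) ∈ sphere (0 : ℂ) 1 := by simp
    have hconst : ∀ z ∈ sphere (0 : ℂ) 1, ‖ratEval x z + e‖ = ‖ratEval x 1 + e‖ := fun z hz => by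
      have := (hsq' z hz).symm.trans (hsq' 1 h1s)
      exact (pow_left_inj₀ (norm_nonneg _) (norm_nonneg _) two_ne_zero).mp (by exact_mod_cast this)
    refine ⟨e, ‖ratEval x 1 + e‖, ?_, hconst⟩
    refine lt_of_le_of_ne (norm_nonneg _) fun h0 => ?_
    have h2 := hreal 1 e fun z hz => by
      rw [one_mul, norm_eq_zero.mp ((hconst z hz).trans h0.symm), Complex.zero_im]
    exact one_ne_zero h2

theorem exists_generator_conjClosure {r : RatFunc ℂ} (hr : ¬ ∃ c, r = RatFunc.C c) :
    ∃ h : RatFunc ℂ, Transcendental ℂ h ∧ IntermediateField.adjoin ℂ {h} = conjClosure r ∧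
      h.denom ∣ r.denom := by
  have hmem : r ∈ conjClosure r := IntermediateField.subset_adjoin _ _ (by simp)
  have hbot : conjClosure r ≠ ⊥ := by
    intro hb
    rw [hb, IntermediateField.mem_bot] at hmem
    obtain ⟨c, hc⟩ := hmem
    exact hr ⟨c, by rw [← hc, RatFunc.algebraMap_eq_C]⟩
  have hgen := RatFunc.Luroth.eq_adjoin_generator (E := conjClosure r)
  obtain ⟨h, hh, N, D, hdeg, heq⟩ := exists_generator_natDegree_lt hr (hgen ▸ hmem)
    (RatFunc.Luroth.transcendental_generator hbot)
  refine ⟨h, RatFunc.transcendental_of_ne_C _ ?_, hh.trans hgen.symm,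
    denom_dvd_denom_of_natDegree_lt hdeg heq⟩
  rintro ⟨c, rfl⟩
  refine hbot ?_
  rw [hgen, ← hh, IntermediateField.adjoin_simple_eq_bot_iff]
  exact IntermediateField.algebraMap_mem _ c

/-- `ratConj h` generates the same field as `h`, so it is a Möbius function of `h`; on the circle
its value is the conjugate of that of `h`. -/
theorem exists_moebius_relation_on_sphere {r h : RatFunc ℂ} (hh : Transcendental ℂ h)
    (hgen : IntermediateField.adjoin ℂ {h} = conjClosure r)
    (hden : ∀ z ∈ closedBall (0 : ℂ) 1, h.denom.eval z ≠ 0) :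
    ∃ a b c d : ℂ, (c ≠ 0 ∨ d ≠ 0) ∧ ∀ z ∈ sphere (0 : ℂ) 1,
      (c * ratEval h z + d) * (starRingEnd ℂ) (ratEval h z) = a * ratEval h z + b := by
  obtain ⟨a, b, c, d, hcd, hrel⟩ := exists_moebius_of_adjoin_eq hh (adjoin_ratConj_eq hgen)
  refine ⟨a, b, c, d, hcd, fun z hz => ?_⟩
  refine sub_eq_zero.mp (eq_zero_of_eventually_cofinite
    (F := fun z => (c * ratEval h z + d) * (starRingEnd ℂ) (ratEval h z) - (a * ratEval h z + b))
    isPreconnected_unit_sphere nontrivial_sphere (fun z hz => ?_) ?_ z hz)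
  · have h1 := (analyticAt_ratEval (hden z (sphere_subset_closedBall hz))).continuousAt
    exact (((continuousAt_const.mul h1).add continuousAt_const).mul
      (Complex.continuous_conj.continuousAt.comp h1)).sub
      ((continuousAt_const.mul h1).add continuousAt_const)
  · filter_upwards [ratEval_ratConj h, ratEval_mul (RatFunc.C c * h + RatFunc.C d) (ratConj h),
      ratEval_add (RatFunc.C c * h) (RatFunc.C d), ratEval_mul (RatFunc.C c) h,
      ratEval_add (RatFunc.C a * h) (RatFunc.C b), ratEval_mul (RatFunc.C a) h]
      with z h1 h2 h3 h4 h5 h6 hz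
    rw [hrel, h5, h6, h3, h4, h1 (mem_sphere_zero_iff_norm.mp hz)] at h2
    simp only [ratEval_C] at h2
    rw [h2, sub_self]

/-- Rational functions without poles on the closed disk. -/
theorem hasBlaschkeFactorization_of_ratFunc {f : ℂ → ℂ} {r : RatFunc ℂ}
    (hr : ¬ ∃ c, r = RatFunc.C c) (hden : ∀ z ∈ closedBall (0 : ℂ) 1, r.denom.eval z ≠ 0)
    (hf : ∀ z ∈ closedBall (0 : ℂ) 1, f z = ratEval r z) : HasBlaschkeFactorization f := by
  obtain ⟨h, hh, hgen, hdvd⟩ := exists_generator_conjClosure hr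
  have hhC : ¬ ∃ c, h = RatFunc.C c := by
    rintro ⟨c, rfl⟩
    exact hh (isAlgebraic_algebraMap c)
  have hhden : ∀ z ∈ closedBall (0 : ℂ) 1, h.denom.eval z ≠ 0 := fun z hz h0 =>
    hden z hz (Polynomial.eval_eq_zero_of_dvd_of_eval_eq_zero hdvd h0)
  obtain ⟨a, b, c, d, hcd, hrel⟩ := exists_moebius_relation_on_sphere hh hgen hhden
  obtain ⟨e, s, hs, hnorm⟩ := exists_norm_eq_of_moebius_relation hhC hhden hcd hrel
  have hs0 : (s : ℂ) ≠ 0 := by exact_mod_cast hs.ne'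
  obtain ⟨n, c', a', hc', ha', hB⟩ := exists_blaschkeFun_of_norm_eq_one_on_sphere
    (u := Polynomial.C (s : ℂ)⁻¹ * (h.num + Polynomial.C e * h.denom)) hhden fun z hz => by
      have h1 := hnorm z hz
      have h2 := hhden z (sphere_subset_closedBall hz)
      have h3 : (Polynomial.C (s : ℂ)⁻¹ * (h.num + Polynomial.C e * h.denom)).eval z /
          h.denom.eval z = (s : ℂ)⁻¹ * (ratEval h z + e) := by
        rw [ratEval_eq_div]
        simp only [Polynomial.eval_mul, Polynomial.eval_add, Polynomial.eval_C]
        field_simp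
      rw [h3, norm_mul, h1, norm_inv, Complex.norm_real, Real.norm_of_nonneg hs.le,
        inv_mul_cancel₀ hs.ne']
  have hHB : ∀ z ∈ closedBall (0 : ℂ) 1, ratEval h z = s * blaschkeFun c' a' z - e := by
    intro z hz
    rw [← hB z hz, ratEval_eq_div]
    have := hhden z hz
    simp only [Polynomial.eval_mul, Polynomial.eval_add, Polynomial.eval_C]
    field_simp
    ring
  have hn : 0 < n := by
    rcases Nat.eq_zero_or_pos n with rfl | hn
    · refine absurd ⟨s * c' - e, exists_eq_C_of_eqOn_ball hhden fun z hz => ?_⟩ hhC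
      rw [hHB z (ball_subset_closedBall hz), blaschkeFun]
      simp
    · exact hn
  have hrmem : r ∈ IntermediateField.adjoin ℂ {h} := by
    rw [hgen]; exact IntermediateField.subset_adjoin _ _ (by simp)
  obtain ⟨u, -, -, hu⟩ := exists_aeval_of_mem_adjoin hh hrmem
  have hfu : ∀ z ∈ closedBall (0 : ℂ) 1,
      ratEval r z * u.denom.eval (ratEval h z) = u.num.eval (ratEval h z) := by
    intro z hz
    refine sub_eq_zero.mp (eq_zero_of_eventually_cofinite
      (F := fun z => ratEval r z * u.denom.eval (ratEval h z) - u.num.eval (ratEval h z))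
      (convex_closedBall (0 : ℂ) 1).isPreconnected nontrivial_closedBall (fun z hz => ?_) ?_ z hz)
    · have h1 := (analyticAt_ratEval (hhden z hz)).continuousAt
      have h2 := (analyticAt_ratEval (hden z hz)).continuousAt
      exact (h2.mul (u.denom.continuous.continuousAt.comp h1)).sub
        (u.num.continuous.continuousAt.comp h1)
    · filter_upwards [ratEval_mul r (Polynomial.aeval h u.denom), ratEval_aeval h u.denom,
        ratEval_aeval h u.num] with z h1 h2 h3 _
      rw [hu, h2, h3] at h1
      rw [h1, sub_self]
  -- The Blaschke product maps the closed disk onto itself, so a pole of the outer function would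
  -- make numerator and denominator of `u` vanish together at some value of `h`.
  have hudenom : ∀ y ∈ closedBall (0 : ℂ) 1, u.denom.eval (s * y - e) ≠ 0 := by
    intro y hy h0
    obtain ⟨z, hz, hzy⟩ := exists_blaschkeFun_eq hn hc' ha' (mem_closedBall_zero_iff.mp hy)
    have hz' := mem_closedBall_zero_iff.mpr hz
    have h1 := hfu z hz'
    rw [hHB z hz', hzy, h0, mul_zero] at h1
    obtain ⟨p, q, hpq⟩ := u.isCoprime_num_denom
    have h2 := congrArg (Polynomial.eval (s * y - e)) hpq
    simp [h0, ← h1] at h2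
  obtain ⟨Z, hZ, hZeq⟩ := ratEval_eq_of_mem_conjClosure
    (hgen ▸ IntermediateField.mem_adjoin_simple_self ℂ h : h ∈ conjClosure r)
  have hψana : ∀ y ∈ closedBall (0 : ℂ) 1,
      AnalyticAt ℂ (fun y : ℂ => u.num.eval (s * y - e) / u.denom.eval (s * y - e)) y := by
    intro y hy
    have haff : Differentiable ℂ fun y : ℂ => (s : ℂ) * y - e := by fun_prop
    exact ((u.num.differentiable.comp haff).analyticAt y).div
      ((u.denom.differentiable.comp haff).analyticAt y) (hudenom y hy)
  -- `ψ` is `u` after the affine change that turns the Blaschke product back into `h`. Besides `Z`,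
  -- the points sharing an `r`-value with a point of `Z` are excluded: this keeps the second point
  -- `w` out of `Z` as well.
  refine ⟨n, c', a', fun y => u.num.eval (s * y - e) / u.denom.eval (s * y - e),
    Z ∪ ⋃ z₀ ∈ Z, {ξ | (r.num - Polynomial.C (ratEval r z₀) * r.denom).eval ξ = 0},
    hn, hc', ha', ⟨?_, ?_⟩, ?_, ?_, ?_⟩
  · exact fun y hy =>
      (hψana y (ball_subset_closedBall hy)).differentiableAt.differentiableWithinAt
  · obtain ⟨M, hM⟩ := (isCompact_closedBall (0 : ℂ) 1).exists_bound_of_continuousOn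
      fun y hy => (hψana y hy).continuousAt.continuousWithinAt
    exact ⟨M, fun y hy => hM y (ball_subset_closedBall hy)⟩
  · intro z hz
    have hz' := ball_subset_closedBall hz
    have hBz := norm_blaschkeFun_lt_one hn hc' ha' (mem_ball_zero_iff.mp hz)
    have h1 := hudenom _ (mem_closedBall_zero_iff.mpr hBz.le)
    rw [eq_div_iff h1, ← hHB z hz', hf z hz', hfu z hz']
  · refine hZ.countable.union (hZ.countable.biUnion fun z₀ _ => ?_)
    refine (Polynomial.finite_setOfPred_isRoot fun h0 =>
      hr ⟨ratEval r z₀, RatFunc.eq_C_of_num_eq (sub_eq_zero.mp h0)⟩).countable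
  · rintro ξ ⟨hξ, hξE⟩ w hw hfw
    simp only [mem_union, mem_iUnion, not_or, not_exists] at hξE
    have hξ' := sphere_subset_closedBall hξ
    have hw' := sphere_subset_closedBall hw
    rw [hf w hw', hf ξ hξ'] at hfw
    have hwZ : w ∉ Z := by
      intro hwZ
      refine hξE.2 w hwZ ?_
      have h1 := hden ξ hξ'
      rw [hfw]
      simp only [mem_ofPred_eq, Polynomial.eval_sub, Polynomial.eval_mul, Polynomial.eval_C]
      rw [ratEval_eq_div, div_mul_cancel₀ _ h1, sub_self]
    have h2 := hZeq w ξ hwZ hξE.1 (mem_sphere_zero_iff_norm.mp hw)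
      (mem_sphere_zero_iff_norm.mp hξ) hfw
    rw [hHB w hw', hHB ξ hξ'] at h2
    exact mul_left_cancel₀ hs0 (by linear_combination h2)

end rational

/-! ### Germs of maps preserving a function and its reflection -/

section germs
open Filter Topology

/-- The reflection `z ↦ conj (f (1 / conj z))` of a function in the unit circle. -/
noncomputable def circleConj (f : ℂ → ℂ) (z : ℂ) : ℂ :=
  (starRingEnd ℂ) (f ((starRingEnd ℂ) z)⁻¹)

/-- The reflection `z ↦ 1 / conj z` in the unit circle. -/
noncomputable def circleRefl (z : ℂ) : ℂ := ((starRingEnd ℂ) z)⁻¹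

theorem circleConj_apply (f : ℂ → ℂ) (z : ℂ) :
    circleConj f z = (starRingEnd ℂ) (f (circleRefl z)) := rfl

@[simp]
theorem circleRefl_circleRefl (z : ℂ) : circleRefl (circleRefl z) = z := by
  simp [circleRefl]

theorem norm_circleRefl (z : ℂ) : ‖circleRefl z‖ = ‖z‖⁻¹ := by simp [circleRefl]

theorem circleRefl_ne_zero {z : ℂ} (hz : z ≠ 0) : circleRefl z ≠ 0 := by
  simpa [circleRefl] using hz

theorem circleRefl_eq_self {z : ℂ} (hz : ‖z‖ = 1) : circleRefl z = z := by
  have hz0 : z ≠ 0 := by rintro rfl; simp at hz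
  rw [circleRefl, inv_eq_iff_eq_inv]
  refine eq_inv_of_mul_eq_one_left ?_
  rw [mul_comm, Complex.mul_conj, Complex.normSq_eq_norm_sq, hz]; simp

theorem continuousAt_circleRefl {z : ℂ} (hz : z ≠ 0) : ContinuousAt circleRefl z :=
  Complex.continuous_conj.continuousAt.inv₀ (by simpa using hz)

theorem circleRefl_injective : Function.Injective circleRefl := fun z w h => by
  rw [← circleRefl_circleRefl z, h, circleRefl_circleRefl]

theorem tendsto_circleRefl_nhdsNE {z : ℂ} (hz : z ≠ 0) :
    Tendsto circleRefl (𝓝[≠] z) (𝓝[≠] (circleRefl z)) :=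
  tendsto_nhdsWithin_of_tendsto_nhds_of_eventually_within _
    ((continuousAt_circleRefl hz).tendsto.mono_left nhdsWithin_le_nhds)
    (eventually_nhdsWithin_of_forall fun _ hw h => hw (circleRefl_injective h))

theorem AnalyticAt.star_star {f : ℂ → ℂ} {z : ℂ} (hf : AnalyticAt ℂ f ((starRingEnd ℂ) z)) :
    AnalyticAt ℂ (fun w => (starRingEnd ℂ) (f ((starRingEnd ℂ) w))) z := by
  rw [Complex.analyticAt_iff_eventually_differentiableAt] at hf ⊢
  filter_upwards [Complex.continuous_conj.continuousAt.eventually hf] with w hw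
  have := hw.conj_conj
  rw [Complex.conj_conj] at this
  exact this

theorem MeromorphicAt.star_star {f : ℂ → ℂ} {z : ℂ} (hf : MeromorphicAt f ((starRingEnd ℂ) z)) :
    MeromorphicAt (fun w => (starRingEnd ℂ) (f ((starRingEnd ℂ) w))) z := by
  obtain ⟨n, hn⟩ := hf
  refine ⟨n, ?_⟩
  convert! hn.star_star using 2 with w
  simp

theorem AnalyticAt.circleConj {f : ℂ → ℂ} {z : ℂ} (hz : z ≠ 0)
    (hf : AnalyticAt ℂ f (circleRefl z)) : AnalyticAt ℂ (circleConj f) z := by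
  have h1 : AnalyticAt ℂ (fun w => (starRingEnd ℂ) (f ((starRingEnd ℂ) w))) z⁻¹ := by
    refine AnalyticAt.star_star ?_
    rwa [map_inv₀]
  have h2 := h1.fun_comp (analyticAt_inv hz)
  refine h2.congr (Eventually.of_forall fun w => ?_)
  simp [_root_.circleConj]

theorem MeromorphicAt.circleConj {f : ℂ → ℂ} {z : ℂ} (hz : z ≠ 0)
    (hf : MeromorphicAt f (circleRefl z)) : MeromorphicAt (circleConj f) z := by
  have h1 : MeromorphicAt (fun w => (starRingEnd ℂ) (f ((starRingEnd ℂ) w))) z⁻¹ := by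
    refine MeromorphicAt.star_star ?_
    rwa [map_inv₀]
  have h2 := h1.comp_analyticAt (g := Inv.inv) (analyticAt_inv hz)
  refine h2.congr (Eventually.of_forall fun w => ?_)
  simp [_root_.circleConj]

/-- `ρ` and `σ` are mutually inverse germs of biholomorphic maps at `z` and `w`, and `ρ` leaves
`f` and `g` invariant. -/
structure IsInvariantGerm (f g : ℂ → ℂ) (ρ σ : ℂ → ℂ) (z w : ℂ) : Prop where
  analyticAt : AnalyticAt ℂ ρ z
  analyticAt_inv : AnalyticAt ℂ σ w
  map_eq : ρ z = w
  inv_eq : σ w = z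
  left_inv : ∀ᶠ ζ in 𝓝 z, σ (ρ ζ) = ζ
  right_inv : ∀ᶠ ω in 𝓝 w, ρ (σ ω) = ω
  invariant : ∀ᶠ ζ in 𝓝[≠] z, f (ρ ζ) = f ζ ∧ g (ρ ζ) = g ζ

theorem eventually_nhds_of_eventually_nhdsNE {p : ℂ → Prop} {z : ℂ} (h : ∀ᶠ ζ in 𝓝[≠] z, p ζ) :
    ∀ᶠ ζ in 𝓝 z, ∀ᶠ ζ' in 𝓝[≠] ζ, p ζ' := by
  have h1 := eventually_eventually_nhds.mpr (eventually_nhdsWithin_iff.mp h)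
  filter_upwards [h1] with ζ hζ
  rcases eq_or_ne ζ z with rfl | hne
  · exact h
  · have h2 : ∀ᶠ ζ' in 𝓝 ζ, ζ' ≠ z := isOpen_ne.mem_nhds hne
    exact ((hζ.and h2).mono fun ζ' h3 => h3.1 h3.2).filter_mono nhdsWithin_le_nhds

namespace IsInvariantGerm
variable {f g ρ σ : ℂ → ℂ} {z w : ℂ}

theorem tendsto (h : IsInvariantGerm f g ρ σ z w) : Tendsto ρ (𝓝 z) (𝓝 w) := by
  have := h.analyticAt.continuousAt.tendsto
  rwa [h.map_eq] at this

theorem tendsto_inv (h : IsInvariantGerm f g ρ σ z w) : Tendsto σ (𝓝 w) (𝓝 z) := by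
  have := h.analyticAt_inv.continuousAt.tendsto
  rwa [h.inv_eq] at this

theorem tendsto_nhdsNE (h : IsInvariantGerm f g ρ σ z w) : Tendsto ρ (𝓝[≠] z) (𝓝[≠] w) := by
  refine tendsto_nhdsWithin_of_tendsto_nhds_of_eventually_within _
    (h.tendsto.mono_left nhdsWithin_le_nhds) ?_
  filter_upwards [self_mem_nhdsWithin, h.left_inv.filter_mono nhdsWithin_le_nhds] with ζ hζ h1 h2
  refine hζ ?_
  rw [← h1, h2, h.inv_eq]; rfl

theorem tendsto_inv_nhdsNE (h : IsInvariantGerm f g ρ σ z w) : Tendsto σ (𝓝[≠] w) (𝓝[≠] z) := by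
  refine tendsto_nhdsWithin_of_tendsto_nhds_of_eventually_within _
    (h.tendsto_inv.mono_left nhdsWithin_le_nhds) ?_
  filter_upwards [self_mem_nhdsWithin, h.right_inv.filter_mono nhdsWithin_le_nhds] with ζ hζ h1 h2
  refine hζ ?_
  rw [← h1, h2, h.map_eq]; rfl

theorem symm (h : IsInvariantGerm f g ρ σ z w) : IsInvariantGerm f g σ ρ w z where
  analyticAt := h.analyticAt_inv
  analyticAt_inv := h.analyticAt
  map_eq := h.inv_eq
  inv_eq := h.map_eq
  left_inv := h.right_inv
  right_inv := h.left_inv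
  invariant := by
    filter_upwards [h.tendsto_inv_nhdsNE.eventually h.invariant,
      h.right_inv.filter_mono nhdsWithin_le_nhds] with ω h1 h2
    rw [h2] at h1
    exact ⟨h1.1.symm, h1.2.symm⟩

theorem eventually (h : IsInvariantGerm f g ρ σ z w) :
    ∀ᶠ ζ in 𝓝 z, IsInvariantGerm f g ρ σ ζ (ρ ζ) := by
  filter_upwards [h.analyticAt.eventually_analyticAt,
    h.tendsto.eventually h.analyticAt_inv.eventually_analyticAt, h.left_inv,
    eventually_eventually_nhds.mpr h.left_inv,
    h.tendsto.eventually (eventually_eventually_nhds.mpr h.right_inv),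
    eventually_nhds_of_eventually_nhdsNE h.invariant] with ζ h1 h2 h3 h4 h5 h6
  exact ⟨h1, h2, rfl, h3, h4, h5, h6⟩

/-- Conjugating a germ by the reflection in the circle gives a holomorphic germ again and exchanges
the roles of `f` and `circleConj f`. -/
theorem reflect (h : IsInvariantGerm f (circleConj f) ρ σ z w) (hz : z ≠ 0) (hw : w ≠ 0) :
    IsInvariantGerm f (circleConj f) (fun ζ => (circleConj ρ ζ)⁻¹) (fun ω => (circleConj σ ω)⁻¹)
      (circleRefl z) (circleRefl w) := by
  have hz' := circleRefl_ne_zero hz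
  have hw' := circleRefl_ne_zero hw
  have hρ : ∀ ζ, (circleConj ρ ζ)⁻¹ = circleRefl (ρ (circleRefl ζ)) := fun ζ => rfl
  have hσ : ∀ ω, (circleConj σ ω)⁻¹ = circleRefl (σ (circleRefl ω)) := fun ζ => rfl
  have ht : Tendsto circleRefl (𝓝 (circleRefl z)) (𝓝 z) := by
    have := (continuousAt_circleRefl hz').tendsto
    rwa [circleRefl_circleRefl] at this
  have hs : Tendsto circleRefl (𝓝 (circleRefl w)) (𝓝 w) := by
    have := (continuousAt_circleRefl hw').tendsto
    rwa [circleRefl_circleRefl] at this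
  refine ⟨?_, ?_, ?_, ?_, ?_, ?_, ?_⟩
  · refine (AnalyticAt.circleConj hz' ?_).inv ?_
    · rw [circleRefl_circleRefl]; exact h.analyticAt
    · rw [circleConj_apply, circleRefl_circleRefl, h.map_eq]; simpa using hw
  · refine (AnalyticAt.circleConj hw' ?_).inv ?_
    · rw [circleRefl_circleRefl]; exact h.analyticAt_inv
    · rw [circleConj_apply, circleRefl_circleRefl, h.inv_eq]; simpa using hz
  · rw [hρ, circleRefl_circleRefl, h.map_eq]
  · rw [hσ, circleRefl_circleRefl, h.inv_eq]
  · filter_upwards [ht.eventually h.left_inv] with ζ h1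
    rw [hσ, hρ, circleRefl_circleRefl, h1, circleRefl_circleRefl]
  · filter_upwards [hs.eventually h.right_inv] with ζ h1
    rw [hσ, hρ, circleRefl_circleRefl, h1, circleRefl_circleRefl]
  · have ht' := tendsto_circleRefl_nhdsNE hz'
    rw [circleRefl_circleRefl] at ht'
    filter_upwards [ht'.eventually h.invariant] with ζ h1
    rw [hρ, circleConj_apply, circleRefl_circleRefl, circleConj_apply]
    refine ⟨?_, by rw [h1.1]⟩
    have h2 := h1.2
    rw [circleConj_apply, circleConj_apply, circleRefl_circleRefl] at h2
    exact (starRingEnd ℂ).injective h2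

end IsInvariantGerm

/-- Two nonzero points are related if a germ of a biholomorphic map which leaves `f` and its
reflection invariant takes one to the other. -/
def GermRel (f : ℂ → ℂ) (z w : ℂ) : Prop :=
  z ≠ 0 ∧ w ≠ 0 ∧ ∃ ρ σ, IsInvariantGerm f (circleConj f) ρ σ z w

theorem GermRel.symm {f : ℂ → ℂ} {z w : ℂ} (h : GermRel f z w) : GermRel f w z := by
  obtain ⟨hz, hw, ρ, σ, h⟩ := h
  exact ⟨hw, hz, σ, ρ, h.symm⟩

theorem GermRel.reflect {f : ℂ → ℂ} {z w : ℂ} (h : GermRel f z w) :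
    GermRel f (circleRefl z) (circleRefl w) := by
  obtain ⟨hz, hw, ρ, σ, h⟩ := h
  exact ⟨circleRefl_ne_zero hz, circleRefl_ne_zero hw, _, _, h.reflect hz hw⟩

theorem IsInvariantGerm.eventually_germRel {f ρ σ : ℂ → ℂ} {z w : ℂ}
    (h : IsInvariantGerm f (circleConj f) ρ σ z w) (hz : z ≠ 0) (hw : w ≠ 0) :
    ∀ᶠ ζ in 𝓝 z, GermRel f ζ (ρ ζ) := by
  filter_upwards [h.eventually, isOpen_ne.mem_nhds hz,
    h.tendsto.eventually (isOpen_ne.mem_nhds hw)] with ζ h1 h2 h3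
  exact ⟨h2, h3, ρ, σ, h1⟩

/-- The closure of the relation `GermRel`. -/
def GermRelClosure (f : ℂ → ℂ) (z w : ℂ) : Prop :=
  ∃ᶠ p : ℂ × ℂ in 𝓝 (z, w), GermRel f p.1 p.2

theorem GermRel.closure {f : ℂ → ℂ} {z w : ℂ} (h : GermRel f z w) : GermRelClosure f z w :=
  fun h1 => h1.self_of_nhds h

theorem GermRelClosure.symm {f : ℂ → ℂ} {z w : ℂ} (h : GermRelClosure f z w) :
    GermRelClosure f w z := by
  intro h1
  have h2 : Tendsto Prod.swap (𝓝 (z, w)) (𝓝 (w, z)) := continuous_swap.tendsto _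
  exact h ((h2.eventually h1).mono fun p hp hp' => hp hp'.symm)

theorem isClosed_germRelClosure (f : ℂ → ℂ) : IsClosed {p : ℂ × ℂ | GermRelClosure f p.1 p.2} := by
  have : {p : ℂ × ℂ | GermRelClosure f p.1 p.2} = closure {p : ℂ × ℂ | GermRel f p.1 p.2} := by
    ext p
    rw [mem_closure_iff_frequently]
    rfl
  rw [this]
  exact isClosed_closure

/-- Pairs in the closure of the relation are limits of generic related pairs. -/
theorem GermRelClosure.frequently_generic {f : ℂ → ℂ} (hf : Meromorphic f) {z w : ℂ}
    (h : GermRelClosure f z w) :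
    ∃ᶠ p : ℂ × ℂ in 𝓝 (z, w), GermRel f p.1 p.2 ∧ f p.2 = f p.1 ∧ p.1 ≠ z ∧ p.2 ≠ w ∧
      AnalyticAt ℂ f p.1 ∧ AnalyticAt ℂ f p.2 := by
  intro hcon
  refine h ?_
  filter_upwards [eventually_eventually_nhds.mpr hcon]
  rintro ⟨x, y⟩ hxy hrel
  obtain ⟨hx, hy, ρ, σ, hg⟩ := hrel
  -- A related pair can be moved along the graph of its germ; both coordinates then avoid any
  -- prescribed isolated points.
  have hpair : Tendsto (fun ζ => (ζ, ρ ζ)) (𝓝[≠] x) (𝓝 (x, y)) :=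
    (tendsto_id.prodMk_nhds hg.tendsto).mono_left nhdsWithin_le_nhds
  have hne : ∀ u v : ℂ, ∀ᶠ ζ in 𝓝[≠] u, ζ ≠ v := fun u v => by
    rcases eq_or_ne u v with rfl | huv
    · exact self_mem_nhdsWithin
    · exact mem_nhdsWithin_of_mem_nhds (isOpen_ne.mem_nhds huv)
  have h1 := hpair.eventually hxy
  have h2 := (hg.eventually_germRel hx hy).filter_mono (nhdsWithin_le_nhds (s := {x}ᶜ))
  have h3 := hg.tendsto_nhdsNE.eventually (hne y w)
  have h4 := (hf x).eventually_analyticAt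
  have h5 := hg.tendsto_nhdsNE.eventually (hf y).eventually_analyticAt
  obtain ⟨ζ, h1, h2, h3, h4, h5, h6, h7⟩ :=
    (h1.and (h2.and (h3.and (h4.and (h5.and (hg.invariant.and (hne x z))))))).exists
  exact h1 ⟨h2, h6.1, h7, h3, h4, h5⟩

/-- If `(z, w)` lies in the closure of the relation, then `f` has at `w` the value `f z`. -/
theorem GermRelClosure.tendsto {f : ℂ → ℂ} (hf : Meromorphic f) {z w : ℂ}
    (h : GermRelClosure f z w) (hz : ContinuousAt f z) : Tendsto f (𝓝[≠] w) (𝓝 (f z)) := by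
  -- At `w` the function has a finite limit or a pole. Generic related pairs have equal values, so
  -- the limit must be compatible with `f z`.
  have key : ∀ l : Filter ℂ, Tendsto f (𝓝[≠] w) l → ¬ Disjoint l (𝓝 (f z)) := by
    intro l hl hd
    obtain ⟨s, hs, t, ht, hst⟩ := Filter.disjoint_iff.mp hd
    have h1 := eventually_nhdsWithin_iff.mp (hl hs)
    have h2 : ∀ᶠ p : ℂ × ℂ in 𝓝 (z, w), f p.1 ∈ t ∧ (p.2 ≠ w → f p.2 ∈ s) :=
      ((continuous_fst.tendsto (z, w)).eventually (hz ht)).and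
        ((continuous_snd.tendsto (z, w)).eventually h1)
    obtain ⟨p, ⟨-, h3, -, h4, -⟩, h5, h6⟩ := ((h.frequently_generic hf).and_eventually h2).exists
    exact hst.le_bot ⟨h6 h4, h3 ▸ h5⟩
  rcases lt_or_ge (meromorphicOrderAt f w) 0 with hneg | hpos
  · refine absurd ?_ (key _ (tendsto_cobounded_of_meromorphicOrderAt_neg hneg))
    exact (Metric.disjoint_nhds_cobounded _).symm
  · obtain ⟨c, hc⟩ := tendsto_nhds_of_meromorphicOrderAt_nonneg (hf w) hpos
    have := key _ hc
    rw [disjoint_nhds_nhds, not_not] at this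
    rwa [this] at hc

end germs

/-! ### The relation near noncritical pairs -/

section germs
open Filter Topology

theorem GermRel.map_eq {f : ℂ → ℂ} {z w : ℂ} (h : GermRel f z w) (hz : ContinuousAt f z)
    (hw : ContinuousAt f w) : f w = f z := by
  obtain ⟨-, -, ρ, σ, hg⟩ := h
  have h1 : Tendsto (fun ζ => f (ρ ζ)) (𝓝[≠] z) (𝓝 (f w)) :=
    hw.tendsto.comp (hg.tendsto.mono_left nhdsWithin_le_nhds)
  have h2 : Tendsto (fun ζ => f (ρ ζ)) (𝓝[≠] z) (𝓝 (f z)) :=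
    (hz.tendsto.mono_left nhdsWithin_le_nhds).congr' (hg.invariant.mono fun ζ hζ => hζ.1.symm)
  exact tendsto_nhds_unique h1 h2

theorem AnalyticAt.exists_localInverse {f : ℂ → ℂ} {w : ℂ} (hf : AnalyticAt ℂ f w)
    (hf' : deriv f w ≠ 0) : ∃ r : ℂ → ℂ, AnalyticAt ℂ r (f w) ∧ r (f w) = w ∧
      (∀ᶠ ω in 𝓝 w, r (f ω) = ω) ∧ ∀ᶠ y in 𝓝 (f w), f (r y) = y :=
  ⟨_, hf.analyticAt_localInverse hf', HasStrictFDerivAt.localInverse_apply_image ..,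
    HasStrictFDerivAt.eventually_left_inverse .., HasStrictDerivAt.eventually_right_inverse ..⟩

theorem MeromorphicOn.eventually_eq_of_eventually_eq {F : ℂ → ℂ} {U : Set ℂ}
    (hF : MeromorphicOn F U) (hU : IsPreconnected U) {x y : ℂ} (hx : x ∈ U) (hy : y ∈ U)
    (h : ∀ᶠ ζ in 𝓝[≠] x, F ζ = 0) : ∀ᶠ ζ in 𝓝[≠] y, F ζ = 0 := by
  by_contra hcon
  have h1 : meromorphicOrderAt F y ≠ ⊤ := fun h2 => hcon (meromorphicOrderAt_eq_top_iff.mp h2)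
  exact hF.meromorphicOrderAt_ne_top_of_isPreconnected hU hy hx h1
    (meromorphicOrderAt_eq_top_iff.mpr h)

theorem GermRelClosure.map_eq {f : ℂ → ℂ} (hf : Meromorphic f) {z w : ℂ}
    (h : GermRelClosure f z w) (hz : ContinuousAt f z) (hw : ContinuousAt f w) : f w = f z :=
  tendsto_nhds_unique (hw.tendsto.mono_left nhdsWithin_le_nhds) (h.tendsto hf hz)

/-- Noncritical points with the same value are exchanged by a unique germ leaving `f` invariant. -/
theorem exists_germ_of_map_eq {f : ℂ → ℂ} {z w : ℂ} (hfz : AnalyticAt ℂ f z)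
    (hfz' : deriv f z ≠ 0) (hfw : AnalyticAt ℂ f w) (hfw' : deriv f w ≠ 0) (hval : f w = f z) :
    ∃ ρ σ, AnalyticAt ℂ ρ z ∧ AnalyticAt ℂ σ w ∧ ρ z = w ∧ σ w = z ∧
      (∀ᶠ ζ in 𝓝 z, σ (ρ ζ) = ζ) ∧ (∀ᶠ ω in 𝓝 w, ρ (σ ω) = ω) ∧ (∀ᶠ ζ in 𝓝 z, f (ρ ζ) = f ζ) ∧
      ∀ᶠ p : ℂ × ℂ in 𝓝 (z, w), f p.2 = f p.1 → p.2 = ρ p.1 := by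
  obtain ⟨r, hr, hrw, hrl, hrr⟩ := hfw.exists_localInverse hfw'
  obtain ⟨s, hs, hsz, hsl, hsr⟩ := hfz.exists_localInverse hfz'
  have hρf : ∀ᶠ ζ in 𝓝 z, f (r (f ζ)) = f ζ :=
    hfz.continuousAt.eventually (by rw [← hval]; exact hrr)
  have hσf : ∀ᶠ ω in 𝓝 w, f (s (f ω)) = f ω :=
    hfw.continuousAt.eventually (by rw [hval]; exact hsr)
  refine ⟨fun ζ => r (f ζ), fun ω => s (f ω), (hval ▸ hr).fun_comp hfz, (hval ▸ hs).fun_comp hfw,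
    (congrArg r hval).symm.trans hrw, (congrArg s hval).trans hsz, ?_, ?_, hρf, ?_⟩
  · filter_upwards [hρf, hsl] with ζ h1 h2
    rw [h1, h2]
  · filter_upwards [hσf, hrl] with ζ h1 h2
    rw [h1, h2]
  · filter_upwards [(continuous_snd.tendsto (z, w)).eventually hrl] with p h3 h4
    rw [← h4, h3]

/-- Near a pair in the closure of the relation consisting of two noncritical points, the relation
is the graph of an invariant germ. -/
theorem GermRelClosure.exists_germ {f : ℂ → ℂ} (hf : Meromorphic f) {z w : ℂ}
    (h : GermRelClosure f z w) (hz : z ≠ 0) (hw : w ≠ 0) (hfz : AnalyticAt ℂ f z)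
    (hfz' : deriv f z ≠ 0) (hfw : AnalyticAt ℂ f w) (hfw' : deriv f w ≠ 0) :
    ∃ ρ σ, IsInvariantGerm f (circleConj f) ρ σ z w ∧
      ∀ᶠ p : ℂ × ℂ in 𝓝 (z, w), GermRel f p.1 p.2 → p.2 = ρ p.1 := by
  obtain ⟨ρ, σ, hρa, hσa, hρz, hσw, hσρ, hρσ, hρf, huniq'⟩ := exists_germ_of_map_eq hfz hfz' hfw hfw'
    (h.map_eq hf hfz.continuousAt hfw.continuousAt)
  have huniq : ∀ᶠ p : ℂ × ℂ in 𝓝 (z, w), GermRel f p.1 p.2 → p.2 = ρ p.1 := by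
    filter_upwards [(continuous_fst.tendsto (z, w)).eventually hfz.eventually_analyticAt,
      (continuous_snd.tendsto (z, w)).eventually hfw.eventually_analyticAt, huniq']
      with p h1 h2 h3 h4
    exact h3 (h4.map_eq h1.continuousAt h2.continuousAt)
  refine ⟨ρ, σ, ⟨hρa, hσa, hρz, hσw, hσρ, hρσ, ?_⟩, huniq⟩
  -- The germ `ρ` is found from `f` alone. Related pairs near `(z, w)` lie on its graph, so `ρ`
  -- preserves the reflection of `f` near one nearby point, and the identity theorem for meromorphic
  -- functions carries this back to `z`.
  have hgood : ∀ᶠ ζ in 𝓝 z, AnalyticAt ℂ ρ ζ ∧ ρ ζ ≠ 0 ∧ ζ ≠ 0 :=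
    hρa.eventually_analyticAt.and ((hρa.continuousAt.eventually_ne (by rwa [hρz])).and
      (isOpen_ne.mem_nhds hz))
  obtain ⟨ε, hε, hball⟩ := Metric.eventually_nhds_iff_ball.mp hgood
  have hmer : MeromorphicOn (fun ζ => circleConj f (ρ ζ) - circleConj f ζ) (ball z ε) := by
    intro ζ hζ
    obtain ⟨h1, h2, h3⟩ := hball ζ hζ
    exact (MeromorphicAt.comp_analyticAt (g := ρ)
      (MeromorphicAt.circleConj h2 (hf _)) h1).fun_sub
      (MeromorphicAt.circleConj (f := f) (z := ζ) h3 (hf _))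
  have hev : ∀ᶠ p : ℂ × ℂ in 𝓝 (z, w), p.1 ∈ ball z ε :=
    (continuous_fst.tendsto (z, w)).eventually (ball_mem_nhds z hε)
  obtain ⟨⟨x, y⟩, ⟨hx, hy, ρ', σ', hg⟩, hxball, hxy⟩ :=
    (Filter.Frequently.and_eventually h (hev.and (eventually_eventually_nhds.mpr huniq))).exists
  have hpair : Tendsto (fun ζ => (ζ, ρ' ζ)) (𝓝 x) (𝓝 (x, y)) :=
    tendsto_id.prodMk_nhds hg.tendsto
  have hx0 : ∀ᶠ ζ in 𝓝[≠] x, circleConj f (ρ ζ) - circleConj f ζ = 0 := by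
    filter_upwards [hg.invariant, (hg.eventually_germRel hx hy).filter_mono nhdsWithin_le_nhds,
      (hpair.eventually hxy).filter_mono nhdsWithin_le_nhds] with ζ h1 h2 h3
    have h4 : ρ' ζ = ρ ζ := h3 h2
    rw [← h4, h1.2, sub_self]
  have hz0 := hmer.eventually_eq_of_eventually_eq (convex_ball z ε).isPreconnected hxball
    (mem_ball_self hε) hx0
  filter_upwards [hz0, hρf.filter_mono nhdsWithin_le_nhds] with ζ h1 h2
  exact ⟨h2, sub_eq_zero.mp h1⟩

theorem GermRelClosure.germRel {f : ℂ → ℂ} (hf : Meromorphic f) {z w : ℂ}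
    (h : GermRelClosure f z w) (hz : z ≠ 0) (hw : w ≠ 0) (hfz : AnalyticAt ℂ f z)
    (hfz' : deriv f z ≠ 0) (hfw : AnalyticAt ℂ f w) (hfw' : deriv f w ≠ 0) : GermRel f z w := by
  obtain ⟨ρ, σ, hg, -⟩ := h.exists_germ hf hz hw hfz hfz' hfw hfw'
  exact ⟨hz, hw, ρ, σ, hg⟩

end germs

/-! ### Meromorphy at infinity, connectedness and propagation of the relation -/

section transcendental
open Filter Topology

theorem MeromorphicNFAt.analyticAt_of_tendsto {f : ℂ → ℂ} {z c : ℂ} (hf : MeromorphicNFAt f z)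
    (h : Tendsto f (𝓝[≠] z) (𝓝 c)) : AnalyticAt ℂ f z := by
  rw [← hf.meromorphicOrderAt_nonneg_iff_analyticAt]
  exact (tendsto_nhds_iff_meromorphicOrderAt_nonneg hf.meromorphicAt).mp ⟨c, h⟩

theorem MeromorphicNFAt.analyticAt_of_eventually_norm_le {f : ℂ → ℂ} {z : ℂ} {M : ℝ}
    (hf : MeromorphicNFAt f z) (h : ∀ᶠ ζ in 𝓝[≠] z, ‖f ζ‖ ≤ M) : AnalyticAt ℂ f z ∧ ‖f z‖ ≤ M := by
  have h1 : AnalyticAt ℂ f z := by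
    rw [← hf.meromorphicOrderAt_nonneg_iff_analyticAt]
    by_contra hneg
    have h2 := tendsto_cobounded_of_meromorphicOrderAt_neg (not_le.mp hneg)
    obtain ⟨ζ, h3, h4⟩ := (h.and ((tendsto_norm_cobounded_atTop.comp h2).eventually
      (eventually_gt_atTop M))).exists
    exact absurd h3 (not_le.mpr h4)
  exact ⟨h1, le_of_tendsto (h1.continuousAt.norm.tendsto.mono_left nhdsWithin_le_nhds) h⟩

theorem meromorphicAt_of_differentiable_of_norm_le {f : ℂ → ℂ} {z : ℂ} {M : ℝ}
    (hd : ∀ᶠ ζ in 𝓝[≠] z, DifferentiableAt ℂ f ζ) (hb : ∀ᶠ ζ in 𝓝[≠] z, ‖f ζ‖ ≤ M) :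
    MeromorphicAt f z := by
  obtain ⟨ε, hε, h⟩ := Metric.nhdsWithin_basis_ball.eventually_iff.mp (hd.and hb)
  have hmem : ∀ ζ ∈ ball z ε \ {z}, ζ ∈ ball z ε ∩ {z}ᶜ := fun ζ hζ => hζ
  have h1 := Complex.differentiableOn_update_limUnder_of_bddAbove (f := f) (ball_mem_nhds z hε)
    (fun ζ hζ => (h (hmem ζ hζ)).1.differentiableWithinAt)
    ⟨M, by rintro _ ⟨ζ, hζ, rfl⟩; exact (h (hmem ζ hζ)).2⟩
  have h2 : AnalyticAt ℂ (Function.update f z (limUnder (𝓝[≠] z) f)) z :=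
    h1.analyticAt (ball_mem_nhds z hε)
  refine h2.meromorphicAt.congr ?_
  filter_upwards [self_mem_nhdsWithin] with ζ hζ
  exact Function.update_of_ne hζ _ _

/-- A meromorphic function which is bounded near infinity is meromorphic there. -/
theorem meromorphicAt_comp_inv_of_norm_le {f : ℂ → ℂ} {R M : ℝ} (hf : ∀ z, MeromorphicNFAt f z)
    (h : ∀ ω, R < ‖ω‖ → ∀ᶠ ζ in 𝓝[≠] ω, ‖f ζ‖ ≤ M) : MeromorphicAt (fun z => f z⁻¹) 0 := by
  have h1 : ∀ᶠ z in 𝓝[≠] (0 : ℂ), R < ‖z⁻¹‖ :=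
    (tendsto_norm_cobounded_atTop.comp tendsto_inv₀_nhdsNE_zero).eventually (eventually_gt_atTop R)
  have h2 : ∀ᶠ z in 𝓝[≠] (0 : ℂ), z ≠ 0 := self_mem_nhdsWithin
  refine meromorphicAt_of_differentiable_of_norm_le (M := M) ?_ ?_
  · filter_upwards [h1, h2] with z hz hz0
    exact (((hf _).analyticAt_of_eventually_norm_le (h _ hz)).1.fun_comp
      (analyticAt_inv hz0)).differentiableAt
  · filter_upwards [h1] with z hz
    exact ((hf _).analyticAt_of_eventually_norm_le (h _ hz)).2

theorem meromorphicAt_comp_inv_of_le_norm {f : ℂ → ℂ} {R : ℝ} (hf : ∀ z, MeromorphicNFAt f z)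
    (h : ∀ ω, R < ‖ω‖ → ∀ᶠ ζ in 𝓝[≠] ω, 1 ≤ ‖f ζ‖) : MeromorphicAt (fun z => f z⁻¹) 0 := by
  have h1 : MeromorphicAt (fun z => f⁻¹ z⁻¹) 0 := by
    refine meromorphicAt_comp_inv_of_norm_le (R := R) (M := 1) (fun z => (hf z).inv) fun ω hω => ?_
    filter_upwards [h ω hω] with ζ hζ
    rw [Pi.inv_apply, norm_inv]
    exact inv_le_one_of_one_le₀ hζ
  refine h1.inv.congr (Eventually.of_forall fun z => ?_)
  simp

/-- Near every point a meromorphic function is either bounded or bounded away from zero. -/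
theorem MeromorphicAt.eventually_norm_le_or {g : ℂ → ℂ} {w : ℂ} (hg : MeromorphicAt g w) :
    (∃ M : ℝ, ∀ᶠ ω in 𝓝[≠] w, ‖g ω‖ ≤ M) ∨ ∀ᶠ ω in 𝓝[≠] w, 1 ≤ ‖g ω‖ := by
  rcases lt_or_ge (meromorphicOrderAt g w) 0 with hneg | hpos
  · exact Or.inr ((tendsto_norm_cobounded_atTop.comp
      (tendsto_cobounded_of_meromorphicOrderAt_neg hneg)).eventually (eventually_ge_atTop 1))
  · obtain ⟨c, hc⟩ := tendsto_nhds_of_meromorphicOrderAt_nonneg hg hpos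
    exact Or.inl ⟨‖c‖ + 1, (hc.norm.eventually (gt_mem_nhds (lt_add_one _))).mono
      fun _ h => le_of_lt h⟩

theorem isPreconnected_ball_diff_of_countable {C : Set ℂ} (hC : C.Countable) {δ : ℝ}
    (hδ : 0 < δ) : IsPreconnected (ball (0 : ℂ) δ \ C) := by
  set e := OpenPartialHomeomorph.univBall (0 : ℂ) δ
  have ht : e.target = ball 0 δ := OpenPartialHomeomorph.univBall_target _ hδ
  have hs : e.source = univ := OpenPartialHomeomorph.univBall_source _ _
  have h1 : (e '' (e.symm '' (C ∩ ball 0 δ))ᶜ) = ball 0 δ \ C := by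
    ext z
    constructor
    · rintro ⟨y, hy, rfl⟩
      have hm : e y ∈ e.target := e.map_source (by rw [hs]; trivial)
      refine ⟨ht ▸ hm, fun hC => hy ⟨e y, ⟨hC, ht ▸ hm⟩, e.left_inv (by rw [hs]; trivial)⟩⟩
    · rintro ⟨hz, hzC⟩
      rw [← ht] at hz
      refine ⟨e.symm z, ?_, e.right_inv hz⟩
      rintro ⟨y, ⟨hyC, hy⟩, hyz⟩
      rw [← ht] at hy
      exact hzC (e.symm.injOn hy hz hyz ▸ hyC)
  rw [← h1]
  have h2 : ((e.symm '' (C ∩ ball 0 δ))ᶜ).Nonempty ∧ IsPreconnected (e.symm '' (C ∩ ball 0 δ))ᶜ :=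
    Set.Countable.isConnected_compl_of_one_lt_rank (by simp [Complex.rank_real_complex])
      ((hC.mono inter_subset_left).image _)
  exact h2.2.image _ (e.continuousOn.mono (by rw [hs]; exact subset_univ _))

theorem isPreconnected_exterior_diff_of_countable {C : Set ℂ} (hC : C.Countable) {M : ℝ}
    (hM : 0 < M) : IsPreconnected ({w : ℂ | M < ‖w‖} \ C) := by
  have h1 : Inv.inv '' (ball (0 : ℂ) M⁻¹ \ (insert 0 (Inv.inv '' C))) = {w : ℂ | M < ‖w‖} \ C := by
    ext w
    constructor
    · rintro ⟨z, ⟨hz, hzC⟩, rfl⟩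
      rw [mem_insert_iff, not_or] at hzC
      refine ⟨?_, fun hC => hzC.2 ⟨z⁻¹, hC, inv_inv z⟩⟩
      rw [Set.mem_ofPred_eq, norm_inv, lt_inv_comm₀ hM (norm_pos_iff.mpr hzC.1)]
      simpa using hz
    · rintro ⟨hw, hwC⟩
      have hw' : M < ‖w‖ := hw
      have hw0 : w ≠ 0 := norm_pos_iff.mp (hM.trans hw')
      refine ⟨w⁻¹, ⟨?_, ?_⟩, inv_inv w⟩
      · rw [mem_ball_zero_iff, norm_inv]
        exact inv_strictAnti₀ hM hw'
      · rintro (h | ⟨y, hy, hyw⟩)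
        · exact hw0 (inv_eq_zero.mp h)
        · exact hwC (inv_injective hyw ▸ hy)
  rw [← h1]
  refine (isPreconnected_ball_diff_of_countable ((hC.image _).insert 0) (inv_pos.mpr hM)).image _ ?_
  refine continuousOn_inv₀.mono fun z hz => ?_
  exact fun h => hz.2 (Or.inl h)

/-- A discrete subset of a second countable space is countable; this is the source of the countable
exceptional set. -/
theorem countable_of_eventually_notMem {X : Type*} [TopologicalSpace X]
    [SecondCountableTopology X] {C : Set X} (h : ∀ z ∈ C, ∀ᶠ ζ in 𝓝[≠] z, ζ ∉ C) :
    C.Countable := by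
  refine (HereditarilyLindelofSpace.isLindelof C).countable_of_isDiscrete
    (isDiscrete_iff_nhdsNE.mpr fun z hz => ?_)
  rw [← disjoint_iff, disjoint_principal_right]
  exact h z hz

theorem exists_germRelClosure_of_frequently {f : ℂ → ℂ} {z : ℂ} {K : Set ℂ} (hK : IsCompact K)
    (h : ∃ᶠ z' in 𝓝 z, ∃ w ∈ K, GermRel f z' w) : ∃ w ∈ K, GermRelClosure f z w := by
  by_contra hcon
  push Not at hcon
  have h1 := hK.eventually_forall_of_forall_eventually (x₀ := z)
    (P := fun z' w => ¬ GermRel f z' w) fun w hw => not_frequently.mp (hcon w hw)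
  obtain ⟨z', ⟨w, hw, h2⟩, h3⟩ := (h.and_eventually h1).exists
  exact h3 w hw h2

/-- Propagation of the relation along a connected set. -/
theorem exists_germRel_of_isPreconnected {f : ℂ → ℂ} (hf : Meromorphic f) {Ω V : Set ℂ}
    (hΩ : IsPreconnected Ω) (hΩo : IsOpen Ω) (hV : IsOpen V)
    (hΩf : ∀ z ∈ Ω, z ≠ 0 ∧ AnalyticAt ℂ f z ∧ deriv f z ≠ 0)
    (hK : ∀ z ∈ Ω, ∃ K, IsCompact K ∧
      (∀ w ∈ K, GermRelClosure f z w → w ∈ V ∧ w ≠ 0 ∧ AnalyticAt ℂ f w ∧ deriv f w ≠ 0) ∧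
      ∀ᶠ z' in 𝓝 z, ∀ w ∈ V, GermRel f z' w → w ∈ K)
    (hne : ∃ z ∈ Ω, ∃ w ∈ V, GermRel f z w) : ∀ z ∈ Ω, ∃ w ∈ V, GermRel f z w := by
  have hopen : IsOpen {z | z ∈ Ω ∧ ∃ w ∈ V, GermRel f z w} := by
    rw [isOpen_iff_mem_nhds]
    rintro z ⟨hz, w, hw, hz0, hw0, ρ, σ, hg⟩
    filter_upwards [hΩo.mem_nhds hz, hg.eventually_germRel hz0 hw0,
      hg.tendsto.eventually (hV.mem_nhds hw)] with ζ h1 h2 h3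
    exact ⟨h1, ρ ζ, h3, h2⟩
  obtain ⟨z₀, hz₀, hw₀⟩ := hne
  refine fun z hz => (hΩ.subset_of_closure_inter_subset hopen ⟨z₀, hz₀, hz₀, hw₀⟩ ?_ hz).2
  -- For relative closedness: the compact set `K` keeps the partners of points near `z` from
  -- escaping, so they accumulate at a partner in the closed relation, which is noncritical and
  -- hence truly related to `z`.
  rintro z ⟨hz, hzΩ⟩
  obtain ⟨K, hKc, hK1, hK2⟩ := hK z hzΩ
  rw [mem_closure_iff_frequently] at hz
  obtain ⟨w, hwK, hzw⟩ := exists_germRelClosure_of_frequently hKc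
    ((hz.and_eventually hK2).mono fun z' ⟨⟨_, w, hw, h1⟩, h2⟩ => ⟨w, h2 w hw h1, h1⟩)
  obtain ⟨hwV, hw0, hw1, hw2⟩ := hK1 w hwK hzw
  obtain ⟨hz0, hz1, hz2⟩ := hΩf z hzΩ
  exact ⟨hzΩ, w, hwV, hzw.germRel hf hz0 hw0 hz1 hz2 hw1 hw2⟩

end transcendental

/-! ### Related points stay away from 0 and infinity -/

section transcendental
open Filter Topology

/-- Meromorphic functions in normal form on `ℂ`, holomorphic at `0`, which are nowhere locally
constant and do not extend meromorphically to infinity. -/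
structure IsTranscendentalMeromorphic (f : ℂ → ℂ) : Prop where
  nf : ∀ z, MeromorphicNFAt f z
  analyticAt_zero : AnalyticAt ℂ f 0
  deriv_ne : ∀ z, ∀ᶠ ω in 𝓝[≠] z, deriv f ω ≠ 0
  not_meromorphicAt : ¬ MeromorphicAt (fun z => f z⁻¹) 0

theorem eventually_nhdsNE_ne (z v : ℂ) : ∀ᶠ ζ in 𝓝[≠] z, ζ ≠ v := by
  rcases eq_or_ne z v with rfl | h
  · exact self_mem_nhdsWithin
  · exact mem_nhdsWithin_of_mem_nhds (isOpen_ne.mem_nhds h)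

theorem isClosed_critical (f : ℂ → ℂ) : IsClosed {z | ¬ (AnalyticAt ℂ f z ∧ deriv f z ≠ 0)} := by
  rw [← isOpen_compl_iff, isOpen_iff_mem_nhds]
  intro z hz
  obtain ⟨h1, h2⟩ := not_not.mp hz
  filter_upwards [h1.eventually_analyticAt, h1.deriv.continuousAt.eventually_ne h2] with ζ h3 h4
  exact not_not.mpr ⟨h3, h4⟩

namespace IsTranscendentalMeromorphic
variable {f : ℂ → ℂ} (hf : IsTranscendentalMeromorphic f)
include hf

theorem meromorphic : Meromorphic f := fun z => (hf.nf z).meromorphicAt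

theorem eventually_ne (z c : ℂ) : ∀ᶠ ω in 𝓝[≠] z, f ω ≠ c := by
  rcases ((hf.meromorphic z).fun_sub (MeromorphicAt.const c z)).eventually_eq_zero_or_eventually_ne_zero
    with h | h
  · exfalso
    have h2 : ∀ᶠ ω in 𝓝[≠] z, ∀ᶠ ζ in 𝓝 ω, f ζ = c := by
      have := eventually_eventually_nhdsWithin.mpr h
      filter_upwards [this, self_mem_nhdsWithin] with ω h3 h4
      rw [isOpen_compl_singleton.nhdsWithin_eq h4] at h3
      exact h3.mono fun ζ h => sub_eq_zero.mp h
    obtain ⟨ω, h3, h4⟩ := ((hf.deriv_ne z).and h2).exists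
    refine h3 ?_
    rw [EventuallyEq.deriv_eq (f := fun _ => c) h4, deriv_const]
  · exact h.mono fun ω h => sub_ne_zero.mp h

theorem analyticAt_of_germRelClosure {z w : ℂ} (h : GermRelClosure f z w)
    (hz : ContinuousAt f z) : AnalyticAt ℂ f w :=
  (hf.nf w).analyticAt_of_tendsto (h.tendsto hf.meromorphic hz)

/-- Near `w` the reflection of `f` is bounded or bounded away from 0. Neither property can hold for
`f` near infinity, since either would make `f` meromorphic there. -/
theorem not_forall_of_dichotomy {w : ℂ} (hw : w ≠ 0) : ∃ D : ℝ → Prop,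
    (∀ᶠ ω in 𝓝[≠] w, D ‖circleConj f ω‖) ∧
      ∀ R : ℝ, ¬ ∀ ω, R < ‖ω‖ → ∀ᶠ ζ in 𝓝[≠] ω, D ‖f ζ‖ := by
  rcases (MeromorphicAt.circleConj hw (hf.meromorphic _)).eventually_norm_le_or with ⟨M, h⟩ | h
  · exact ⟨fun x => x ≤ M, h, fun R hR => hf.not_meromorphicAt
      (meromorphicAt_comp_inv_of_norm_le hf.nf hR)⟩
  · exact ⟨fun x => 1 ≤ x, h, fun R hR => hf.not_meromorphicAt
      (meromorphicAt_comp_inv_of_le_norm hf.nf hR)⟩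

theorem exists_ball_noncritical : ∃ δ > 0, ∀ z ∈ ball (0 : ℂ) δ,
    AnalyticAt ℂ f z ∧ (z ≠ 0 → deriv f z ≠ 0) :=
  Metric.eventually_nhds_iff_ball.mp
    (hf.analyticAt_zero.eventually_analyticAt.and (eventually_nhdsWithin_iff.mp (hf.deriv_ne 0)))

/-- If the relation accumulated at `(0, w₀)`, then every small `z ≠ 0` would have a partner near
`w₀`. The reflection of `f` would then be as tame near 0 as near `w₀`, that is, `f` would be tame
near infinity. -/
theorem not_germRelClosure_zero {w₀ : ℂ} (hw₀ : w₀ ≠ 0) : ¬ GermRelClosure f 0 w₀ := by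
  intro h0
  have hw₀a := hf.analyticAt_of_germRelClosure h0 hf.analyticAt_zero.continuousAt
  obtain ⟨D, hD, hDR⟩ := hf.not_forall_of_dichotomy hw₀
  have hev : ∀ᶠ ω in 𝓝 w₀, (ω ≠ w₀ → deriv f ω ≠ 0 ∧ f ω ≠ f 0 ∧ D ‖circleConj f ω‖) ∧
      AnalyticAt ℂ f ω ∧ ω ≠ 0 :=
    (eventually_nhdsWithin_iff.mp ((hf.deriv_ne w₀).and ((hf.eventually_ne w₀ (f 0)).and hD))).and
      (hw₀a.eventually_analyticAt.and (isOpen_ne.mem_nhds hw₀))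
  obtain ⟨r, hr, hball⟩ := Metric.nhds_basis_closedBall.eventually_iff.mp hev
  have hA : IsCompact (closedBall w₀ r \ ball w₀ (r / 2)) :=
    (isCompact_closedBall _ _).diff isOpen_ball
  -- On this annulus `f` avoids the value `f 0`, so it contains no partners of points near 0. This
  -- separation lets the relation propagate over the punctured disk.
  have hAK : ∀ᶠ z in 𝓝 (0 : ℂ), ∀ w ∈ closedBall w₀ r \ ball w₀ (r / 2), ¬ GermRel f z w := by
    refine hA.eventually_forall_of_forall_eventually (P := fun z w => ¬ GermRel f z w)
      fun w hw => not_frequently.mp fun h1 => ?_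
    have hne : w ≠ w₀ := by
      rintro rfl
      exact hw.2 (mem_ball_self (by positivity))
    exact ((hball hw.1).1 hne).2.1 (GermRelClosure.map_eq hf.meromorphic h1
      hf.analyticAt_zero.continuousAt (hball hw.1).2.1.continuousAt)
  obtain ⟨δ₀, hδ₀, hδball⟩ := hf.exists_ball_noncritical
  obtain ⟨δ, hδ, hδs⟩ := Metric.eventually_nhds_iff_ball.mp
    (hAK.and ((eventually_mem_set.mpr (ball_mem_nhds (0 : ℂ) hδ₀)).and
      (eventually_nhdsWithin_iff.mp (hf.eventually_ne 0 (f 0)))))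
  have hpre : IsPreconnected (ball (0 : ℂ) δ \ {0}) :=
    isPreconnected_ball_diff_of_countable (countable_singleton 0) hδ
  have hΩo : IsOpen (ball (0 : ℂ) δ \ {0}) := isOpen_ball.sdiff isClosed_singleton
  have key : ∀ z ∈ ball (0 : ℂ) δ \ {0}, ∃ w ∈ ball w₀ r, GermRel f z w := by
    refine exists_germRel_of_isPreconnected hf.meromorphic hpre hΩo isOpen_ball
      (fun z hz => ⟨hz.2, (hδball z (hδs z hz.1).2.1).1, (hδball z (hδs z hz.1).2.1).2 hz.2⟩)
      (fun z hz => ⟨closedBall w₀ (r / 2), isCompact_closedBall _ _, fun w hw h1 => ?_, ?_⟩) ?_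
    · have hwr : w ∈ ball w₀ r := closedBall_subset_ball (by linarith) hw
      have hb := hball (ball_subset_closedBall hwr)
      have hval := GermRelClosure.map_eq hf.meromorphic h1
        (hδball z (hδs z hz.1).2.1).1.continuousAt hb.2.1.continuousAt
      have hne : w ≠ w₀ := by
        rintro rfl
        have h2 := GermRelClosure.map_eq hf.meromorphic h0 hf.analyticAt_zero.continuousAt
          hb.2.1.continuousAt
        exact (hδs z hz.1).2.2 hz.2 (hval.symm.trans h2)
      exact ⟨hwr, hb.2.2, hb.2.1, (hb.1 hne).1⟩
    · filter_upwards [hΩo.mem_nhds hz] with z' hz' w hw h1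
      by_contra h2
      exact (hδs z' hz'.1).1 w ⟨ball_subset_closedBall hw, fun h3 => h2 (ball_subset_closedBall h3)⟩ h1
    · obtain ⟨p, h1, h2⟩ := (Filter.Frequently.and_eventually h0
        (prod_mem_nhds (ball_mem_nhds (0 : ℂ) hδ) (ball_mem_nhds w₀ hr))).exists
      exact ⟨p.1, ⟨h2.1, h1.1⟩, p.2, h2.2, h1⟩
  refine hDR δ⁻¹ fun ω hω => ?_
  have hω0 : ω ≠ 0 := norm_pos_iff.mp ((inv_pos.mpr hδ).trans hω)
  obtain ⟨w, hw, -, -, ρ, σ, hg⟩ := key (circleRefl ω) ⟨by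
    rw [mem_ball_zero_iff, norm_circleRefl]; exact inv_lt_of_inv_lt₀ hδ hω, circleRefl_ne_zero hω0⟩
  have h1 : ∀ᶠ ω' in 𝓝[≠] w, D ‖circleConj f ω'‖ := by
    filter_upwards [eventually_nhdsNE_ne w w₀,
      mem_nhdsWithin_of_mem_nhds (isOpen_ball.mem_nhds hw)] with ω' h2 h3
    exact ((hball (ball_subset_closedBall h3)).1 h2).2.2
  filter_upwards [(tendsto_circleRefl_nhdsNE hω0).eventually
    ((hg.tendsto_nhdsNE.eventually h1).and hg.invariant)] with ζ h2
  have h3 := h2.1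
  rw [h2.2.2, circleConj_apply, circleRefl_circleRefl, RCLike.norm_conj] at h3
  exact h3

theorem not_germRelClosure_zero_right {w : ℂ} (hw : w ≠ 0) : ¬ GermRelClosure f w 0 :=
  fun h => hf.not_germRelClosure_zero hw h.symm

/-- After reflection, a very large partner of a point of `K` becomes a point near 0 related to a
point of a compact set avoiding 0. This is excluded by `not_germRelClosure_zero`. -/
theorem exists_norm_le_of_isCompact {K : Set ℂ} (hK : IsCompact K) (h0 : (0 : ℂ) ∉ K) :
    ∃ M > 0, ∀ z ∈ K, ∀ w, GermRel f z w → ‖w‖ ≤ M := by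
  have hK' : IsCompact (circleRefl '' K) := hK.image_of_continuousOn fun z hz =>
    (continuousAt_circleRefl fun h => h0 (h ▸ hz)).continuousWithinAt
  have h1 := hK'.eventually_forall_of_forall_eventually (x₀ := (0 : ℂ))
    (P := fun y z => ¬ GermRel f y z) fun z hz => not_frequently.mp <| by
      obtain ⟨z, hz, rfl⟩ := hz
      exact hf.not_germRelClosure_zero (circleRefl_ne_zero fun h => h0 (h ▸ hz))
  obtain ⟨ε, hε, hball⟩ := Metric.eventually_nhds_iff_ball.mp h1
  refine ⟨ε⁻¹, inv_pos.mpr hε, fun z hz w h => ?_⟩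
  by_contra! hcon
  refine hball (circleRefl w) ?_ (circleRefl z) (mem_image_of_mem _ hz) h.symm.reflect
  rw [mem_ball_zero_iff, norm_circleRefl]
  exact inv_lt_of_inv_lt₀ hε hcon

theorem countable_critical : {z | ¬ (AnalyticAt ℂ f z ∧ deriv f z ≠ 0)}.Countable :=
  countable_of_eventually_notMem fun z _ =>
    ((hf.meromorphic z).eventually_analyticAt.and (hf.deriv_ne z)).mono fun _ h => not_not.mpr h

/-- The partners of an annulus around 0 have norm at most `M`. If some point inside had a partner
beyond `M`, propagation would give every noncritical point beyond `M` a partner inside, and `f`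
would be bounded near infinity. -/
theorem exists_norm_le_of_norm_lt : ∃ δ > 0, ∃ M, ∀ z w, ‖z‖ < δ → GermRel f z w → ‖w‖ ≤ M := by
  obtain ⟨δ, hδ, hball⟩ := hf.exists_ball_noncritical
  have hδ2 : closedBall (0 : ℂ) (δ / 2) ⊆ ball 0 δ := closedBall_subset_ball (by linarith)
  have hA : IsCompact (closedBall (0 : ℂ) (δ / 2) \ ball 0 (δ / 4)) :=
    (isCompact_closedBall _ _).diff isOpen_ball
  obtain ⟨M, hM, hMA⟩ := hf.exists_norm_le_of_isCompact hA
    (fun h => h.2 (mem_ball_self (by positivity)))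
  refine ⟨δ / 2, by positivity, M, ?_⟩
  by_contra! hcon
  obtain ⟨z₁, w₁, hz₁, h₁, hw₁⟩ := hcon
  set C := {z | ¬ (AnalyticAt ℂ f z ∧ deriv f z ≠ 0)}
  have hΩo : IsOpen ({w : ℂ | M < ‖w‖} \ C) :=
    (isOpen_lt continuous_const continuous_norm).sdiff (isClosed_critical f)
  have hext : ∀ w ∈ {w : ℂ | M < ‖w‖} \ C, w ≠ 0 ∧ AnalyticAt ℂ f w ∧ deriv f w ≠ 0 :=
    fun w hw => ⟨norm_pos_iff.mp (hM.trans hw.1), not_not.mp hw.2⟩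
  have key : ∀ w ∈ {w : ℂ | M < ‖w‖} \ C, ∃ z ∈ ball (0 : ℂ) (δ / 2), GermRel f w z := by
    refine exists_germRel_of_isPreconnected hf.meromorphic
      (isPreconnected_exterior_diff_of_countable hf.countable_critical hM) hΩo isOpen_ball hext
      (fun w hw => ⟨closedBall 0 (δ / 4), isCompact_closedBall _ _, fun z hz h => ?_, ?_⟩) ?_
    · have hz' : z ∈ ball (0 : ℂ) (δ / 2) := closedBall_subset_ball (by linarith) hz
      have hz0 : z ≠ 0 := by
        rintro rfl
        exact hf.not_germRelClosure_zero_right (hext w hw).1 h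
      have hb := hball z (hδ2 (ball_subset_closedBall hz'))
      exact ⟨hz', hz0, hb.1, hb.2 hz0⟩
    · filter_upwards [hΩo.mem_nhds hw] with w' hw' z hz h
      by_contra h2
      exact absurd (hMA z ⟨ball_subset_closedBall hz, fun h3 => h2 (ball_subset_closedBall h3)⟩ w'
        h.symm) (not_le.mpr hw'.1)
    · obtain ⟨hz0, hw0, ρ, σ, hg⟩ := h₁
      have hs := hg.symm
      have h2 := (hs.eventually_germRel hw0 hz0).filter_mono (nhdsWithin_le_nhds (s := {w₁}ᶜ))
      have h3 := (hs.tendsto.eventually (isOpen_ball.mem_nhds (mem_ball_zero_iff.mpr hz₁))).filter_mono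
        (nhdsWithin_le_nhds (s := {w₁}ᶜ))
      have h4 : ∀ᶠ ζ in 𝓝[≠] w₁, M < ‖ζ‖ := mem_nhdsWithin_of_mem_nhds
        ((isOpen_lt continuous_const continuous_norm).mem_nhds hw₁)
      obtain ⟨ζ, h2, h3, h4, h5, h6⟩ := (h2.and (h3.and (h4.and
        ((hf.meromorphic w₁).eventually_analyticAt.and (hf.deriv_ne w₁))))).exists
      exact ⟨ζ, ⟨h4, not_not.mpr ⟨h5, h6⟩⟩, σ ζ, h3, h2⟩
  obtain ⟨B, hB⟩ := (isCompact_closedBall (0 : ℂ) (δ / 2)).exists_bound_of_continuousOn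
    fun z hz => (hball z (hδ2 hz)).1.continuousAt.continuousWithinAt
  refine hf.not_meromorphicAt (meromorphicAt_comp_inv_of_norm_le (R := M) (M := B) hf.nf
    fun ω hω => ?_)
  filter_upwards [mem_nhdsWithin_of_mem_nhds
    ((isOpen_lt continuous_const continuous_norm).mem_nhds hω),
    (hf.meromorphic ω).eventually_analyticAt, hf.deriv_ne ω] with ζ h1 h2 h3
  obtain ⟨z, hz, h⟩ := key ζ ⟨h1, not_not.mpr ⟨h2, h3⟩⟩
  have hz' := ball_subset_closedBall hz
  rw [← h.map_eq h2.continuousAt (hball z (hδ2 hz')).1.continuousAt]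
  exact hB z hz'

end IsTranscendentalMeromorphic
end transcendental

/-! ### Related points have comparable norms -/

section transcendental
open Filter Topology
namespace IsTranscendentalMeromorphic
variable {f : ℂ → ℂ} (hf : IsTranscendentalMeromorphic f)
include hf

theorem exists_eventually_sub_eq_pow_mul : ∃ l ≠ 0, ∃ h : ℂ → ℂ, AnalyticAt ℂ h 0 ∧ h 0 ≠ 0 ∧
    ∀ᶠ z in 𝓝 (0 : ℂ), f z - f 0 = z ^ l * h z := by
  have h1 : AnalyticAt ℂ (fun z => f z - f 0) 0 := hf.analyticAt_zero.sub analyticAt_const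
  have h2 : ¬ ∀ᶠ z in 𝓝 (0 : ℂ), f z - f 0 = 0 := fun h => by
    obtain ⟨z, h3, h4⟩ := ((hf.eventually_ne 0 (f 0)).and (h.filter_mono nhdsWithin_le_nhds)).exists
    exact h3 (sub_eq_zero.mp h4)
  obtain ⟨l, h, hh, hh0, hl⟩ := h1.exists_eventuallyEq_pow_smul_nonzero_iff.mpr h2
  refine ⟨l, ?_, h, hh, hh0, by simpa using hl⟩
  rintro rfl
  have := hl.self_of_nhds
  simp only [sub_self, pow_zero, one_smul] at this
  exact hh0 this.symm

/-- From `f z - f 0 = z ^ l * h z` with `|h|` between `|h 0| / 2` and `2 |h 0|`, equal values give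
`|w|^l ≤ 4 |z|^l ≤ (4 |z|)^l`. -/
theorem exists_ball_norm_le_of_eq :
    ∃ ε > 0, ∀ z ∈ ball (0 : ℂ) ε, ∀ w ∈ ball (0 : ℂ) ε, f w = f z → ‖w‖ ≤ 4 * ‖z‖ := by
  obtain ⟨l, hl0, h, hh, hh0, hl⟩ := hf.exists_eventually_sub_eq_pow_mul
  have hc : 0 < ‖h 0‖ := norm_pos_iff.mpr hh0
  have hn := hh.continuousAt.norm
  obtain ⟨ε, hε, hball⟩ := Metric.eventually_nhds_iff_ball.mp
    (hl.and ((hn.eventually (lt_mem_nhds (half_lt_self hc))).and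
      (hn.eventually (gt_mem_nhds (show ‖h 0‖ < 2 * ‖h 0‖ by linarith)))))
  refine ⟨ε, hε, fun z hz w hw hwz => ?_⟩
  obtain ⟨hz1, -, hz3⟩ := hball z hz
  obtain ⟨hw1, hw2, -⟩ := hball w hw
  rw [hwz, hz1] at hw1
  have h5 : ‖z‖ ^ l * ‖h z‖ = ‖w‖ ^ l * ‖h w‖ := by
    rw [← norm_pow, ← norm_mul, hw1, norm_mul, norm_pow]
  refine le_of_pow_le_pow_left₀ hl0 (by positivity) ?_
  have h6 : ‖w‖ ^ l * (‖h 0‖ / 2) ≤ ‖z‖ ^ l * (2 * ‖h 0‖) :=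
    (mul_le_mul_of_nonneg_left hw2.le (by positivity)).trans
      (h5.symm.le.trans (mul_le_mul_of_nonneg_left hz3.le (by positivity)))
  have h7 : ‖w‖ ^ l ≤ 4 * ‖z‖ ^ l := by
    refine le_of_mul_le_mul_right (a := ‖h 0‖ / 2) ?_ (by positivity)
    linarith
  rw [mul_pow]
  exact h7.trans (mul_le_mul_of_nonneg_right (le_self_pow₀ (by norm_num) hl0) (by positivity))

theorem exists_norm_le_mul_of_norm_lt :
    ∃ δ > 0, ∀ z w, ‖z‖ < δ → GermRel f z w → ‖w‖ ≤ 4 * ‖z‖ := by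
  obtain ⟨ε₀, hε₀, hball₀⟩ := hf.exists_ball_norm_le_of_eq
  obtain ⟨ε₁, hε₁, hball₁⟩ := hf.exists_ball_noncritical
  obtain ⟨δ, hδ, M, hM⟩ := hf.exists_norm_le_of_norm_lt
  set ε := min ε₀ ε₁
  have hε : 0 < ε := lt_min hε₀ hε₁
  have h1 := ((isCompact_closedBall (0 : ℂ) M).diff (isOpen_ball (x := (0 : ℂ)) (ε := ε))
    ).eventually_forall_of_forall_eventually (x₀ := (0 : ℂ))
    (P := fun z w => ¬ GermRel f z w) fun w hw => not_frequently.mp <|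
      hf.not_germRelClosure_zero fun h => hw.2 (h ▸ mem_ball_self hε)
  obtain ⟨δ', hδ', hball⟩ := Metric.eventually_nhds_iff_ball.mp h1
  refine ⟨min (min δ δ') ε, by positivity, fun z w hz h => ?_⟩
  rw [lt_min_iff, lt_min_iff] at hz
  have hzε : z ∈ ball (0 : ℂ) ε := mem_ball_zero_iff.mpr hz.2
  have hwε : w ∈ ball (0 : ℂ) ε := by
    by_contra hw
    exact hball z (mem_ball_zero_iff.mpr hz.1.2) w
      ⟨mem_closedBall_zero_iff.mpr (hM z w hz.1.1 h), hw⟩ h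
  have hb : ∀ u ∈ ball (0 : ℂ) ε, u ∈ ball (0 : ℂ) ε₀ ∧ u ∈ ball (0 : ℂ) ε₁ := fun u hu =>
    ⟨ball_subset_ball (min_le_left _ _) hu, ball_subset_ball (min_le_right _ _) hu⟩
  exact hball₀ z (hb z hzε).1 w (hb w hwε).1
    (h.map_eq (hball₁ z (hb z hzε).2).1.continuousAt (hball₁ w (hb w hwε).2).1.continuousAt)

/-- Related points have comparable absolute values. -/
theorem exists_norm_le_mul : ∃ C > 0, ∀ z w, GermRel f z w → ‖w‖ ≤ C * ‖z‖ := by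
  obtain ⟨δ, hδ, h⟩ := hf.exists_norm_le_mul_of_norm_lt
  -- The factor 4 covers small `z` and, by reflection, large `w`. In the remaining case `δ ≤ |z|`
  -- and `|w| ≤ δ⁻¹`.
  refine ⟨max 4 (δ⁻¹ / δ), by positivity, fun z w hzw => ?_⟩
  have hz : 0 < ‖z‖ := norm_pos_iff.mpr hzw.1
  have hw : 0 < ‖w‖ := norm_pos_iff.mpr hzw.2.1
  rcases lt_or_ge ‖z‖ δ with h1 | h1
  · exact (h z w h1 hzw).trans (mul_le_mul_of_nonneg_right (le_max_left _ _) hz.le)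
  rcases lt_or_ge δ⁻¹ ‖w‖ with h2 | h2
  · have h3 := h (circleRefl w) (circleRefl z)
      (by rw [norm_circleRefl]; exact inv_lt_of_inv_lt₀ hδ h2) hzw.symm.reflect
    rw [norm_circleRefl, norm_circleRefl, ← div_eq_mul_inv, ← one_div, div_le_div_iff₀ hz hw] at h3
    refine le_trans ?_ (mul_le_mul_of_nonneg_right (le_max_left _ _) hz.le)
    linarith
  · refine h2.trans (le_trans ?_ (mul_le_mul (le_max_right 4 _) h1 hδ.le (by positivity)))
    rw [div_mul_cancel₀ _ hδ.ne']

theorem exists_germRelClosure_norm_le_mul :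
    ∃ C > 0, ∀ z w, GermRelClosure f z w → ‖w‖ ≤ C * ‖z‖ := by
  obtain ⟨C, hC, h⟩ := hf.exists_norm_le_mul
  refine ⟨C, hC, fun z w hzw => ?_⟩
  by_contra! hcon
  have ho : IsOpen {p : ℂ × ℂ | C * ‖p.1‖ < ‖p.2‖} :=
    isOpen_lt (continuous_const.mul continuous_fst.norm) continuous_snd.norm
  obtain ⟨p, h1, h2⟩ := (Filter.Frequently.and_eventually hzw (ho.mem_nhds hcon)).exists
  exact absurd (h _ _ h1) (not_le.mpr h2)

end IsTranscendentalMeromorphic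
end transcendental

/-! ### Liouville's theorem makes invariant germs linear -/

section transcendental
open Filter Topology

theorem finite_of_eventually_notMem {X : Type*} [TopologicalSpace X] {C : Set X}
    (hC : IsCompact C) (h : ∀ z ∈ C, ∀ᶠ ζ in 𝓝[≠] z, ζ ∉ C) : C.Finite := by
  refine hC.finite (isDiscrete_iff_nhdsNE.mpr fun z hz => ?_)
  rw [← disjoint_iff, disjoint_principal_right]
  exact h z hz

theorem GermRel.refl {f : ℂ → ℂ} {z : ℂ} (hz : z ≠ 0) : GermRel f z z :=
  ⟨hz, hz, id, id, analyticAt_id, analyticAt_id, rfl, rfl, Eventually.of_forall fun _ => rfl,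
    Eventually.of_forall fun _ => rfl, Eventually.of_forall fun _ => ⟨rfl, rfl⟩⟩

/-- Points at which `f` is holomorphic and which are not related to a critical point. -/
structure IsRegularPoint (f : ℂ → ℂ) (z : ℂ) : Prop where
  ne_zero : z ≠ 0
  analyticAt : AnalyticAt ℂ f z
  deriv_ne : ∀ w, GermRelClosure f z w → deriv f w ≠ 0

theorem IsRegularPoint.deriv_ne_self {f : ℂ → ℂ} {z : ℂ} (h : IsRegularPoint f z) :
    deriv f z ≠ 0 := h.deriv_ne z (GermRel.refl h.ne_zero).closure

/-- The product of the normalized differences `x - w / z` over all points `w` related to `z`. -/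
noncomputable def germRelProd (f : ℂ → ℂ) (C : ℝ) (x z : ℂ) : ℂ :=
  ∏ᶠ w ∈ {w | GermRel f z w}, (x - w / z) / ((‖x‖ + C : ℝ) : ℂ)

namespace IsTranscendentalMeromorphic
variable {f : ℂ → ℂ} (hf : IsTranscendentalMeromorphic f)
include hf

theorem ne_zero_of_germRelClosure {z w : ℂ} (hz : z ≠ 0) (h : GermRelClosure f z w) : w ≠ 0 := by
  rintro rfl
  exact hf.not_germRelClosure_zero_right hz h

/-- Points related to some `z` near `z₁` lie in a fixed disk and have the value `f z`. That disk
holds only finitely many critical points, whose values `f z` avoids for `z` near but different from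
`z₁`. -/
theorem eventually_isRegularPoint (z₁ : ℂ) : ∀ᶠ z in 𝓝[≠] z₁, IsRegularPoint f z := by
  obtain ⟨C, hC, h⟩ := hf.exists_germRelClosure_norm_le_mul
  have hfin : (closedBall 0 (C * (‖z₁‖ + 1)) ∩
      {z | ¬ (AnalyticAt ℂ f z ∧ deriv f z ≠ 0)}).Finite :=
    finite_of_eventually_notMem ((isCompact_closedBall _ _).inter_right (isClosed_critical f))
      fun z _ => ((hf.meromorphic z).eventually_analyticAt.and (hf.deriv_ne z)).mono
        fun _ h1 h2 => h2.2 h1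
  have h1 := (eventually_all_finite hfin (l := 𝓝[≠] z₁) (p := fun w z => f z ≠ f w)).mpr
    fun w _ => hf.eventually_ne z₁ (f w)
  have h2 : ∀ᶠ z in 𝓝[≠] z₁, ‖z‖ < ‖z₁‖ + 1 := mem_nhdsWithin_of_mem_nhds
    ((isOpen_lt continuous_norm continuous_const).mem_nhds
      (show ‖z₁‖ < ‖z₁‖ + 1 from lt_add_one _))
  filter_upwards [h1, h2, eventually_nhdsNE_ne z₁ 0, (hf.meromorphic z₁).eventually_analyticAt]
    with z h3 h4 h5 h6
  refine ⟨h5, h6, fun w hw h7 => ?_⟩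
  have hwa := hf.analyticAt_of_germRelClosure hw h6.continuousAt
  refine h3 w ⟨?_, fun h8 => h8.2 h7⟩
    (hw.map_eq hf.meromorphic h6.continuousAt hwa.continuousAt).symm
  rw [mem_closedBall_zero_iff]
  exact (h z w hw).trans (mul_le_mul_of_nonneg_left h4.le hC.le)

theorem germRel_of_isRegularPoint {z w : ℂ} (hz : IsRegularPoint f z) (h : GermRelClosure f z w) :
    GermRel f z w :=
  h.germRel hf.meromorphic hz.ne_zero (hf.ne_zero_of_germRelClosure hz.ne_zero h) hz.analyticAt
    hz.deriv_ne_self (hf.analyticAt_of_germRelClosure h hz.analyticAt.continuousAt)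
    (hz.deriv_ne w h)

/-- Near a regular point the relation is a union of finitely many disjoint graphs. -/
theorem exists_germs {z₀ : ℂ} (hz₀ : IsRegularPoint f z₀) :
    ∃ (T : Finset ℂ) (ρ : ℂ → ℂ → ℂ), (∀ w ∈ T, AnalyticAt ℂ (ρ w) z₀) ∧
      ∀ᶠ z in 𝓝 z₀, {w | GermRel f z w} = (fun w => ρ w z) '' T ∧
        InjOn (fun w => ρ w z) (T : Set ℂ) := by
  obtain ⟨C, hC, hbd⟩ := hf.exists_germRelClosure_norm_le_mul
  have hex : ∀ w, GermRelClosure f z₀ w → ∃ ρ σ, IsInvariantGerm f (circleConj f) ρ σ z₀ w ∧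
      ∀ᶠ p : ℂ × ℂ in 𝓝 (z₀, w), GermRel f p.1 p.2 → p.2 = ρ p.1 := fun w hw =>
    hw.exists_germ hf.meromorphic hz₀.ne_zero (hf.ne_zero_of_germRelClosure hz₀.ne_zero hw)
      hz₀.analyticAt hz₀.deriv_ne_self (hf.analyticAt_of_germRelClosure hw
        hz₀.analyticAt.continuousAt) (hz₀.deriv_ne w hw)
  choose! ρ σ hg huniq using hex
  have hcl : IsClosed {w | GermRelClosure f z₀ w} :=
    (isClosed_germRelClosure f).preimage (f := fun w => (z₀, w)) (by fun_prop)
  have hcpt : IsCompact {w | GermRelClosure f z₀ w} :=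
    (isCompact_closedBall (0 : ℂ) (C * ‖z₀‖)).of_isClosed_subset hcl
      fun w hw => mem_closedBall_zero_iff.mpr (hbd z₀ w hw)
  -- The fibre is compact by the norm bound, and discrete because near each of its points the
  -- relation is a graph.
  have hfin : {w | GermRelClosure f z₀ w}.Finite := by
    refine finite_of_eventually_notMem hcpt fun w hw => ?_
    have ht : Tendsto (fun ω => (z₀, ω)) (𝓝 w) (𝓝 (z₀, w)) :=
      (Continuous.prodMk_right z₀).tendsto w
    filter_upwards [(ht.eventually (huniq w hw)).filter_mono nhdsWithin_le_nhds,
      self_mem_nhdsWithin] with ω h1 h2 h3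
    have h4 := h1 (hf.germRel_of_isRegularPoint hz₀ h3)
    rw [(hg w hw).map_eq] at h4
    exact h2 h4
  have hT : ∀ w ∈ hfin.toFinset, GermRelClosure f z₀ w := fun w hw => hfin.mem_toFinset.mp hw
  refine ⟨hfin.toFinset, ρ, fun w hw => (hg w (hT w hw)).analyticAt, ?_⟩
  have h1 : ∀ᶠ z in 𝓝 z₀, ∀ w ∈ hfin.toFinset, GermRel f z (ρ w z) :=
    (eventually_all_finset _).mpr fun w hw =>
      (hg w (hT w hw)).eventually_germRel hz₀.ne_zero
        (hf.ne_zero_of_germRelClosure hz₀.ne_zero (hT w hw))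
  have h2 : ∀ᶠ z in 𝓝 z₀, ∀ w ∈ hfin.toFinset, ∀ w' ∈ hfin.toFinset, w ≠ w' → ρ w z ≠ ρ w' z := by
    refine (eventually_all_finset _).mpr fun w hw => (eventually_all_finset _).mpr fun w' hw' => ?_
    refine eventually_imp_distrib_left.mpr fun hne => ?_
    refine (hg w (hT w hw)).analyticAt.continuousAt.ne_iff_eventually_ne
      (hg w' (hT w' hw')).analyticAt.continuousAt |>.mp ?_
    rwa [(hg w (hT w hw)).map_eq, (hg w' (hT w' hw')).map_eq]
  have h3 : ∀ᶠ z in 𝓝 z₀, ∀ w ∈ closedBall (0 : ℂ) (C * (‖z₀‖ + 1)), GermRel f z w →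
      ∃ v ∈ hfin.toFinset, ρ v z = w := by
    refine (isCompact_closedBall _ _).eventually_forall_of_forall_eventually
      (P := fun z w => GermRel f z w → ∃ v ∈ hfin.toFinset, ρ v z = w) fun w _ => ?_
    by_cases hw : GermRelClosure f z₀ w
    · exact (huniq w hw).mono fun p h4 h5 => ⟨w, hfin.mem_toFinset.mpr hw, (h4 h5).symm⟩
    · exact (not_frequently.mp hw).mono fun p h4 h5 => absurd h5 h4
  have h4 : ∀ᶠ z in 𝓝 z₀, ‖z‖ < ‖z₀‖ + 1 :=
    (isOpen_lt continuous_norm continuous_const)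
      |>.mem_nhds (show ‖z₀‖ < ‖z₀‖ + 1 from lt_add_one _)
  filter_upwards [h1, h2, h3, h4] with z h1 h2 h3 h4
  refine ⟨Subset.antisymm (fun w hw => ?_) ?_, fun w hw w' hw' h => ?_⟩
  · exact h3 w (mem_closedBall_zero_iff.mpr ((hbd z w (GermRel.closure hw)).trans
      (mul_le_mul_of_nonneg_left h4.le hC.le))) hw
  · rintro _ ⟨w, hw, rfl⟩
    exact h1 w hw
  · by_contra hne
    exact h2 w hw w' hw' hne h

theorem finite_germRel {z : ℂ} (hz : IsRegularPoint f z) : {w | GermRel f z w}.Finite := by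
  obtain ⟨T, ρ, -, h⟩ := hf.exists_germs hz
  rw [h.self_of_nhds.1]
  exact T.finite_toSet.image _

theorem analyticAt_germRelProd {C : ℝ} {x z₀ : ℂ} (hz₀ : IsRegularPoint f z₀) :
    AnalyticAt ℂ (germRelProd f C x) z₀ := by
  obtain ⟨T, ρ, hρ, h⟩ := hf.exists_germs hz₀
  have h1 : AnalyticAt ℂ (fun z => ∏ w ∈ T, (x - ρ w z / z) / ((‖x‖ + C : ℝ) : ℂ)) z₀ :=
    Finset.analyticAt_fun_prod _ fun w hw =>
      (analyticAt_const.sub ((hρ w hw).div analyticAt_id hz₀.ne_zero)).fun_mul analyticAt_const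
  refine h1.congr (h.mono fun z hz => ?_)
  rw [germRelProd, hz.1, finprod_mem_image hz.2, finprod_mem_coe_finset]

/-- Each factor has norm at most 1 by the choice of the normalization, so no bound on the number of
related points is needed. -/
theorem norm_germRelProd_le_one {C : ℝ} (hC : 0 < C) (h : ∀ z w, GermRel f z w → ‖w‖ ≤ C * ‖z‖)
    {x z : ℂ} (hz : IsRegularPoint f z) : ‖germRelProd f C x z‖ ≤ 1 := by
  rw [germRelProd, finprod_mem_eq_finite_toFinset_prod _ (hf.finite_germRel hz), norm_prod]
  refine Finset.prod_le_one (fun w _ => norm_nonneg _) fun w hw => ?_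
  have hw' : GermRel f z w := (hf.finite_germRel hz).mem_toFinset.mp hw
  have hx : 0 < ‖x‖ + C := by positivity
  rw [norm_div, Complex.norm_real, Real.norm_of_nonneg hx.le, div_le_one hx]
  refine (norm_sub_le _ _).trans (add_le_add_right ?_ _)
  rw [norm_div, div_le_iff₀ (norm_pos_iff.mpr hz.ne_zero)]
  exact h z w hw'

/-- The product is holomorphic at regular points and bounded by 1 there; the remaining points are
isolated, so the singularities are removable and Liouville's theorem applies. -/
theorem germRelProd_eq {C : ℝ} (hC : 0 < C) (h : ∀ z w, GermRel f z w → ‖w‖ ≤ C * ‖z‖) {x z z' : ℂ}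
    (hz : IsRegularPoint f z) (hz' : IsRegularPoint f z') :
    germRelProd f C x z = germRelProd f C x z' := by
  set P := germRelProd f C x
  have hb : ∀ ζ, ∀ᶠ ω in 𝓝[≠] ζ, ‖P ω‖ ≤ 1 := fun ζ =>
    (hf.eventually_isRegularPoint ζ).mono fun ω hω => hf.norm_germRelProd_le_one hC h hω
  have hmer : MeromorphicOn P univ := fun ζ _ =>
    meromorphicAt_of_differentiable_of_norm_le ((hf.eventually_isRegularPoint ζ).mono
      fun ω hω => (hf.analyticAt_germRelProd hω).differentiableAt) (hb ζ)
  set H := toMeromorphicNFOn P univ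
  have hHP : ∀ ζ, H =ᶠ[𝓝[≠] ζ] P := fun ζ =>
    hmer.toMeromorphicNFOn_eq_self_on_nhdsNE (mem_univ ζ)
  have hH : ∀ ζ, AnalyticAt ℂ H ζ ∧ ‖H ζ‖ ≤ 1 := fun ζ =>
    (meromorphicNFOn_toMeromorphicNFOn P univ (mem_univ ζ)).analyticAt_of_eventually_norm_le
      (by filter_upwards [hHP ζ, hb ζ] with ω h1 h2; exact (congrArg norm h1).trans_le h2)
  have heq : ∀ ζ, IsRegularPoint f ζ → H ζ = P ζ := fun ζ hζ =>
    tendsto_nhds_unique ((hH ζ).1.continuousAt.tendsto.mono_left nhdsWithin_le_nhds)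
      (((hf.analyticAt_germRelProd hζ).continuousAt.tendsto.mono_left
        nhdsWithin_le_nhds).congr' (hHP ζ).symm)
  rw [← heq z hz, ← heq z' hz']
  refine Differentiable.apply_eq_apply_of_bounded (fun ζ => (hH ζ).1.differentiableAt) ?_ z z'
  exact isBounded_iff_forall_norm_le.mpr ⟨1, by rintro _ ⟨ζ, rfl⟩; exact (hH ζ).2⟩

/-- A germ of an invariant map is the germ of a linear map. -/
theorem germRel_div_mul {z₀ w₀ z : ℂ} (hz₀ : IsRegularPoint f z₀) (h₀ : GermRel f z₀ w₀)
    (hz : IsRegularPoint f z) : GermRel f z (w₀ / z₀ * z) := by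
  obtain ⟨C, hC, h⟩ := hf.exists_norm_le_mul
  -- With `x = w₀ / z₀` the product vanishes at `z₀`, hence at every regular point; a vanishing
  -- factor at `z` is a related point with the same ratio.
  have h1 : germRelProd f C (w₀ / z₀) z₀ = 0 := by
    rw [germRelProd, finprod_mem_eq_finite_toFinset_prod _ (hf.finite_germRel hz₀)]
    refine Finset.prod_eq_zero ((hf.finite_germRel hz₀).mem_toFinset.mpr h₀) ?_
    rw [sub_self, zero_div]
  rw [hf.germRelProd_eq hC h hz₀ hz, germRelProd,
    finprod_mem_eq_finite_toFinset_prod _ (hf.finite_germRel hz), Finset.prod_eq_zero_iff] at h1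
  obtain ⟨w, hw, h2⟩ := h1
  have hx : ((‖w₀ / z₀‖ + C : ℝ) : ℂ) ≠ 0 := by
    rw [Complex.ofReal_ne_zero]; positivity
  rw [div_eq_zero_iff, or_iff_left hx, sub_eq_zero] at h2
  rw [h2, div_mul_cancel₀ _ hz.ne_zero]
  exact (hf.finite_germRel hz).mem_toFinset.mp hw

theorem eventually_comp_mul_eq {z₀ w₀ : ℂ} (hz₀ : IsRegularPoint f z₀) (h₀ : GermRel f z₀ w₀) :
    ∀ᶠ z in 𝓝 (0 : ℂ), f (w₀ / z₀ * z) = f z := by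
  have h1 : Tendsto (fun z : ℂ => w₀ / z₀ * z) (𝓝 0) (𝓝 0) := by
    have : Continuous fun z : ℂ => w₀ / z₀ * z := by fun_prop
    simpa using this.tendsto 0
  have h2 := hf.analyticAt_zero.eventually_analyticAt
  have h3 := eventually_nhdsWithin_iff.mp (hf.eventually_isRegularPoint 0)
  filter_upwards [h1.eventually h2, h2, h3] with z h4 h5 h6
  rcases eq_or_ne z 0 with rfl | hz
  · rw [mul_zero]
  · exact (hf.germRel_div_mul hz₀ h₀ (h6 hz)).map_eq h5.continuousAt h4.continuousAt

end IsTranscendentalMeromorphic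
end transcendental

/-! ### The group of invariant rotations and the transcendental case -/

section transcendental
open Filter Topology

/-- The rotations which leave the germ of `f` at the origin invariant. -/
def rotationSubgroup (f : ℂ → ℂ) : Subgroup ℂˣ where
  carrier := {c | ∀ᶠ z in 𝓝 (0 : ℂ), f (c * z) = f z}
  one_mem' := Eventually.of_forall fun z => by simp
  mul_mem' {a b} ha hb := by
    have h1 : Tendsto (fun z : ℂ => (b : ℂ) * z) (𝓝 0) (𝓝 0) := by
      simpa using (continuous_const_mul (b : ℂ)).tendsto 0
    filter_upwards [h1.eventually ha, hb] with z h2 h3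
    rw [Units.val_mul, mul_assoc, h2, h3]
  inv_mem' {a} ha := by
    have h1 : Tendsto (fun z : ℂ => ((a⁻¹ : ℂˣ) : ℂ) * z) (𝓝 0) (𝓝 0) := by
      simpa using (continuous_const_mul ((a⁻¹ : ℂˣ) : ℂ)).tendsto 0
    filter_upwards [h1.eventually ha] with z h2
    rw [← h2, Units.mul_inv_cancel_left]

theorem mem_rotationSubgroup {f : ℂ → ℂ} {c : ℂˣ} :
    c ∈ rotationSubgroup f ↔ ∀ᶠ z in 𝓝 (0 : ℂ), f (c * z) = f z := Iff.rfl

/-- `ψ` is `f` composed with the principal k-th root. The discontinuity of the root is harmless,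
since `f` does not see the choice of root; at 0 continuity makes the singularity removable. -/
theorem exists_isHInfty_comp_pow {f : ℂ → ℂ} (hf : ∀ z ∈ closedBall (0 : ℂ) 1, AnalyticAt ℂ f z)
    {k : ℕ} (hk : k ≠ 0)
    (h : ∀ z ∈ ball (0 : ℂ) 1, ∀ w ∈ ball (0 : ℂ) 1, w ^ k = z ^ k → f w = f z) :
    ∃ ψ, IsHInfty ψ ∧ ∀ z ∈ ball (0 : ℂ) 1, f z = ψ (z ^ k) := by
  set s : ℂ → ℂ := fun y => y ^ ((k : ℂ)⁻¹)
  have hs : ∀ y, s y ^ k = y := fun y => Complex.cpow_nat_inv_pow y hk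
  have hsb : ∀ y ∈ ball (0 : ℂ) 1, s y ∈ ball (0 : ℂ) 1 := fun y hy => by
    rw [mem_ball_zero_iff] at hy ⊢
    rw [← hs y, norm_pow] at hy
    exact (pow_lt_one_iff_of_nonneg (norm_nonneg _) hk).mp hy
  have hpow : ∀ z ∈ ball (0 : ℂ) 1, z ^ k ∈ ball (0 : ℂ) 1 := fun z hz => by
    rw [mem_ball_zero_iff] at hz ⊢
    rw [norm_pow]
    exact pow_lt_one₀ (norm_nonneg _) hz hk
  have hfac : ∀ z ∈ ball (0 : ℂ) 1, f z = f (s (z ^ k)) := fun z hz =>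
    (h z hz _ (hsb _ (hpow z hz)) (hs _)).symm
  have hana : ∀ y ∈ ball (0 : ℂ) 1, y ≠ 0 → AnalyticAt ℂ (fun y => f (s y)) y := by
    intro y hy hy0
    have hsy0 : s y ≠ 0 := fun h0 => hy0 (by rw [← hs y, h0, zero_pow hk])
    obtain ⟨r, hr, hry, -, hrr⟩ := AnalyticAt.exists_localInverse (f := fun z : ℂ => z ^ k)
      (w := s y) (analyticAt_id.fun_pow k)
      (by simp only [deriv_pow_field]; exact mul_ne_zero (by exact_mod_cast hk) (pow_ne_zero _ hsy0))
    simp only [hs] at hr hry hrr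
    have h1 : AnalyticAt ℂ (fun y => f (r y)) y :=
      AnalyticAt.fun_comp (g := f) (by rw [hry]; exact hf _ (ball_subset_closedBall (hsb y hy))) hr
    refine h1.congr ?_
    have h2 : ∀ᶠ y' in 𝓝 y, r y' ∈ ball (0 : ℂ) 1 :=
      hr.continuousAt.eventually (isOpen_ball.mem_nhds (by rw [hry]; exact hsb y hy))
    filter_upwards [hrr, h2] with y' h3 h4
    rw [hfac _ h4, h3]
  have hzero : AnalyticAt ℂ (fun y => f (s y)) 0 := by
    refine Complex.analyticAt_of_differentiable_on_punctured_nhds_of_continuousAt ?_ ?_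
    · filter_upwards [mem_nhdsWithin_of_mem_nhds (ball_mem_nhds (0 : ℂ) one_pos),
        self_mem_nhdsWithin] with y h1 h2
      exact (hana y h1 h2).differentiableAt
    · have hs0 : s 0 = 0 := (pow_eq_zero_iff hk).mp (hs 0)
      have hsc : ContinuousAt s 0 := by
        rw [ContinuousAt, hs0, Metric.tendsto_nhds]
        intro ε hε
        filter_upwards [ball_mem_nhds (0 : ℂ) (pow_pos hε k)] with y hy
        rw [mem_ball_zero_iff, ← hs y, norm_pow] at hy
        rw [dist_zero_right]
        exact lt_of_pow_lt_pow_left₀ k hε.le hy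
      refine ContinuousAt.comp (g := f) ?_ hsc
      rw [hs0]
      exact (hf 0 (mem_closedBall_self zero_le_one)).continuousAt
  obtain ⟨M, hM⟩ := (isCompact_closedBall (0 : ℂ) 1).exists_bound_of_continuousOn
    fun z hz => (hf z hz).continuousAt.continuousWithinAt
  refine ⟨fun y => f (s y), ⟨fun y hy => ?_, M, fun y hy => hM _
    (ball_subset_closedBall (hsb y hy))⟩, hfac⟩
  rcases eq_or_ne y 0 with rfl | hy0
  · exact hzero.differentiableAt.differentiableWithinAt
  · exact (hana y hy hy0).differentiableAt.differentiableWithinAt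

namespace IsTranscendentalMeromorphic
variable {f : ℂ → ℂ} (hf : IsTranscendentalMeromorphic f)
include hf

/-- Here `l` is the vanishing order of `f - f 0` at 0: comparing leading terms of `f (c z)` and `f
z` gives `c ^ l = 1`. -/
theorem exists_rotationSubgroup_le : ∃ l ≠ 0, rotationSubgroup f ≤ rootsOfUnity l ℂ := by
  obtain ⟨l, hl, h, hh, hh0, hev⟩ := hf.exists_eventually_sub_eq_pow_mul
  refine ⟨l, hl, fun c hc => ?_⟩
  have h1 : Tendsto (fun z : ℂ => (c : ℂ) * z) (𝓝 0) (𝓝 0) := by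
    simpa using (continuous_const_mul (c : ℂ)).tendsto 0
  have h2 : ∀ᶠ z in 𝓝[≠] (0 : ℂ), (c : ℂ) ^ l * h (c * z) = h z := by
    filter_upwards [self_mem_nhdsWithin, (h1.eventually hev).filter_mono nhdsWithin_le_nhds,
      hev.filter_mono nhdsWithin_le_nhds,
      (mem_rotationSubgroup.mp hc).filter_mono nhdsWithin_le_nhds] with z h3 h4 h5 h6
    rw [h6, h5, mul_pow] at h4
    refine mul_left_cancel₀ (pow_ne_zero l h3) ?_
    rw [h4]; ring
  have h3 : Tendsto (fun z => (c : ℂ) ^ l * h (c * z)) (𝓝[≠] 0) (𝓝 ((c : ℂ) ^ l * h 0)) :=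
    ((hh.continuousAt.tendsto.comp h1).const_mul _).mono_left nhdsWithin_le_nhds
  have h4 := tendsto_nhds_unique (h3.congr' h2)
    (hh.continuousAt.tendsto.mono_left nhdsWithin_le_nhds)
  rw [mem_rootsOfUnity]
  exact Units.ext (mul_right_cancel₀ hh0 (by simpa using h4))

/-- The invariant rotations form the group of roots of unity of some order. -/
theorem exists_rotationSubgroup_eq : ∃ k ≠ 0, rotationSubgroup f = rootsOfUnity k ℂ := by
  obtain ⟨l, hl, hle⟩ := hf.exists_rotationSubgroup_le
  have : NeZero l := ⟨hl⟩
  have : Finite (rotationSubgroup f) := Finite.of_injective _ (Subgroup.inclusion_injective hle)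
  have hk : Nat.card (rotationSubgroup f) ≠ 0 := Nat.card_pos.ne'
  have : NeZero (Nat.card (rotationSubgroup f)) := ⟨hk⟩
  -- With `k` the order of the group, Lagrange puts it inside the k-th roots of unity, and the
  -- cardinalities agree.
  refine ⟨_, hk, Subgroup.eq_of_le_of_card_ge (fun c hc => ?_) (card_rootsOfUnity ℂ _)⟩
  rw [mem_rootsOfUnity]
  exact Subtype.ext_iff.mp (pow_card_eq_one' (x := (⟨c, hc⟩ : rotationSubgroup f)))

theorem countable_setOf_eq (c : ℂ) : {z | f z = c}.Countable :=
  countable_of_eventually_notMem fun z _ => hf.eventually_ne z c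

theorem countable_not_isRegularPoint : {z | ¬ IsRegularPoint f z}.Countable :=
  countable_of_eventually_notMem fun z _ =>
    (hf.eventually_isRegularPoint z).mono fun _ h => not_not.mpr h

omit hf in
/-- Only countably many pairs of noncritical points of the circle with the same value are
unrelated. -/
theorem countable_not_germRel (han : ∀ z ∈ closedBall (0 : ℂ) 1, AnalyticAt ℂ f z) :
    {p : ℂ × ℂ | ‖p.1‖ = 1 ∧ ‖p.2‖ = 1 ∧ deriv f p.1 ≠ 0 ∧ deriv f p.2 ≠ 0 ∧ f p.2 = f p.1 ∧
      ¬ GermRel f p.1 p.2}.Countable := by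
  refine countable_of_eventually_notMem ?_
  rintro ⟨ξ, w⟩ ⟨hξ, hw, hξ', hw', hval, hrel⟩
  have hmem : ∀ {u : ℂ}, ‖u‖ = 1 → u ∈ closedBall (0 : ℂ) 1 := fun h =>
    mem_closedBall_zero_iff.mpr h.le
  have hne : ∀ {u : ℂ}, ‖u‖ = 1 → u ≠ 0 := fun h => by rintro rfl; simp at h
  have hg : ∀ {u : ℂ}, ‖u‖ = 1 → AnalyticAt ℂ (circleConj f) u := fun h =>
    AnalyticAt.circleConj (hne h) (by rw [circleRefl_eq_self h]; exact han _ (hmem h))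
  have hgv : ∀ {u : ℂ}, ‖u‖ = 1 → circleConj f u = (starRingEnd ℂ) (f u) := fun h => by
    rw [circleConj_apply, circleRefl_eq_self h]
  obtain ⟨ρ, σ, hρa, hσa, hρ, hσ, hσρ, hρσ, hρf, huniq⟩ := exists_germ_of_map_eq (han ξ (hmem hξ))
    hξ' (han w (hmem hw)) hw' hval
  by_contra hcon
  refine hrel ⟨hne hξ, hne hw, ρ, σ, hρa, hσa, hρ, hσ, hσρ, hρσ, ?_⟩
  -- If the pair is an accumulation point of the set, the germ `ρ` preserving `f` maps circle points
  -- near `ξ` to circle points. There the reflection of `f` is its conjugate, so `ρ` preserves it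
  -- too, and by the identity theorem near `ξ`.
  have h1 : ∃ᶠ ζ in 𝓝[≠] ξ, circleConj f (ρ ζ) = circleConj f ζ := by
    intro h2
    refine hcon ?_
    have h3 := (continuous_fst.tendsto (ξ, w)).eventually (eventually_nhdsWithin_iff.mp h2)
    filter_upwards [self_mem_nhdsWithin, huniq.filter_mono nhdsWithin_le_nhds,
      h3.filter_mono nhdsWithin_le_nhds]
    rintro ⟨x, y⟩ h4 h5 h6 ⟨hx, hy, -, -, hxy, -⟩
    have h7 : y = ρ x := h5 hxy
    refine h6 (fun h8 => h4 ?_) ?_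
    · have h9 : x = ξ := h8
      rw [mem_singleton_iff, h7, h9, hρ]
    · have h9 : ‖ρ x‖ = 1 := h7 ▸ hy
      have h10 : f y = f x := hxy
      change circleConj f (ρ x) = circleConj f x
      rw [hgv h9, hgv hx, ← h7, h10]
  have h2 := (AnalyticAt.frequently_eq_iff_eventually_eq
    (AnalyticAt.fun_comp (g := circleConj f) (by rw [hρ]; exact hg hw) hρa) (hg hξ)).mp h1
  filter_upwards [hρf.filter_mono nhdsWithin_le_nhds, h2.filter_mono nhdsWithin_le_nhds]
    with ζ h3 h4
  exact ⟨h3, h4⟩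

theorem hasBlaschkeFactorization (han : ∀ z ∈ closedBall (0 : ℂ) 1, AnalyticAt ℂ f z) :
    HasBlaschkeFactorization f := by
  obtain ⟨k, hk, hG⟩ := hf.exists_rotationSubgroup_eq
  have hrot : ∀ z ∈ ball (0 : ℂ) 1, ∀ w ∈ ball (0 : ℂ) 1, w ^ k = z ^ k → f w = f z := by
    intro z hz w hw hwz
    rcases eq_or_ne z 0 with rfl | hz0
    · rw [zero_pow hk, pow_eq_zero_iff hk] at hwz
      rw [hwz]
    have hc1 : (w / z) ^ k = 1 := by rw [div_pow, hwz, div_self (pow_ne_zero k hz0)]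
    have hc0 : w / z ≠ 0 := fun h => by rw [h, zero_pow hk] at hc1; exact zero_ne_one hc1
    have hcn : ‖w / z‖ = 1 := by
      refine (pow_eq_one_iff_of_nonneg (norm_nonneg _) hk).mp ?_
      rw [← norm_pow, hc1, norm_one]
    have hmem : Units.mk0 (w / z) hc0 ∈ rotationSubgroup f := by
      rw [hG, mem_rootsOfUnity]
      exact Units.ext (by simpa using hc1)
    have hcomp : AnalyticOnNhd ℂ (fun u => f (w / z * u)) (ball 0 1) := fun u hu => by
      refine AnalyticAt.fun_comp (g := f) (han _ ?_) (analyticAt_const.fun_mul analyticAt_id)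
      rw [mem_closedBall_zero_iff, norm_mul, hcn, one_mul]
      exact (mem_ball_zero_iff.mp hu).le
    have h1 := hcomp.eqOn_of_preconnected_of_eventuallyEq
      (fun u hu => han u (ball_subset_closedBall hu)) (convex_ball (0 : ℂ) 1).isPreconnected
      (mem_ball_self one_pos) (mem_rotationSubgroup.mp hmem) hz
    simpa [div_mul_cancel₀ _ hz0] using h1
  obtain ⟨ψ, hψ, hfac⟩ := exists_isHInfty_comp_pow han hk hrot
  have hB : ∀ z, blaschkeFun 1 (0 : Fin k → ℂ) z = z ^ k := fun z => by simp [blaschkeFun]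
  set X := {p : ℂ × ℂ | ‖p.1‖ = 1 ∧ ‖p.2‖ = 1 ∧ deriv f p.1 ≠ 0 ∧ deriv f p.2 ≠ 0 ∧
    f p.2 = f p.1 ∧ ¬ GermRel f p.1 p.2}
  set Y := ⋃ w ∈ {z | ¬ (AnalyticAt ℂ f z ∧ deriv f z ≠ 0)}, {z | f z = f w}
  -- The Blaschke product is `z ^ k`. Excluded are nonregular points, points with the value of a
  -- critical point (so that `w` is noncritical too), and first coordinates of the countably many
  -- unrelated pairs.
  refine ⟨k, 1, 0, ψ, ({z | ¬ IsRegularPoint f z} ∪ Y) ∪ Prod.fst '' X, hk.bot_lt, norm_one,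
    fun i => mem_ball_self one_pos, hψ, fun z hz => by rw [hB]; exact hfac z hz,
    (hf.countable_not_isRegularPoint.union (hf.countable_critical.biUnion
      fun w _ => hf.countable_setOf_eq (f w))).union ((countable_not_germRel han).image _), ?_⟩
  rintro ξ ⟨hξ, hξE⟩ w hw hval
  rw [mem_union, mem_union, not_or, not_or] at hξE
  obtain ⟨⟨hreg, hY⟩, hX⟩ := hξE
  have hreg' : IsRegularPoint f ξ := not_not.mp hreg
  have hw' : deriv f w ≠ 0 := fun h => hY <| by
    exact mem_biUnion (x := w) (fun h1 => h1.2 h) hval.symm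
  have hrel : GermRel f ξ w := by
    by_contra hcon
    exact hX ⟨(ξ, w), ⟨mem_sphere_zero_iff_norm.mp hξ, mem_sphere_zero_iff_norm.mp hw,
      hreg'.deriv_ne_self, hw', hval, hcon⟩, rfl⟩
  have hc0 : w / ξ ≠ 0 := div_ne_zero hrel.2.1 hrel.1
  have hmem : Units.mk0 (w / ξ) hc0 ∈ rotationSubgroup f :=
    mem_rotationSubgroup.mpr (hf.eventually_comp_mul_eq hreg' hrel)
  rw [hG, mem_rootsOfUnity, Units.ext_iff] at hmem
  have h1 : (w / ξ) ^ k = 1 := by simpa using hmem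
  rw [hB, hB]
  rwa [div_pow, div_eq_one_iff_eq (pow_ne_zero k hrel.1)] at h1

end IsTranscendentalMeromorphic
end transcendental

/-! ### Functions meromorphic at infinity are rational -/

section rational
open Filter Topology

/-- An entire function with a pole at infinity is a polynomial. -/
theorem Differentiable.exists_polynomial_of_tendsto {N : ℕ} : ∀ {H : ℂ → ℂ} {c : ℂ},
    Differentiable ℂ H → Tendsto (fun z => z ^ N * H z⁻¹) (𝓝[≠] 0) (𝓝 c) →
      ∃ P : Polynomial ℂ, ∀ z, H z = P.eval z := by
  induction N with
  | zero =>
    intro H c hH hc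
    have h1 : Tendsto H (cocompact ℂ) (𝓝 c) := by
      rw [← Metric.cobounded_eq_cocompact]
      simpa [Function.comp_def] using hc.comp Filter.tendsto_inv₀_cobounded'
    exact ⟨Polynomial.C c, fun z => by
      rw [hH.apply_eq_of_tendsto_cocompact z h1, Polynomial.eval_C]⟩
  | succ N ih =>
    intro H c hH hc
    -- `(H z - H 0) / z` is entire and has growth order one less at infinity; growth order 0 is
    -- Liouville's theorem.
    have hK : Differentiable ℂ (dslope H 0) := by
      rw [← differentiableOn_univ, Complex.differentiableOn_dslope univ_mem]
      exact hH.differentiableOn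
    have hpow : Tendsto (fun z : ℂ => z ^ (N + 1) * H 0) (𝓝[≠] 0) (𝓝 0) := by
      have : Continuous fun z : ℂ => z ^ (N + 1) * H 0 := by fun_prop
      simpa using (this.tendsto 0).mono_left nhdsWithin_le_nhds
    obtain ⟨P, hP⟩ := ih (c := c - 0) hK <| (hc.sub hpow).congr' <| by
      filter_upwards [self_mem_nhdsWithin] with z hz
      have hz0 : z ≠ 0 := hz
      rw [dslope_of_ne _ (inv_ne_zero hz0), slope_def_field, sub_zero, div_inv_eq_mul]
      ring
    refine ⟨Polynomial.C (H 0) + Polynomial.X * P, fun z => ?_⟩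
    have := sub_smul_dslope H 0 z
    rw [sub_zero, smul_eq_mul] at this
    simp only [Polynomial.eval_add, Polynomial.eval_C, Polynomial.eval_mul, Polynomial.eval_X]
    rw [← hP, this]
    ring

/-- A meromorphic function on the sphere is a quotient of polynomials. -/
theorem Meromorphic.exists_polynomial_mul_eq {f : ℂ → ℂ} (hf : Meromorphic f)
    (hinf : MeromorphicAt (fun z => f z⁻¹) 0) :
    ∃ P Q : Polynomial ℂ, Q ≠ 0 ∧ ∀ z, Q.eval z * f z = P.eval z := by
  have h1 : ∀ᶠ z in 𝓝[≠] (0 : ℂ), AnalyticAt ℂ f z⁻¹ := by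
    filter_upwards [hinf.eventually_analyticAt, self_mem_nhdsWithin] with z hz hz0
    have hz0' : z ≠ 0 := hz0
    have h2 := AnalyticAt.fun_comp (g := fun z => f z⁻¹) (f := fun z => z⁻¹) (x := z⁻¹)
      (by rwa [inv_inv]) (analyticAt_inv (inv_ne_zero hz0'))
    simpa using h2
  have h3 : ∀ᶠ z in cocompact ℂ, AnalyticAt ℂ f z := by
    rw [← Metric.cobounded_eq_cocompact]
    exact (Filter.tendsto_inv₀_cobounded'.eventually h1).mono fun z hz => by simpa using hz
  obtain ⟨K, hK, hKf⟩ := mem_cocompact.mp h3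
  have hScl : IsClosed {z | ¬ AnalyticAt ℂ f z} := (isOpen_analyticAt ℂ f).isClosed_compl
  -- Meromorphy at infinity makes `f` holomorphic outside a compact set, so the isolated singular
  -- points are finite in number and one polynomial clears them all.
  have hS : {z | ¬ AnalyticAt ℂ f z}.Finite := by
    refine finite_of_eventually_notMem (hK.of_isClosed_subset hScl fun z hz => ?_)
      fun z _ => (hf z).eventually_analyticAt.mono fun _ h => not_not.mpr h
    by_contra h
    exact hz (hKf h)
  choose n hn using hf
  set Q : Polynomial ℂ := ∏ s ∈ hS.toFinset, (Polynomial.X - Polynomial.C s) ^ n s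
  have hQ : Q.Monic := Polynomial.monic_prod_of_monic _ _ fun s _ =>
    (Polynomial.monic_X_sub_C s).pow _
  have hH : Differentiable ℂ fun z => Q.eval z * f z := by
    intro z
    refine AnalyticAt.differentiableAt ?_
    by_cases hz : AnalyticAt ℂ f z
    · exact (Q.differentiable.analyticAt z).fun_mul hz
    · have hz' : z ∈ hS.toFinset := hS.mem_toFinset.mpr hz
      set Q₁ : Polynomial ℂ := ∏ s ∈ hS.toFinset.erase z, (Polynomial.X - Polynomial.C s) ^ n s
      have h4 := (Q₁.differentiable.analyticAt z).fun_mul (hn z)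
      refine h4.congr (Eventually.of_forall fun ζ => ?_)
      have h5 : Q = (Polynomial.X - Polynomial.C z) ^ n z * Q₁ :=
        (Finset.mul_prod_erase _ _ hz').symm
      simp only [h5, Polynomial.eval_mul, Polynomial.eval_pow, Polynomial.eval_sub,
        Polynomial.eval_X, Polynomial.eval_C, smul_eq_mul]
      ring
  have hQinf : MeromorphicAt (fun z : ℂ => Q.eval z⁻¹) 0 := by
      simp only [Polynomial.eval_eq_sum_range]
      exact MeromorphicAt.fun_sum fun i _ =>
        (MeromorphicAt.const _ _).fun_mul ((MeromorphicAt.id 0).inv.fun_pow i)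
  obtain ⟨N, hN⟩ := hQinf.fun_mul hinf
  obtain ⟨P, hP⟩ := hH.exists_polynomial_of_tendsto (N := N)
    ((hN.continuousAt.tendsto.mono_left nhdsWithin_le_nhds).congr fun z => by
      rw [sub_zero, smul_eq_mul])
  exact ⟨P, Q, hQ.ne_zero, hP⟩

theorem hasBlaschkeFactorization_of_meromorphicAt_comp_inv {f : ℂ → ℂ} (hf : Meromorphic f)
    (han : ∀ z ∈ closedBall (0 : ℂ) 1, AnalyticAt ℂ f z)
    (hnc : ¬ ∃ c, ∀ z ∈ closedBall (0 : ℂ) 1, f z = c)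
    (hinf : MeromorphicAt (fun z => f z⁻¹) 0) : HasBlaschkeFactorization f := by
  obtain ⟨P, Q, hQ, hPQ⟩ := hf.exists_polynomial_mul_eq hinf
  set r : RatFunc ℂ := algebraMap _ _ P / algebraMap _ _ Q
  have hr : r.num * Q = P * r.denom := (RatFunc.num_mul_eq_mul_denom_iff hQ).mpr rfl
  have hmul : ∀ z ∈ closedBall (0 : ℂ) 1, f z * r.denom.eval z = r.num.eval z := by
    intro z hz
    have h1 : ∀ᶠ ζ in 𝓝[≠] z, Q.eval ζ ≠ 0 := by
      have h2 := (Polynomial.finite_setOfPred_isRoot hQ).eventually_cofinite_notMem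
      exact h2.filter_mono (nhdsNE_le_cofinite z)
    have h2 : ∀ᶠ ζ in 𝓝[≠] z, f ζ * r.denom.eval ζ = r.num.eval ζ := by
      filter_upwards [h1] with ζ hζ
      refine mul_right_cancel₀ hζ ?_
      rw [← Polynomial.eval_mul, hr, Polynomial.eval_mul, ← hPQ]
      ring
    exact tendsto_nhds_unique
      (((han z hz).continuousAt.mul r.denom.continuous.continuousAt).tendsto.mono_left
        nhdsWithin_le_nhds)
      ((r.num.continuous.continuousAt.tendsto.mono_left nhdsWithin_le_nhds).congr'
        (h2.mono fun _ h => h.symm))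
  have hden : ∀ z ∈ closedBall (0 : ℂ) 1, r.denom.eval z ≠ 0 := by
    intro z hz h0
    have h1 := hmul z hz
    rw [h0, mul_zero] at h1
    obtain ⟨u, v, huv⟩ := r.isCoprime_num_denom
    have h2 := congrArg (Polynomial.eval z) huv
    simp [h0, ← h1] at h2
  have hfr : ∀ z ∈ closedBall (0 : ℂ) 1, f z = ratEval r z := fun z hz => by
    rw [ratEval_eq_div, eq_div_iff (hden z hz), hmul z hz]
  refine hasBlaschkeFactorization_of_ratFunc ?_ hden hfr
  rintro ⟨c, hc⟩
  exact hnc ⟨c, fun z hz => by rw [hfr z hz, hc, ratEval_C]⟩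

end rational

/-! ### Passage to the normal form and conclusion -/

section main
open Filter Topology

/-- The normal form of a meromorphic function holomorphic on the closed disk factors through a
finite Blaschke product which accounts for almost all self-intersections. -/
theorem hasBlaschkeFactorization_toMeromorphicNFOn {φ : ℂ → ℂ} (hφ : IsMeromorphicHolClosedDisk φ)
    (hnc : ¬ IsConstantMeromorphic φ) :
    HasBlaschkeFactorization (toMeromorphicNFOn φ univ) := by
  have hmer : MeromorphicOn φ univ := fun z _ => hφ.1 z
  have heq : ∀ z, toMeromorphicNFOn φ univ =ᶠ[𝓝[≠] z] φ := fun z =>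
    hmer.toMeromorphicNFOn_eq_self_on_nhdsNE (mem_univ z)
  have hnf : ∀ z, MeromorphicNFAt (toMeromorphicNFOn φ univ) z := fun z =>
    meromorphicNFOn_toMeromorphicNFOn φ univ (mem_univ z)
  set f := toMeromorphicNFOn φ univ
  have hf : Meromorphic f := fun z => (hnf z).meromorphicAt
  have han : ∀ z ∈ closedBall (0 : ℂ) 1, AnalyticAt ℂ f z := fun z hz =>
    (hnf z).analyticAt_of_tendsto (((hφ.2 z hz).continuousAt.tendsto.mono_left
      nhdsWithin_le_nhds).congr' (heq z).symm)
  have hconst : ∀ c, ¬ ∀ᶠ z in 𝓝[≠] (0 : ℂ), f z = c := by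
    intro c hc
    refine hnc ⟨c, mem_codiscrete.mpr fun z => disjoint_principal_right.mpr ?_⟩
    have h1 := MeromorphicOn.eventually_eq_of_eventually_eq (F := fun z => f z - c) (U := univ)
      (fun z _ => (hf z).fun_sub (MeromorphicAt.const c z)) isPreconnected_univ (mem_univ 0)
      (mem_univ z) (hc.mono fun z hz => sub_eq_zero.mpr hz)
    rw [compl_compl]
    filter_upwards [h1, heq z] with ζ h2 h3
    exact h3.symm.trans (sub_eq_zero.mp h2)
  -- This is the split into the rational and the transcendental case.
  by_cases hinf : MeromorphicAt (fun z => f z⁻¹) 0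
  · refine hasBlaschkeFactorization_of_meromorphicAt_comp_inv hf han ?_ hinf
    rintro ⟨c, hc⟩
    exact hconst c (mem_nhdsWithin_of_mem_nhds
      (mem_of_superset (closedBall_mem_nhds (0 : ℂ) one_pos) hc))
  refine IsTranscendentalMeromorphic.hasBlaschkeFactorization ⟨hnf, han 0 (by simp), fun z => ?_,
    hinf⟩ han
  rcases (hf z).deriv.eventually_eq_zero_or_eventually_ne_zero with h | h
  · exfalso
    have h1 := MeromorphicOn.eventually_eq_of_eventually_eq (F := deriv f) (U := univ)
      (fun z _ => (hf z).deriv) isPreconnected_univ (mem_univ z) (mem_univ 0) h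
    have h0 : AnalyticAt ℂ f 0 := han 0 (by simp)
    have h2 : ∀ᶠ ζ in 𝓝 (0 : ℂ), deriv f ζ = 0 :=
      (h0.deriv.continuousAt.eventuallyEq_nhds_iff_eventuallyEq_nhdsNE continuousAt_const).mp h1
    obtain ⟨ε, hε, hball⟩ := Metric.eventually_nhds_iff_ball.mp
      (h2.and h0.eventually_analyticAt)
    refine hconst (f 0) (mem_nhdsWithin_of_mem_nhds (mem_of_superset (ball_mem_nhds 0 hε)
      fun ζ hζ => ?_))
    exact isOpen_ball.is_const_of_deriv_eq_zero (convex_ball (0 : ℂ) ε).isPreconnected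
      (fun u hu => (hball u hu).2.differentiableAt.differentiableWithinAt)
      (fun u hu => (hball u hu).1) hζ (mem_ball_self hε)
  · exact h

theorem toMeromorphicNFOn_apply_of_analyticAt {φ : ℂ → ℂ} (hφ : Meromorphic φ) {z : ℂ}
    (hz : AnalyticAt ℂ φ z) : toMeromorphicNFOn φ univ z = φ z :=
  (((meromorphicNFOn_toMeromorphicNFOn φ univ (mem_univ z)
    ).eventuallyEq_nhdsNE_iff_eventuallyEq_nhds hz.meromorphicNFAt).mp
    (MeromorphicOn.toMeromorphicNFOn_eq_self_on_nhdsNE (fun z _ => hφ z) (mem_univ z))).eq_of_nhds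

end main

theorem mainTheorem10 (φ : ℂ → ℂ) (hφ : IsMeromorphicHolClosedDisk φ)
    (hnc : ¬ IsConstantMeromorphic φ) :
    (∃ E : Set ℂ, E.Countable ∧
      ∀ ξ ∈ sphere (0 : ℂ) 1 \ E, selfIntersectionMult φ ξ = (cowenThomsonOrder φ : ℕ∞)) ∧
    minSelfIntersectionMult φ = (cowenThomsonOrder φ : ℕ∞) := by
  obtain ⟨n, c, a, ψ, E, hn, hc, ha, hψ, hfac, hE, h⟩ :=
    hasBlaschkeFactorization_toMeromorphicNFOn hφ hnc
  have heq : ∀ z ∈ closedBall (0 : ℂ) 1, toMeromorphicNFOn φ univ z = φ z := fun z hz =>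
    toMeromorphicNFOn_apply_of_analyticAt hφ.1 (hφ.2 z hz)
  refine selfIntersectionMult_eq_of_factorization hφ.2 hn hc ha hψ (fun z hz => ?_) hE
    fun ξ hξ w hw hval => h ξ hξ w hw ?_
  · rw [← heq z (ball_subset_closedBall hz), hfac z hz]
  · rw [heq w (sphere_subset_closedBall hw), heq ξ (sphere_subset_closedBall hξ.1), hval]
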